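/- **Model.** There are $M$ sources with weights $w_m>0$, $\sum_{m=1}^M w_m=1$. Packet $i$ has transmission time $T_i$ and computation time $C_i$; the $T_i$ are i.i.d., the $C_i$ are i.i.d., the two sequences are independent, and both laws are those of positive random variables with a density and a finite mean. Packet $i\ge 1$ comes from source $m_i$ and is generated at time $s_i$, with $Z_i=s_{i+1}-s_i$. Packet $0$ has $s_0=-T_0-C_0$, is delivered at time $0$, and counts as the initial update of every source; $s_1\ge 0$. In the non-preemptive server, packet $i+1$ waits for $W_{i+1}=\max\{0,\;T_i+W_i+C_i-Z_i-T_{i+1}\}$ ($W_0=0$) and every packet is delivered. In the preemptive server $W_i=0$, and packet $i$ is delivered if and only if $s_i+T_i+C_i\le s_{i+1}+T_{i+1}$. A delivered packet is delivered at $r_i=s_i+T_i+W_i+C_i$. **Policies.** When the computation of packet $i$ starts, the history consists of $T_0,\dots,T_i$, $C_0,\dots,C_{i-1}$ and all earlier sources, generation times and private randomization. A causal scheduler selects $m_{i+1}$ from this history, possibly with fresh independent randomization. A causal sampler satisfies $Z_i\ge T_i+W_i$ and, from the history, $m_{i+1}$ and fresh independent randomization, selects for each $i\ge1$ a time $\Theta_i\in[0,\infty]$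 such that $Z_i=T_i+W_i+\Theta_i$ if $\Theta_i<C_i$, while $Z_i\ge T_i+W_i+C_i$ may also depend on $C_i$ if $C_i\le\Theta_i$. A policy is feasible if it consists of a causal scheduler and a causal sampler and, almost surely, for each source the fraction of the first $n$ packets that are delivered packets of this source converges as $n\to\infty$ (without preemption, these limits are the scheduling frequencies). A random scheduler with frequency vector $f=(f_1,\dots,f_M)$, $f_m\ge0$, $\sum_m f_m=1$, is a causal scheduler for which each $m_{i+1}$ has distribution $f$ and is independent of the history. **Cost.** For $k\ge1$ let $P^m_k=X^m_k+A^m_k$ be the $k$-th peak age of source $m$, where $X_k^m$ is the time between the generations of the $(k-1)$-th and the $k$-th delivered packet of source $m$ (the $0$-th one being packet $0$), and $A^m_k$ is the time from generation to delivery of the latter; $P^m_k=\infty$ if there is no $k$-th delivery. The cost of a policy is $\bar P=\sum_{m=1}^M w_m\limsup_{N\to\infty}\frac1N\sum_{k=1}^N\mathbb E[P_k^m]$. **Claim.** For the non-preemptive and for the preemptive server there is a frequency vector $f$, for which random schedulers exist, such that every random scheduler $\xi$ with frequencies $f$ has a causal sampler $\pi$ for which $(\xi,\pi)$ is feasible,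 all the limits $\lim_N\frac1N\sum_{k\le N}\mathbb E[P^m_k]$ exist and are finite, and $\bar P_{(\xi,\pi)}\le\bar P_{(\xi',\pi')}$ for every feasible policy $(\xi',\pi')$. Consequently the infimum of $\bar P$ over all feasible policies equals the infimum over frequency vectors $f$, random schedulers with frequencies $f$, and samplers forming a feasible policy with them. -/

import Mathlib

open MeasureTheory ProbabilityTheory Filter Topology
open scoped ENNReal

noncomputable section

namespace StatusUpdate

/-- The two edge-server settings. -/
inductive Server where
  | nonpreemptive
  | preemptive

/-- The exogenous randomness: `T i` and `C i` are the transmission and computation times of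
packet `i`; `U i` and `V i` are the private randomisation seeds that the scheduler and the sampler
may use for their decisions about packet `i + 1`. -/
structure Noise (Ω : Type*) where
  T : ℕ → Ω → ℝ
  C : ℕ → Ω → ℝ
  U : ℕ → Ω → ℝ
  V : ℕ → Ω → ℝ

variable {Ω : Type*}

/-- All exogenous variables as one family. -/
def Noise.coord (ν : Noise Ω) (x : ℕ × Fin 4) : Ω → ℝ :=
  ![ν.T x.1, ν.C x.1, ν.U x.1, ν.V x.1] x.2

/-- The transmission times are i.i.d. with law `μT`, the computation times i.i.d. with law `μC`,
the seeds i.i.d. uniform on `[0, 1]`, and everything is mutually independent. -/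
structure Noise.IsModel [MeasurableSpace Ω] (ν : Noise Ω) (P : Measure Ω) (μT μC : Measure ℝ) :
    Prop where
  meas : ∀ x, Measurable (ν.coord x)
  law_T : ∀ i, P.map (ν.T i) = μT
  law_C : ∀ i, P.map (ν.C i) = μC
  law_U : ∀ i, P.map (ν.U i) = volume.restrict (Set.Icc (0 : ℝ) 1)
  law_V : ∀ i, P.map (ν.V i) = volume.restrict (Set.Icc (0 : ℝ) 1)
  indep : iIndepFun ν.coord P

/-- A law of a positive random time with a density and a finite mean. -/
structure IsTimeLaw (μ : Measure ℝ) : Prop where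
  isProbability : IsProbabilityMeasure μ
  density : μ ≪ volume
  pos : ∀ᵐ t ∂μ, 0 < t
  integrable : Integrable (fun t : ℝ => t) μ

/-- The history when packet `i` has been transmitted and its computation starts: all transmission
times up to `T i`, all computation times before `C i`, all earlier randomisation. (The earlier
sources, generation times and waiting times are functions of these.) -/
abbrev Noise.history (ν : Noise Ω) (i : ℕ) : MeasurableSpace Ω :=
  (⨆ j ∈ Set.Iic i, MeasurableSpace.comap (ν.T j) inferInstance) ⊔
  (⨆ j ∈ Set.Iio i, (MeasurableSpace.comap (ν.C j) inferInstance ⊔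
    MeasurableSpace.comap (ν.U j) inferInstance ⊔ MeasurableSpace.comap (ν.V j) inferInstance))

/-- Information of the scheduler when it selects the source of packet `i + 1`. -/
abbrev Noise.schedInfo (ν : Noise Ω) (i : ℕ) : MeasurableSpace Ω :=
  ν.history i ⊔ MeasurableSpace.comap (ν.U i) inferInstance

/-- Information of the sampler when, knowing the source of packet `i + 1`, it plans the generation
time of packet `i + 1`; `C i` has not been observed. -/
abbrev Noise.sampInfo (ν : Noise Ω) (i : ℕ) : MeasurableSpace Ω :=
  ν.schedInfo i ⊔ MeasurableSpace.comap (ν.V i) inferInstance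

/-- Information of the sampler once the computation time of packet `i` is known as well. -/
abbrev Noise.doneInfo (ν : Noise Ω) (i : ℕ) : MeasurableSpace Ω :=
  ν.sampInfo i ⊔ MeasurableSpace.comap (ν.C i) inferInstance

/-- `ξ i` is the source `m_i` of packet `i`, for `i ≥ 1` (the value `ξ 0` is never used). -/
abbrev Scheduler (Ω : Type*) (M : ℕ) := ℕ → Ω → Fin M

/-- `Z i` is the time between the generation of packet `i` and that of packet `i + 1`. -/
abbrev Sampler (Ω : Type*) := ℕ → Ω → ℝ

/-- Generation time `s_i`. Packet `0` is delivered at time `0` after `T 0 + C 0`. -/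
def genTime (ν : Noise Ω) (Z : Sampler Ω) : ℕ → Ω → ℝ
  | 0, ω => -(ν.T 0 ω + ν.C 0 ω)
  | i + 1, ω => genTime ν Z i ω + Z i ω

/-- Waiting time `W_i` of packet `i` in the server queue. Without preemption, packet `i + 1` arrives
at the server at `s_i + Z_i + T_{i+1}` and waits until packet `i` is finished at
`s_i + T_i + W_i + C_i`. With preemption there is no waiting. -/
def waiting (srv : Server) (ν : Noise Ω) (Z : Sampler Ω) : ℕ → Ω → ℝ
  | 0, _ => 0
  | i + 1, ω =>
    match srv with
    | .nonpreemptive =>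
        max 0 (ν.T i ω + waiting srv ν Z i ω + ν.C i ω - Z i ω - ν.T (i + 1) ω)
    | .preemptive => 0

/-- Packet `i` is delivered. With preemption this means that its computation ends no later
than the arrival of packet `i + 1` at the server. -/
def Received (srv : Server) (ν : Noise Ω) (Z : Sampler Ω) (i : ℕ) (ω : Ω) : Prop :=
  match srv with
  | .nonpreemptive => True
  | .preemptive =>
      genTime ν Z i ω + ν.T i ω + ν.C i ω ≤ genTime ν Z (i + 1) ω + ν.T (i + 1) ω

/-- Delivery time `r_i = s_i + T_i + W_i + C_i` of a packet that is delivered. -/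
def deliveryTime (srv : Server) (ν : Noise Ω) (Z : Sampler Ω) (i : ℕ) (ω : Ω) : ℝ :=
  genTime ν Z i ω + ν.T i ω + waiting srv ν Z i ω + ν.C i ω

/-- Packet `i ≥ 1` is a delivered packet of source `m`. -/
def ReceivedFrom {M : ℕ} (srv : Server) (ν : Noise Ω) (ξ : Scheduler Ω M) (Z : Sampler Ω)
    (m : Fin M) (ω : Ω) (i : ℕ) : Prop :=
  1 ≤ i ∧ ξ i ω = m ∧ Received srv ν Z i ω

/-- System index of the `k`-th delivered packet of source `m`; packet `0` plays the role of the
`0`-th one for every source (the initial age of every source is `T 0 + C 0`). If there is no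
`k`-th delivered packet with `k ≥ 1`, the value is `0`. -/
def recvIndex {M : ℕ} (srv : Server) (ν : Noise Ω) (ξ : Scheduler Ω M) (Z : Sampler Ω)
    (m : Fin M) (ω : Ω) : ℕ → ℕ
  | 0 => 0
  | k + 1 => Nat.nth (ReceivedFrom srv ν ξ Z m ω) k

/-- Peak age of source `m` just before its `k`-th delivery (`k ≥ 1`): time between the generations
of the `(k-1)`-th and the `k`-th delivered packet of `m`, plus the system time of the latter.
It is `∞` if source `m` never gets a `k`-th delivery. -/
def peakAge {M : ℕ} (srv : Server) (ν : Noise Ω) (ξ : Scheduler Ω M) (Z : Sampler Ω)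
    (m : Fin M) (k : ℕ) (ω : Ω) : ℝ≥0∞ :=
  let i := recvIndex srv ν ξ Z m ω k
  let j := recvIndex srv ν ξ Z m ω (k - 1)
  if i = 0 then ⊤
  else ENNReal.ofReal ((genTime ν Z i ω - genTime ν Z j ω) +
    (deliveryTime srv ν Z i ω - genTime ν Z i ω))

/-- `(1 / N) ∑_{k = 1}^{N} E[P_k^m]`. -/
def meanPeakAge {M : ℕ} [MeasurableSpace Ω] (srv : Server) (ν : Noise Ω) (P : Measure Ω)
    (ξ : Scheduler Ω M) (Z : Sampler Ω) (m : Fin M) (N : ℕ) : ℝ≥0∞ :=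
  (∑ k ∈ Finset.Icc 1 N, ∫⁻ ω, peakAge srv ν ξ Z m k ω ∂P) / N

/-- Weighted long-run average peak age of information of the policy `(ξ, Z)`. -/
def avgPAoI {M : ℕ} [MeasurableSpace Ω] (srv : Server) (ν : Noise Ω) (P : Measure Ω)
    (w : Fin M → ℝ) (ξ : Scheduler Ω M) (Z : Sampler Ω) : ℝ≥0∞ :=
  ∑ m, ENNReal.ofReal (w m) * limsup (fun N : ℕ => meanPeakAge srv ν P ξ Z m N) atTop

/-- Causal scheduler: the source of packet `i + 1` is selected, possibly at random, from the
history. -/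
def CausalScheduler {M : ℕ} (ν : Noise Ω) (ξ : Scheduler Ω M) : Prop :=
  ∀ i, Measurable[ν.schedInfo i] (ξ (i + 1))

/-- Causal sampler. A new packet is generated only when channel and queue are empty
(`Z_i ≥ T_i + W_i`). When the computation of packet `i` starts, the sampler plans, possibly at
random, a time `Θ_i ∈ [0, ∞]`: if packet `i` is still being computed after `Θ_i`, then
packet `i + 1` is generated at that moment; if the computation ends before, packet `i + 1` is
generated at an arbitrary later moment, which may depend on `C_i`. The first decision is taken at
time `0`, when packet `0` is delivered. -/
def CausalSampler [MeasurableSpace Ω] (srv : Server) (ν : Noise Ω) (P : Measure Ω)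
    (Z : Sampler Ω) : Prop :=
  (∀ i, Measurable[ν.doneInfo i] (Z i)) ∧
  (∀ᵐ ω ∂P, ν.T 0 ω + ν.C 0 ω ≤ Z 0 ω) ∧
  (∀ i, ∀ᵐ ω ∂P, ν.T i ω + waiting srv ν Z i ω ≤ Z i ω) ∧
  ∃ Θ : ℕ → Ω → ℝ≥0∞, (∀ i, Measurable[ν.sampInfo i] (Θ i)) ∧
    ∀ i, 1 ≤ i → ∀ᵐ ω ∂P,
      (Θ i ω < ENNReal.ofReal (ν.C i ω) →
        Z i ω = ν.T i ω + waiting srv ν Z i ω + (Θ i ω).toReal) ∧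
      (ENNReal.ofReal (ν.C i ω) ≤ Θ i ω →
        ν.T i ω + waiting srv ν Z i ω + ν.C i ω ≤ Z i ω)

open Classical in
/-- Almost surely, for every source the fraction of the first `n` packets that are delivered
packets of this source converges. Without preemption, these are the scheduling
frequencies. -/
def HasFrequencies {M : ℕ} [MeasurableSpace Ω] (srv : Server) (ν : Noise Ω) (P : Measure Ω)
    (ξ : Scheduler Ω M) (Z : Sampler Ω) : Prop :=
  ∀ᵐ ω ∂P, ∀ m : Fin M, ∃ x : ℝ, Tendsto
    (fun n : ℕ => (((Finset.Icc 1 n).filter (ReceivedFrom srv ν ξ Z m ω)).card : ℝ) / n)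
    atTop (𝓝 x)

/-- The feasible policies: a causal scheduler with a causal sampler, with long-run frequencies. -/
def Feasible {M : ℕ} [MeasurableSpace Ω] (srv : Server) (ν : Noise Ω) (P : Measure Ω)
    (ξ : Scheduler Ω M) (Z : Sampler Ω) : Prop :=
  CausalScheduler ν ξ ∧ CausalSampler srv ν P Z ∧ HasFrequencies srv ν P ξ Z

/-- Random scheduler with frequency vector `f`: each source is drawn from the fixed
distribution `f`, independently of the whole history. -/
def IsRandomScheduler {M : ℕ} [MeasurableSpace Ω] (ν : Noise Ω) (P : Measure Ω)
    (f : Fin M → ℝ) (ξ : Scheduler Ω M) : Prop :=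
  CausalScheduler ν ξ ∧
  (∀ i m, P {ω | ξ (i + 1) ω = m} = ENNReal.ofReal (f m)) ∧
  ∀ i, Indep (MeasurableSpace.comap (ξ (i + 1)) ⊤) (ν.history i) P

end StatusUpdate

end

open scoped ENNReal NNReal

noncomputable section

namespace StatusUpdate

/-! A decision consists of a source, the side information seen when a threshold is planned, and the
threshold `Θ`. What a sampler does after a completed computation can only lengthen `Z`: always `Z ≥
T + W + min(Θ, C)`, while the next wait and the delivery of a packet depend on the sampler only
through `Θ`. The conditional means of all these quantities are functions of the decision, so a law
`η` of decisions has the natural cost `∑ w_m γ_m(η) / ρ_m(η)`, where `γ_m` is the mean time per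
packet charged to source `m` and `ρ_m` is its delivery rate per packet.

Lower bound. Time averages are taken with probability weights proportional to `(i+1)^(-(1+2^(-j)))`,
`j → ∞`. Their squared norms are summable over `j`, so bounded orthogonal sequences average to zero
almost surely by a plain L² estimate (`ae_tendsto_wt_of_orthogonal`). Averages of nonnegative
sequences have a limsup bounded by the Cesàro one (`limsup_wt_le`). Finally, the weights are
asymptotically homogeneous of degree `-1` (`wt_scale`), so replacing the index of a delivery by the
index of its packet produces the factor `1/ρ_m`; the existence of frequencies enters here. Along a
path the weighted empirical laws of the decisions live in a compact space, and every cluster point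
is admissible: the side information has its prescribed law and is independent of the source. Hence
the weighted peak ages are asymptotically at least the minimal cost of an admissible law
(`CostData.le_liminf_of_path`), and Fatou carries this to the expected cost (`le_avgPAoI`).

Existence. Truncation at level `K` makes the cost continuous in `η`; the supremum over `K` is lower
semicontinuous and attains its minimum on the compact admissible set (`CostData.exists_minimizer`).
The density of the transmission time makes the delivery probability continuous in the threshold.
Waiting for every computation shows that the minimum is finite.

Achievability. An admissible `η` disintegrates into a source law `f`, independent side information
and a randomised threshold (`CostData.exists_threshold`). With any random scheduler of frequencies
`f`, thresholds drawn by this rule from the private seeds give decisions of law `η` that are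
independent of the past, and a renewal reward argument (`tendsto_lintegral_div`) identifies the
limits as `γ_m / ρ_m`. The cost thus equals the lower bound. -/

/-! ### Power weights and their comparison with Cesàro means -/

/-- Exponents decreasing to `1` geometrically. -/
def wtExp (j : ℕ) : ℝ := 1 + (1 / 2) ^ j

/-- Normalising constant of the power weights. -/
def wtMass (j : ℕ) : ℝ≥0 := ∑' i : ℕ, (((i : ℝ≥0) + 1) ^ wtExp j)⁻¹

/-- Probability weights on `ℕ` proportional to `(i + 1) ^ (-wtExp j)`. -/
def wt (j i : ℕ) : ℝ≥0 := (wtMass j)⁻¹ * (((i : ℝ≥0) + 1) ^ wtExp j)⁻¹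

theorem one_lt_wtExp (j : ℕ) : 1 < wtExp j := by
  unfold wtExp; linarith [pow_pos (show (0 : ℝ) < 1 / 2 by norm_num) j]

theorem wtExp_pos (j : ℕ) : 0 < wtExp j := by linarith [one_lt_wtExp j]

theorem tendsto_wtExp : Tendsto wtExp atTop (𝓝 1) := by
  have := (tendsto_pow_atTop_nhds_zero_of_lt_one (r := (1 / 2 : ℝ)) (by norm_num)
    (by norm_num)).const_add 1
  rw [add_zero] at this
  exact this

theorem summable_wt_aux (j : ℕ) : Summable fun i : ℕ => (((i : ℝ≥0) + 1) ^ wtExp j)⁻¹ := by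
  have h := NNReal.summable_rpow_inv.2 (one_lt_wtExp j)
  have := (NNReal.summable_nat_add_iff 1).2 h
  simpa using this

theorem wtMass_pos (j : ℕ) : 0 < wtMass j := by
  refine lt_of_lt_of_le ?_ ((summable_wt_aux j).le_tsum 0 (fun _ _ => zero_le))
  simp

theorem summable_wt (j : ℕ) : Summable (wt j) := (summable_wt_aux j).mul_left _

theorem tsum_wt (j : ℕ) : ∑' i, wt j i = 1 := by
  unfold wt
  rw [NNReal.tsum_mul_left]
  exact inv_mul_cancel₀ (wtMass_pos j).ne'

theorem tsum_coe_wt (j : ℕ) : ∑' i, (wt j i : ℝ≥0∞) = 1 := by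
  rw [← ENNReal.coe_tsum (summable_wt j), tsum_wt, ENNReal.coe_one]

theorem wt_antitone (j : ℕ) : Antitone (wt j) := by
  intro a b hab
  unfold wt
  gcongr
  exact (wtExp_pos j).le

/-- The mass is the zeta function at `1 + 2^(-j)`, which has a simple pole with residue 1 at 1. -/
theorem tendsto_wtMass : Tendsto (fun j => (1 / 2 : ℝ) ^ j * wtMass j) atTop (𝓝 1) := by
  have h1 : Tendsto wtExp atTop (𝓝[>] 1) :=
    tendsto_nhdsWithin_iff.2 ⟨tendsto_wtExp, Eventually.of_forall one_lt_wtExp⟩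
  refine (tendsto_sub_mul_tsum_nat_rpow.comp h1).congr fun j => ?_
  simp only [Function.comp]
  congr 1
  · simp [wtExp]
  · rw [wtMass, NNReal.coe_tsum]
    have h := Real.summable_one_div_nat_rpow.2 (one_lt_wtExp j)
    rw [h.tsum_eq_zero_add]
    simp [Real.zero_rpow (wtExp_pos j).ne']

theorem eventually_inv_wtMass_le : ∀ᶠ j in atTop, ((wtMass j)⁻¹ : ℝ≥0) ≤ 2 * (1 / 2) ^ j := by
  filter_upwards [tendsto_wtMass.eventually (lt_mem_nhds (show (1 / 2 : ℝ) < 1 by norm_num))]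
    with j hj
  rw [inv_le_iff_one_le_mul₀ (wtMass_pos j), ← NNReal.coe_le_coe]
  push_cast
  linarith

theorem tendsto_inv_wtMass : Tendsto (fun j => (wtMass j)⁻¹) atTop (𝓝 0) := by
  refine tendsto_of_tendsto_of_tendsto_of_le_of_le' tendsto_const_nhds (h := fun j => 2 * (1/2) ^ j)
    ?_ (Eventually.of_forall fun _ => zero_le) eventually_inv_wtMass_le
  have : Tendsto (fun j => (1 / 2 : ℝ≥0) ^ j) atTop (𝓝 0) :=
    NNReal.tendsto_pow_atTop_nhds_zero_of_lt_one (NNReal.coe_lt_coe.1 (by norm_num))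
  simpa using this.const_mul 2

theorem wt_le (j i : ℕ) : wt j i ≤ (wtMass j)⁻¹ := by
  unfold wt
  refine mul_le_of_le_one_right zero_le (inv_le_one_of_one_le₀ ?_)
  exact NNReal.one_le_rpow (by simp) (wtExp_pos j).le

theorem tendsto_wt (i : ℕ) : Tendsto (fun j => wt j i) atTop (𝓝 0) :=
  tendsto_of_tendsto_of_tendsto_of_le_of_le tendsto_const_nhds tendsto_inv_wtMass
    (fun _ => zero_le) fun j => wt_le j i

/-- The inner sum is at most a constant times the squared inverse mass, which is eventually at most
`4 · 4^(-j)`. The geometric choice of exponents serves this summability. -/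
theorem tsum_wt_sq_ne_top : ∑' j, ∑' i, (wt j i : ℝ≥0∞) ^ 2 ≠ ⊤ := by
  have hS : Summable fun i : ℕ => (((i : ℝ≥0) + 1) ^ 2)⁻¹ := by
    have := (NNReal.summable_nat_add_iff 1).2 (NNReal.summable_rpow_inv.2 (show (1 : ℝ) < 2 by norm_num))
    simpa using this
  set S := ∑' i : ℕ, (((i : ℝ≥0) + 1) ^ 2)⁻¹
  have hj : ∀ j, ∑' i, (wt j i : ℝ≥0∞) ^ 2 ≤ (((wtMass j)⁻¹ ^ 2 * S : ℝ≥0) : ℝ≥0∞) := by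
    intro j
    rw [ENNReal.coe_mul, ENNReal.coe_tsum hS, ← ENNReal.tsum_mul_left]
    refine ENNReal.tsum_le_tsum fun i => ?_
    rw [← ENNReal.coe_pow, ← ENNReal.coe_mul, ENNReal.coe_le_coe, wt, mul_pow, inv_pow _ 2]
    gcongr
    rw [← inv_pow]
    gcongr
    conv_lhs => rw [← NNReal.rpow_one ((i : ℝ≥0) + 1)]
    exact NNReal.rpow_le_rpow_of_exponent_le (by simp) (one_lt_wtExp j).le
  refine ne_top_of_le_ne_top ?_ (ENNReal.tsum_le_tsum hj)
  rw [ENNReal.tsum_coe_ne_top_iff_summable]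
  refine Summable.mul_right _ ?_
  obtain ⟨J, hJ⟩ := eventually_atTop.1 eventually_inv_wtMass_le
  rw [← NNReal.summable_nat_add_iff J]
  have hg : Summable fun j => (4 : ℝ≥0) * (1 / 4) ^ (j + J) :=
    (NNReal.summable_nat_add_iff J).2 ((NNReal.summable_geometric
      (NNReal.coe_lt_coe.1 (by norm_num))).mul_left 4)
  refine NNReal.summable_of_le (fun j => ?_) hg
  calc (wtMass (j + J))⁻¹ ^ 2 ≤ (2 * (1 / 2) ^ (j + J)) ^ 2 := by
        gcongr; exact hJ _ (by omega)
    _ = _ := by rw [mul_pow, ← pow_mul, mul_comm _ 2, pow_mul]; norm_num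

/-- Homogeneity of power weights. Since the exponents tend to 1, the factor tends to `1/y`: this
converts the weight of a packet index into that of a delivery index. -/
theorem wt_scale {y : ℝ≥0} {n l : ℕ} (h : (n : ℝ≥0) + 1 ≤ y * (l + 1)) (j : ℕ) :
    (y ^ wtExp j)⁻¹ * wt j l ≤ wt j n := by
  unfold wt
  rw [mul_left_comm, ← mul_inv, ← NNReal.mul_rpow]
  gcongr
  exact (wtExp_pos j).le

/-- Abelian comparison: antitone weights average a sequence whose partial sums grow linearly. -/
theorem sum_antitone_mul_le {a b : ℕ → ℝ} (ha : Antitone a) {c B : ℝ}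
    (h : ∀ n, ∑ k ∈ Finset.range n, b k ≤ c * n + B) (n : ℕ) :
    ∑ k ∈ Finset.range n, a k * b k + a n * (c * n + B) ≤
      c * ∑ k ∈ Finset.range n, a k + a 0 * B + a n * ∑ k ∈ Finset.range n, b k := by
  induction n with
  | zero => simp
  | succ n ih =>
    have hn := h (n + 1)
    have hd : a (n + 1) ≤ a n := ha (Nat.le_succ n)
    rw [Finset.sum_range_succ, Finset.sum_range_succ _ n, Finset.sum_range_succ _ n] at *
    push_cast at *
    -- Abel summation: the two sides change by amounts differing by `(a n - a (n+1))` times the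
    -- slack in `h (n+1)`. The term with `a n` on either side of the claim keeps track of this
    -- slack.
    nlinarith [mul_nonneg (sub_nonneg.2 hd) (sub_nonneg.2 hn)]

/-- Abelian direction of summability: antitone weights are mixtures of Cesàro means, and initial
blocks are negligible because single weights vanish in the limit. -/
theorem limsup_wt_le (b : ℕ → ℝ≥0∞) :
    limsup (fun j => ∑' k, (wt j k : ℝ≥0∞) * b k) atTop ≤
      limsup (fun n : ℕ => (∑ k ∈ Finset.range n, b k) / n) atTop := by
  refine le_of_forall_gt_imp_ge_of_dense fun c hc => ?_
  rcases eq_or_ne c ⊤ with rfl | hct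
  · exact le_top
  lift c to ℝ≥0 using hct
  obtain ⟨n0, hn0⟩ := eventually_atTop.1 (eventually_lt_of_limsup_lt hc)
  -- A single infinite term would make all later Cesàro means infinite.
  have hfin : ∀ k, b k ≠ ⊤ := by
    intro k hk
    have h1 := hn0 (max n0 (k + 1)) (le_max_left _ _)
    have : ∑ k ∈ Finset.range (max n0 (k + 1)), b k = ⊤ :=
      ENNReal.sum_eq_top.2 ⟨k, by simp, hk⟩
    rw [this, ENNReal.top_div_of_ne_top (by simp)] at h1
    exact absurd h1 (by simp)
  lift b to ℕ → ℝ≥0 using hfin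
  set B : ℝ≥0 := ∑ k ∈ Finset.range n0, b k
  have hb : ∀ n, ∑ k ∈ Finset.range n, (b k : ℝ) ≤ c * n + B := by
    intro n
    rcases le_total n n0 with h | h
    · have : ∑ k ∈ Finset.range n, b k ≤ B :=
        Finset.sum_le_sum_of_subset (Finset.range_mono h)
      have h2 : ∑ k ∈ Finset.range n, (b k : ℝ) ≤ B := by exact_mod_cast this
      have : (0 : ℝ) ≤ c * n := by positivity
      linarith
    · have h1 := (hn0 n h).le
      rcases Nat.eq_zero_or_pos n with rfl | hpos
      · simp
      rw [ENNReal.div_le_iff (by positivity) (by simp)] at h1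
      have : ∑ k ∈ Finset.range n, (b k : ℝ) ≤ c * n := by
        rw [← ENNReal.ofNNReal_finsetSum, ← ENNReal.coe_natCast, ← ENNReal.coe_mul,
          ENNReal.coe_le_coe] at h1
        exact_mod_cast h1
      have : (0 : ℝ) ≤ B := B.2
      linarith
  -- The terms before `n0` enter only through `B`, whose coefficient `wt j 0` tends to 0.
  have hj : ∀ j, ∑' k, (wt j k : ℝ≥0∞) * b k ≤ ((c + wt j 0 * B : ℝ≥0) : ℝ≥0∞) := by
    intro j
    refine ENNReal.tsum_le_of_sum_range_le fun n => ?_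
    have h1 := sum_antitone_mul_le (a := fun k => (wt j k : ℝ)) (b := fun k => (b k : ℝ))
      (fun x y h => NNReal.coe_le_coe.2 (wt_antitone j h)) hb n
    have h2 : ∑ k ∈ Finset.range n, (wt j k : ℝ) ≤ 1 := by
      rw [← NNReal.coe_one, ← tsum_wt j, NNReal.coe_tsum]
      exact (NNReal.summable_coe.2 (summable_wt j)).sum_le_tsum _ (fun _ _ => NNReal.coe_nonneg _)
    have h3 : ∑ k ∈ Finset.range n, (wt j k : ℝ) * b k ≤ c + wt j 0 * B := by
      have := mul_le_mul_of_nonneg_left (hb n) (wt j n).2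
      have := mul_le_mul_of_nonneg_left h2 c.2
      simp only [NNReal.val_eq_coe] at *
      linarith
    exact_mod_cast h3
  calc limsup (fun j => ∑' k, (wt j k : ℝ≥0∞) * b k) atTop
      ≤ limsup (fun j => ((c + wt j 0 * B : ℝ≥0) : ℝ≥0∞)) atTop :=
        limsup_le_limsup (Eventually.of_forall hj)
    _ = c := by
        refine Tendsto.limsup_eq (ENNReal.tendsto_coe.2 ?_)
        simpa using ((tendsto_wt 0).mul_const B).const_add c

/-! ### Decision laws and the compact minimisation problem -/

/-- A scheduling decision: source, observed side information, planned threshold. -/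
abbrev Key (M : ℕ) := Fin M × ℝ≥0∞ × ℝ≥0∞

/-- Per-decision conditional means: the delivery probability `rate`, the truncated mean inter-generation
time `inc K` and the truncated mean system time `sys K` of delivered packets. `base` is the law of
the side information. -/
structure CostData where
  base : Measure ℝ≥0∞
  rate : C(ℝ≥0∞, ℝ≥0)
  inc : ℕ → C(ℝ≥0∞, ℝ≥0)
  sys : ℕ → C(ℝ≥0∞ × ℝ≥0∞, ℝ≥0)

section Optimisation
variable {M : ℕ}

/-- Indicator of the decisions for source `m`. -/
def srcInd (m : Fin M) : C(Key M, ℝ≥0) where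
  toFun x := if x.1 = m then 1 else 0
  continuous_toFun := (continuous_of_discreteTopology (f := fun i : Fin M => if i = m then (1 : ℝ≥0)
    else 0)).comp continuous_fst

theorem continuous_lintegral_prob {X : Type*} [TopologicalSpace X] [CompactSpace X]
    [MeasurableSpace X] [OpensMeasurableSpace X] (φ : C(X, ℝ≥0)) :
    Continuous fun η : ProbabilityMeasure X => ∫⁻ x, φ x ∂(η : Measure X) := by
  rw [continuous_iff_continuousAt]
  intro η
  exact (ProbabilityMeasure.tendsto_iff_forall_lintegral_tendsto.1 tendsto_id)
    (BoundedContinuousFunction.mkOfCompact φ)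

theorem lintegral_ne_top_of_compact {X : Type*} [TopologicalSpace X] [CompactSpace X]
    [MeasurableSpace X] [OpensMeasurableSpace X] (φ : C(X, ℝ≥0)) (η : ProbabilityMeasure X) :
    ∫⁻ x, φ x ∂(η : Measure X) ≠ ⊤ :=
  (BoundedContinuousFunction.lintegral_lt_top_of_nnreal (η : Measure X)
    (BoundedContinuousFunction.mkOfCompact φ)).ne

namespace CostData
variable (D : CostData)

def rateFn (m : Fin M) : C(Key M, ℝ≥0) :=
  srcInd m * D.rate.comp ⟨fun x => x.2.2, by fun_prop⟩

/-- An inter-generation time lengthens the peak age of every source, whereas a system time is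
charged only to the source of the packet. -/
def gainFn (K : ℕ) (m : Fin M) : C(Key M, ℝ≥0) :=
  (D.inc K).comp ⟨fun x => x.2.2, by fun_prop⟩ + srcInd m * (D.sys K).comp ⟨fun x => x.2, by fun_prop⟩

/-- Cost at truncation level `K` of the decision law `η`. -/
def cost (w : Fin M → ℝ) (K : ℕ) (η : Measure (Key M)) : ℝ≥0∞ :=
  ∑ m, ENNReal.ofReal (w m) * ((∫⁻ x, D.gainFn K m x ∂η) / ∫⁻ x, D.rateFn m x ∂η)

/-- Decision laws under which the side information has law `base` and is independent of the
source. -/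
def admissible (M : ℕ) : Set (ProbabilityMeasure (Key M)) :=
  {η | ∀ (m : Fin M) (φ : C(ℝ≥0∞, ℝ≥0)),
    ∫⁻ x, srcInd m x * φ x.2.1 ∂(η : Measure (Key M)) =
      (∫⁻ x, srcInd m x ∂(η : Measure (Key M))) * ∫⁻ t, φ t ∂D.base}

/-- Testing independence only against continuous functions makes both sides weakly continuous in
`η`. -/
theorem isClosed_admissible [IsProbabilityMeasure D.base] : IsClosed (D.admissible M) := by
  simp only [admissible, Set.ofPred_forall]
  refine isClosed_iInter fun m => isClosed_iInter fun φ => ?_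
  refine isClosed_eq ?_ ?_
  · exact continuous_lintegral_prob (srcInd m * φ.comp ⟨fun x : Key M => x.2.1, by fun_prop⟩)
  · refine ENNReal.continuous_mul_const ?_ |>.comp (continuous_lintegral_prob (srcInd m))
    exact lintegral_ne_top_of_compact φ ⟨D.base, inferInstance⟩

/-- Numerators and denominators are integrals of continuous functions on a compact space. Division
is continuous away from `0/0` and `∞/∞`; positivity of `inc` excludes the first, boundedness the
second. -/
theorem continuous_cost (w : Fin M → ℝ) (K : ℕ) (hpos : ∀ θ, 0 < D.inc K θ) :
    Continuous fun η : ProbabilityMeasure (Key M) => D.cost w K (η : Measure (Key M)) := by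
  unfold cost
  refine continuous_finsetSum _ fun m _ => ?_
  refine (ENNReal.continuous_const_mul ENNReal.ofReal_ne_top).comp ?_
  rw [continuous_iff_continuousAt]
  intro η
  refine ENNReal.Tendsto.div ((continuous_lintegral_prob _).tendsto η) (Or.inl ?_)
    ((continuous_lintegral_prob _).tendsto η) (Or.inr (lintegral_ne_top_of_compact _ η))
  have h0 : ∀ x : Key M, (D.gainFn K m x : ℝ≥0∞) ≠ 0 := by
    intro x
    have := hpos x.2.2
    simp only [gainFn, ContinuousMap.add_apply, ContinuousMap.comp_apply, ContinuousMap.coe_mk]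
    positivity
  intro h
  rw [lintegral_eq_zero_iff (by fun_prop)] at h
  obtain ⟨x, hx⟩ := h.exists
  exact h0 x hx

/-- A supremum of continuous functions is lower semicontinuous, and a closed set of probability
measures on a compact space is compact. Unbounded means enter only as suprema of truncated ones, so
no tightness or uniform integrability is needed. -/
theorem exists_minimizer [IsProbabilityMeasure D.base] (w : Fin M → ℝ)
    (hpos : ∀ K θ, 0 < D.inc K θ) (hne : (D.admissible M).Nonempty) :
    ∃ η ∈ D.admissible M, ∀ η' ∈ D.admissible M,
      ⨆ K, D.cost w K (η : Measure (Key M)) ≤ ⨆ K, D.cost w K (η' : Measure (Key M)) := by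
  have hlsc : LowerSemicontinuousOn
      (fun η : ProbabilityMeasure (Key M) => ⨆ K, D.cost w K (η : Measure (Key M)))
      (D.admissible M) :=
    (lowerSemicontinuous_iSup fun K =>
      (D.continuous_cost w K (hpos K)).lowerSemicontinuous).lowerSemicontinuousOn _
  obtain ⟨η, hη, hmin⟩ := hlsc.exists_isMinOn hne D.isClosed_admissible.isCompact
  exact ⟨η, hη, fun η' hη' => hmin hη'⟩

/-- The law of source and side information under an admissible decision law. -/
theorem map_eq_prod [IsProbabilityMeasure D.base] {η : ProbabilityMeasure (Key M)}
    (hη : η ∈ D.admissible M) :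
    (η : Measure (Key M)).map (fun x => (x.1, x.2.1)) =
      ((η : Measure (Key M)).map Prod.fst).prod D.base := by
  -- On the fibre of a fixed source, admissibility identifies two finite measures through their
  -- integrals of continuous functions; finitely many fibres give the product law.
  have key : ∀ m : Fin M, ((η : Measure (Key M)).restrict {x | x.1 = m}).map (fun x => x.2.1) =
      (η : Measure (Key M)) {x | x.1 = m} • D.base := by
    intro m
    have hm : MeasurableSet {x : Key M | x.1 = m} := measurable_fst (measurableSet_singleton m)
    have hfin : (η : Measure (Key M)) {x | x.1 = m} ≠ ⊤ := measure_ne_top _ _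
    have : IsFiniteMeasure ((η : Measure (Key M)) {x | x.1 = m} • D.base) :=
      Measure.smul_finite _ hfin
    refine ext_of_forall_lintegral_eq_of_IsFiniteMeasure fun φ => ?_
    have h := hη m φ.toContinuousMap
    have e1 : ∀ (ψ : Key M → ℝ≥0∞), ∫⁻ x, srcInd m x * ψ x ∂(η : Measure (Key M)) =
        ∫⁻ x in {x | x.1 = m}, ψ x ∂(η : Measure (Key M)) := by
      intro ψ
      rw [← lintegral_indicator hm]
      refine lintegral_congr fun x => ?_
      by_cases hx : x.1 = m <;> simp [srcInd, hx]
    rw [lintegral_map (by fun_prop) (by fun_prop), lintegral_smul_measure, smul_eq_mul]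
    have e2 : ∫⁻ x, srcInd m x ∂(η : Measure (Key M)) = (η : Measure (Key M)) {x | x.1 = m} := by
      have := e1 1
      simpa using this
    rw [e2, e1] at h
    exact h
  symm
  refine Measure.prod_eq fun s t hs ht => ?_
  rw [Measure.map_apply (by fun_prop) (hs.prod ht), Measure.map_apply (by fun_prop) hs]
  have hfib : ∀ A : Set (Key M), MeasurableSet A → (η : Measure (Key M)) A =
      ∑ m, (η : Measure (Key M)) (A ∩ {x | x.1 = m}) := by
    intro A hA
    rw [← measure_biUnion_finset (s := Finset.univ)]
    · congr 1; ext x; simp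
    · intro a _ b _ hab
      refine Set.disjoint_left.2 fun x hx hx' => hab ?_
      exact hx.2.symm.trans hx'.2
    · exact fun m _ => hA.inter (measurable_fst (measurableSet_singleton m))
  have hmm : Measurable fun x : Key M => (x.1, x.2.1) := by fun_prop
  rw [hfib _ (hmm (hs.prod ht)), hfib _ (measurable_fst hs), Finset.sum_mul]
  refine Finset.sum_congr rfl fun m _ => ?_
  by_cases hm : m ∈ s
  · have := congrArg (fun μ => μ t) (key m)
    simp only [Measure.smul_apply, smul_eq_mul] at this
    rw [Measure.map_apply (by fun_prop) ht, Measure.restrict_apply (by measurability)] at this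
    convert this using 2
    · ext x; constructor
      · rintro ⟨⟨h1, h2⟩, h3⟩; exact ⟨h2, h3⟩
      · rintro ⟨h2, h3⟩
        have h3' : x.1 = m := h3
        exact ⟨⟨by simpa [h3'] using hm, h2⟩, h3⟩
    · congr 1; ext x; constructor
      · rintro ⟨h1, h3⟩; exact h3
      · intro h3
        have h3' : x.1 = m := h3
        exact ⟨by simpa [h3'] using hm, h3⟩
  · have e : ∀ B : Set (Key M), (∀ x ∈ B, x.1 ∈ s) → B ∩ {x | x.1 = m} = ∅ := by
      intro B hB
      ext x; simp only [Set.mem_inter_iff, Set.mem_ofPred_eq, Set.mem_empty_iff_false, iff_false]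
      rintro ⟨h1, rfl⟩; exact hm (hB x h1)
    rw [e _ (fun x hx => hx.1), e (Prod.fst ⁻¹' s) (fun x hx => hx)]
    simp

end CostData

theorem map_projIcc_restrict :
    (volume.restrict (Set.Icc (0 : ℝ) 1)).map (Set.projIcc (0 : ℝ) 1 zero_le_one) =
      (volume : Measure unitInterval) := by
  have h1 : (volume : Measure unitInterval).map Subtype.val = volume.restrict (Set.Icc 0 1) :=
    map_comap_subtype_coe measurableSet_Icc _
  rw [← h1, Measure.map_map (by fun_prop) (by fun_prop)]
  have : (Set.projIcc (0 : ℝ) 1 zero_le_one) ∘ Subtype.val = id := by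
    ext x; simp
  rw [this, Measure.map_id]

/-- Every admissible decision law is the law of a randomised threshold. -/
theorem CostData.exists_threshold (D : CostData) [IsProbabilityMeasure D.base]
    {η : ProbabilityMeasure (Key M)} (hη : η ∈ D.admissible M) :
    ∃ κ : Fin M × ℝ≥0∞ → ℝ → ℝ≥0∞, Measurable (Function.uncurry κ) ∧
      ((((η : Measure (Key M)).map Prod.fst).prod D.base).prod
        (volume.restrict (Set.Icc (0 : ℝ) 1))).map (fun x => (x.1.1, x.1.2, κ x.1 x.2)) =
      (η : Measure (Key M)) := by
  set ρ : Measure ((Fin M × ℝ≥0∞) × ℝ≥0∞) :=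
    (η : Measure (Key M)).map (fun x => ((x.1, x.2.1), x.2.2)) with hρ
  have : IsProbabilityMeasure ρ := Measure.isProbabilityMeasure_map (by fun_prop)
  -- The conditional law of the threshold is realised as the image of one uniform variable, to be
  -- supplied by the private seed of the sampler.
  obtain ⟨f, hf, hfκ⟩ := Kernel.exists_measurable_map_eq_unitInterval ρ.condKernel
  have hfst : ρ.fst = ((η : Measure (Key M)).map Prod.fst).prod D.base := by
    rw [← D.map_eq_prod hη, Measure.fst, hρ, Measure.map_map (by fun_prop) (by fun_prop)]
    rfl
  have hI := map_projIcc_restrict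
  have hproj : Measurable (Set.projIcc (0 : ℝ) 1 zero_le_one) := continuous_projIcc.measurable
  refine ⟨fun a v => f a (Set.projIcc 0 1 zero_le_one v), ?_, ?_⟩
  · exact hf.comp (measurable_fst.prodMk (hproj.comp measurable_snd))
  rw [← hfst]
  have hgm : Measurable fun x : (Fin M × ℝ≥0∞) × ℝ =>
      (x.1, f x.1 (Set.projIcc 0 1 zero_le_one x.2)) :=
    measurable_fst.prodMk (hf.comp (measurable_fst.prodMk (hproj.comp measurable_snd)))
  have h2 : (ρ.fst.prod (volume.restrict (Set.Icc (0 : ℝ) 1))).map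
      (fun x => (x.1, f x.1 (Set.projIcc 0 1 zero_le_one x.2))) = ρ := by
    refine Measure.ext fun s hs => ?_
    rw [Measure.map_apply hgm hs, Measure.prod_apply (hgm hs)]
    conv_rhs => rw [← ρ.disintegrate ρ.condKernel, Measure.compProd_apply hs]
    refine lintegral_congr fun a => ?_
    rw [← hfκ a, Measure.map_apply hf.of_uncurry_left (measurable_prodMk_left hs), ← hI,
      Measure.map_apply hproj (hf.of_uncurry_left (measurable_prodMk_left hs))]
    rfl
  have h3 : (fun x : (Fin M × ℝ≥0∞) × ℝ =>
      (x.1.1, x.1.2, f x.1 (Set.projIcc 0 1 zero_le_one x.2))) =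
      (fun y : (Fin M × ℝ≥0∞) × ℝ≥0∞ => (y.1.1, y.1.2, y.2)) ∘
        (fun x => (x.1, f x.1 (Set.projIcc 0 1 zero_le_one x.2))) := rfl
  rw [h3, ← Measure.map_map (by fun_prop) hgm, h2, hρ, Measure.map_map (by fun_prop) (by fun_prop)]
  exact Measure.map_id

end Optimisation

/-! ### A weighted law of large numbers -/

section Orthogonal
variable {Ω : Type*} [MeasurableSpace Ω] {P : Measure Ω} [IsProbabilityMeasure P]

theorem integral_sq_sum_le {Y : ℕ → Ω → ℝ} (hY : ∀ l, Measurable (Y l)) {B : ℝ}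
    (hB : ∀ l ω, |Y l ω| ≤ B) (horth : ∀ l k, l < k → ∫ ω, Y l ω * Y k ω ∂P = 0)
    (a : ℕ → ℝ) (n : ℕ) :
    ∫ ω, (∑ l ∈ Finset.range n, a l * Y l ω) ^ 2 ∂P ≤ B ^ 2 * ∑ l ∈ Finset.range n, a l ^ 2 := by
  have hbd : ∀ (f : Ω → ℝ) (K : ℝ), Measurable f → (∀ ω, |f ω| ≤ K) → Integrable f P :=
    fun f K hf hK => Integrable.of_bound hf.aestronglyMeasurable K (ae_of_all _ hK)
  have hS : ∀ n, Measurable fun ω => ∑ l ∈ Finset.range n, a l * Y l ω := fun n => by fun_prop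
  have hSb : ∀ n ω, |∑ l ∈ Finset.range n, a l * Y l ω| ≤ ∑ l ∈ Finset.range n, |a l| * B := by
    intro n ω
    refine (Finset.abs_sum_le_sum_abs _ _).trans (Finset.sum_le_sum fun l _ => ?_)
    rw [abs_mul]
    exact mul_le_mul_of_nonneg_left (hB l ω) (abs_nonneg _)
  have hB0 : 0 ≤ B := by
    obtain ⟨ω⟩ := nonempty_of_isProbabilityMeasure P
    exact (abs_nonneg _).trans (hB 0 ω)
  have hint2 : ∀ l k, Integrable (fun ω => Y l ω * Y k ω) P := fun l k =>
    hbd _ (B * B) ((hY l).mul (hY k)) fun ω => by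
      rw [abs_mul]; exact mul_le_mul (hB l ω) (hB k ω) (abs_nonneg _) hB0
  induction n with
  | zero => simp
  | succ n ih =>
    have hcross : ∫ ω, (∑ l ∈ Finset.range n, a l * Y l ω) * Y n ω ∂P = 0 := by
      simp_rw [Finset.sum_mul, mul_assoc]
      rw [integral_finsetSum _ fun l _ => (hint2 l n).const_mul _]
      refine Finset.sum_eq_zero fun l hl => ?_
      rw [integral_const_mul, horth l n (Finset.mem_range.1 hl), mul_zero]
    have hcint : Integrable (fun ω => (∑ l ∈ Finset.range n, a l * Y l ω) * Y n ω) P := by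
      simp_rw [Finset.sum_mul, mul_assoc]
      exact integrable_finsetSum _ fun l _ => (hint2 l n).const_mul _
    have hsint : Integrable (fun ω => (∑ l ∈ Finset.range n, a l * Y l ω) ^ 2) P :=
      hbd _ ((∑ l ∈ Finset.range n, |a l| * B) ^ 2) ((hS n).pow_const 2) fun ω => by
        rw [abs_pow]; gcongr; exact hSb n ω
    have hexp : ∀ ω, (∑ l ∈ Finset.range (n + 1), a l * Y l ω) ^ 2 =
        (∑ l ∈ Finset.range n, a l * Y l ω) ^ 2 +
        2 * a n * ((∑ l ∈ Finset.range n, a l * Y l ω) * Y n ω) + a n ^ 2 * (Y n ω * Y n ω) := by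
      intro ω; rw [Finset.sum_range_succ]; ring
    simp_rw [hexp]
    have i1 := integral_add (hsint.add (hcint.const_mul (2 * a n))) ((hint2 n n).const_mul (a n ^ 2))
    have i2 := integral_add hsint (hcint.const_mul (2 * a n))
    simp only [Pi.add_apply] at i1 i2
    rw [i1, i2, integral_const_mul, integral_const_mul, hcross,
      Finset.sum_range_succ, mul_add]
    have hYY : ∫ ω, Y n ω * Y n ω ∂P ≤ B ^ 2 := by
      have : ∫ ω, Y n ω * Y n ω ∂P ≤ ∫ _, B ^ 2 ∂P := by
        refine integral_mono (hint2 n n) (integrable_const _) fun ω => ?_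
        have := hB n ω
        rw [← sq, ← sq_abs]
        exact pow_le_pow_left₀ (abs_nonneg _) this 2
      simpa using this
    nlinarith [sq_nonneg (a n)]

theorem summable_wt_mul {y : ℕ → ℝ} {B : ℝ} (hB : ∀ l, |y l| ≤ B) (j : ℕ) :
    Summable fun l => (wt j l : ℝ) * y l := by
  refine Summable.of_norm_bounded (g := fun l => (wt j l : ℝ) * B)
    ((NNReal.summable_coe.2 (summable_wt j)).mul_right B) fun l => ?_
  rw [norm_mul, Real.norm_of_nonneg (NNReal.coe_nonneg _), Real.norm_eq_abs]
  exact mul_le_mul_of_nonneg_left (hB l) (NNReal.coe_nonneg _)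

/-- By orthogonality the second moment of the `j`-th average is at most `B² ∑ wt²`, which is
summable over `j`. The squared averages are then almost surely summable, hence tend to zero. -/
theorem ae_tendsto_wt_of_orthogonal {Y : ℕ → Ω → ℝ} (hY : ∀ l, Measurable (Y l)) {B : ℝ}
    (hB : ∀ l ω, |Y l ω| ≤ B) (horth : ∀ l k, l < k → ∫ ω, Y l ω * Y k ω ∂P = 0) :
    ∀ᵐ ω ∂P, Tendsto (fun j => ∑' l, (wt j l : ℝ) * Y l ω) atTop (𝓝 0) := by
  have hmS : ∀ j n, Measurable fun ω => ∑ l ∈ Finset.range n, (wt j l : ℝ) * Y l ω :=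
    fun j n => by fun_prop
  have hlim : ∀ j ω, Tendsto (fun n => ∑ l ∈ Finset.range n, (wt j l : ℝ) * Y l ω) atTop
      (𝓝 (∑' l, (wt j l : ℝ) * Y l ω)) :=
    fun j ω => (summable_wt_mul (fun l => hB l ω) j).hasSum.tendsto_sum_nat
  have hmT : ∀ j, Measurable fun ω => ∑' l, (wt j l : ℝ) * Y l ω := fun j =>
    measurable_of_tendsto_metrizable (hmS j) (tendsto_pi_nhds.2 fun ω => hlim j ω)
  have hfin : ∀ j n, ∫⁻ ω, ENNReal.ofReal ((∑ l ∈ Finset.range n, (wt j l : ℝ) * Y l ω) ^ 2) ∂P ≤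
      ENNReal.ofReal (B ^ 2) * ∑' l, (wt j l : ℝ≥0∞) ^ 2 := by
    intro j n
    have hb : ∀ ω, |∑ l ∈ Finset.range n, (wt j l : ℝ) * Y l ω| ≤
        ∑ l ∈ Finset.range n, (wt j l : ℝ) * B := fun ω =>
      (Finset.abs_sum_le_sum_abs _ _).trans (Finset.sum_le_sum fun l _ => by
        rw [abs_mul, abs_of_nonneg (NNReal.coe_nonneg _)]
        exact mul_le_mul_of_nonneg_left (hB l ω) (NNReal.coe_nonneg _))
    rw [← ofReal_integral_eq_lintegral_ofReal
      (Integrable.of_bound ((hmS j n).pow_const 2).aestronglyMeasurable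
        ((∑ l ∈ Finset.range n, (wt j l : ℝ) * B) ^ 2) (ae_of_all _ fun ω => by
          rw [Real.norm_eq_abs, abs_pow]; gcongr; exact hb ω))
      (ae_of_all _ fun ω => sq_nonneg _)]
    refine (ENNReal.ofReal_le_ofReal (integral_sq_sum_le hY hB horth _ n)).trans ?_
    rw [ENNReal.ofReal_mul (sq_nonneg _)]
    gcongr
    rw [ENNReal.ofReal_sum_of_nonneg fun _ _ => sq_nonneg _]
    refine le_trans (le_of_eq ?_) (ENNReal.sum_le_tsum (Finset.range n))
    refine Finset.sum_congr rfl fun l _ => ?_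
    rw [ENNReal.ofReal_pow (NNReal.coe_nonneg _), ENNReal.ofReal_coe_nnreal]
  -- The bound for finite partial sums passes to the full weighted sum by Fatou.
  have hfat : ∀ j, ∫⁻ ω, ENNReal.ofReal ((∑' l, (wt j l : ℝ) * Y l ω) ^ 2) ∂P ≤
      ENNReal.ofReal (B ^ 2) * ∑' l, (wt j l : ℝ≥0∞) ^ 2 := by
    intro j
    calc ∫⁻ ω, ENNReal.ofReal ((∑' l, (wt j l : ℝ) * Y l ω) ^ 2) ∂P
        = ∫⁻ ω, liminf (fun n => ENNReal.ofReal
            ((∑ l ∈ Finset.range n, (wt j l : ℝ) * Y l ω) ^ 2)) atTop ∂P := by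
          refine lintegral_congr fun ω => (Tendsto.liminf_eq ?_).symm
          exact (ENNReal.continuous_ofReal.tendsto _).comp ((hlim j ω).pow 2)
      _ ≤ liminf (fun n => ∫⁻ ω, ENNReal.ofReal
            ((∑ l ∈ Finset.range n, (wt j l : ℝ) * Y l ω) ^ 2) ∂P) atTop :=
          lintegral_liminf_le fun n => ((hmS j n).pow_const 2).ennreal_ofReal
      _ ≤ _ := liminf_le_of_le (by isBoundedDefault) fun b hb => by
          obtain ⟨n, hn⟩ := hb.exists
          exact hn.trans (hfin j n)
  have htot : ∫⁻ ω, ∑' j, ENNReal.ofReal ((∑' l, (wt j l : ℝ) * Y l ω) ^ 2) ∂P ≠ ⊤ := by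
    rw [lintegral_tsum fun j => ((hmT j).pow_const 2).ennreal_ofReal.aemeasurable]
    refine ne_top_of_le_ne_top ?_ (ENNReal.tsum_le_tsum hfat)
    rw [ENNReal.tsum_mul_left]
    exact ENNReal.mul_ne_top ENNReal.ofReal_ne_top tsum_wt_sq_ne_top
  filter_upwards [ae_lt_top (Measurable.tsum
    fun j => ((hmT j).pow_const 2).ennreal_ofReal) htot] with ω hω
  have h0 := ENNReal.tendsto_atTop_zero_of_tsum_ne_top hω.ne
  have h1 : Tendsto (fun j => (∑' l, (wt j l : ℝ) * Y l ω) ^ 2) atTop (𝓝 0) := by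
    have := (ENNReal.tendsto_toReal ENNReal.zero_ne_top).comp h0
    refine this.congr fun j => ?_
    simp [ENNReal.toReal_ofReal (sq_nonneg _)]
  have h2 := h1.sqrt
  simp only [Real.sqrt_zero, Real.sqrt_sq_eq_abs] at h2
  exact (tendsto_zero_iff_abs_tendsto_zero _).2 h2

/-- Fubini over the law of `(G, X)` and the independent law of `N`. With an earlier centred term as
`G`, this is the orthogonality of the centred terms. -/
theorem integral_mul_sub_eq_zero {𝒳 𝒴 : Type*} [MeasurableSpace 𝒳] [MeasurableSpace 𝒴]
    {X : Ω → 𝒳} {N : Ω → 𝒴} {G : Ω → ℝ} (hX : Measurable X) (hN : Measurable N)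
    (hG : Measurable G) (hind : IndepFun (fun ω => (G ω, X ω)) N P)
    {ψ : 𝒳 × 𝒴 → ℝ} (hψ : Measurable ψ) {B B' : ℝ} (hB : ∀ x, |ψ x| ≤ B) (hB' : ∀ ω, |G ω| ≤ B') :
    ∫ ω, G ω * (ψ (X ω, N ω) - ∫ n, ψ (X ω, n) ∂(P.map N)) ∂P = 0 := by
  have hbd : ∀ (f : Ω → ℝ) (K : ℝ), Measurable f → (∀ ω, |f ω| ≤ K) → Integrable f P :=
    fun f K hf hK => Integrable.of_bound hf.aestronglyMeasurable K (ae_of_all _ hK)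
  have : IsProbabilityMeasure (P.map N) := Measure.isProbabilityMeasure_map hN.aemeasurable
  have : IsProbabilityMeasure (P.map fun ω => (G ω, X ω)) :=
    Measure.isProbabilityMeasure_map (hG.prodMk hX).aemeasurable
  have hψbar : Measurable fun x => ∫ n, ψ (x, n) ∂(P.map N) :=
    hψ.stronglyMeasurable.integral_prod_right'.measurable
  have hψb : ∀ x, |∫ n, ψ (x, n) ∂(P.map N)| ≤ B := fun x => by
    simpa using norm_integral_le_of_norm_le_const (μ := P.map N) (f := fun n => ψ (x, n))
      (C := B) (ae_of_all _ fun n => hB _)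
  have hB0 : 0 ≤ B' := by
    obtain ⟨ω⟩ := nonempty_of_isProbabilityMeasure P
    exact (abs_nonneg _).trans (hB' ω)
  have hi : ∀ f : Ω → ℝ, Measurable f → (∀ ω, |f ω| ≤ B) → Integrable (fun ω => G ω * f ω) P :=
    fun f hf hfb => hbd _ (B' * B) (hG.mul hf) fun ω => by
      rw [abs_mul]; exact mul_le_mul (hB' ω) (hfb ω) (abs_nonneg _) hB0
  simp_rw [mul_sub]
  have i1 := integral_sub (hi _ (hψ.comp (hX.prodMk hN)) fun ω => hB _)
    (hi _ (hψbar.comp hX) fun ω => hψb _)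
  simp only [Function.comp] at i1
  rw [i1, sub_eq_zero]
  have hlaw := (indepFun_iff_map_prod_eq_prod_map_map (hG.prodMk hX).aemeasurable
    hN.aemeasurable).1 hind
  -- truncating the first coordinate makes the integrand bounded on the product space
  set c : ℝ → ℝ := fun g => max (-B') (min g B')
  have hc : ∀ ω, c (G ω) = G ω := fun ω => by
    have := abs_le.1 (hB' ω)
    simp [c, this.1, this.2]
  have hcm : Measurable c := by fun_prop
  have hcb : ∀ g, |c g| ≤ B' := fun g => abs_le.2
    ⟨le_max_left _ _, max_le (by linarith) (min_le_right _ _)⟩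
  have hF : Measurable fun p : (ℝ × 𝒳) × 𝒴 => c p.1.1 * ψ (p.1.2, p.2) := by fun_prop
  have e1 : ∫ ω, G ω * ψ (X ω, N ω) ∂P =
      ∫ p, c p.1.1 * ψ (p.1.2, p.2) ∂(P.map fun ω => ((G ω, X ω), N ω)) := by
    rw [integral_map ((hG.prodMk hX).prodMk hN).aemeasurable hF.aestronglyMeasurable]
    simp_rw [hc]
  rw [e1, hlaw, integral_prod _ (Integrable.of_bound hF.aestronglyMeasurable (B' * B)
    (ae_of_all _ fun p => by
      rw [Real.norm_eq_abs, abs_mul]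
      exact mul_le_mul (hcb _) (hB _) (abs_nonneg _) hB0))]
  simp_rw [integral_const_mul]
  have hm : Measurable fun x : ℝ × 𝒳 => c x.1 * ∫ n, ψ (x.2, n) ∂(P.map N) :=
    (hcm.comp measurable_fst).mul (hψbar.comp measurable_snd)
  rw [integral_map (hG.prodMk hX).aemeasurable hm.aestronglyMeasurable]
  simp_rw [hc]

/-- Weighted averages of a bounded function of an adapted variable and fresh noise are close to
those of its conditional mean. -/
theorem ae_tendsto_wt_sub {𝒳 𝒴 : Type*} [MeasurableSpace 𝒳] [MeasurableSpace 𝒴]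
    {𝒢 : ℕ → MeasurableSpace Ω} (hle : ∀ l, 𝒢 l ≤ ‹MeasurableSpace Ω›) (hmono : Monotone 𝒢)
    {X : ℕ → Ω → 𝒳} {N : ℕ → Ω → 𝒴} (hX : ∀ l, Measurable[𝒢 l] (X l))
    (hN : ∀ l, Measurable[𝒢 (l + 1)] (N l)) {lN : Measure 𝒴} (hlN : ∀ l, P.map (N l) = lN)
    (hind : ∀ l, Indep (𝒢 l) (MeasurableSpace.comap (N l) inferInstance) P)
    {ψ : 𝒳 × 𝒴 → ℝ} (hψ : Measurable ψ) {B : ℝ} (hB : ∀ x, |ψ x| ≤ B) :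
    ∀ᵐ ω ∂P, Tendsto (fun j => ∑' l, (wt j l : ℝ) *
      (ψ (X l ω, N l ω) - ∫ n, ψ (X l ω, n) ∂lN)) atTop (𝓝 0) := by
  have hNm : ∀ l, Measurable (N l) := fun l => (hN l).mono (hle _) le_rfl
  have hXm : ∀ l, Measurable (X l) := fun l => (hX l).mono (hle _) le_rfl
  have : IsProbabilityMeasure lN := hlN 0 ▸ Measure.isProbabilityMeasure_map (hNm 0).aemeasurable
  have hψbar : Measurable fun x => ∫ n, ψ (x, n) ∂lN :=
    hψ.stronglyMeasurable.integral_prod_right'.measurable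
  have hψb : ∀ x, |∫ n, ψ (x, n) ∂lN| ≤ B := fun x => by
    simpa using norm_integral_le_of_norm_le_const (μ := lN) (f := fun n => ψ (x, n))
      (C := B) (ae_of_all _ fun n => hB _)
  have hY : ∀ l, Measurable[𝒢 (l + 1)] fun ω => ψ (X l ω, N l ω) - ∫ n, ψ (X l ω, n) ∂lN := by
    intro l
    have hX' : Measurable[𝒢 (l + 1)] (X l) := (hX l).mono (hmono (Nat.le_succ l)) le_rfl
    exact (hψ.comp (hX'.prodMk (hN l))).sub (hψbar.comp hX')
  have hYb : ∀ l ω, |ψ (X l ω, N l ω) - ∫ n, ψ (X l ω, n) ∂lN| ≤ B + B := fun l ω =>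
    (abs_sub _ _).trans (add_le_add (hB _) (hψb _))
  refine ae_tendsto_wt_of_orthogonal (fun l => (hY l).mono (hle _) le_rfl) hYb fun l k hlk => ?_
  have hG : Measurable[𝒢 k] fun ω => ψ (X l ω, N l ω) - ∫ n, ψ (X l ω, n) ∂lN :=
    (hY l).mono (hmono hlk) le_rfl
  have h := integral_mul_sub_eq_zero (P := P) (hXm k) (hNm k) (hG.mono (hle _) le_rfl) (N := N k)
    (indep_of_indep_of_le_left (hind k) (hG.prodMk (hX k)).comap_le) hψ hB (hYb l)
  rw [hlN k] at h
  exact h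

end Orthogonal

/-! ### Information as σ-algebras generated by coordinates -/

section Sigma
variable {Ω : Type*} {ν : Noise Ω}

/-- The σ-algebra generated by the coordinates in `S`. -/
abbrev Noise.sigma (ν : Noise Ω) (S : Set (ℕ × Fin 4)) : MeasurableSpace Ω :=
  ⨆ x ∈ S, MeasurableSpace.comap (ν.coord x) inferInstance

theorem Noise.comap_le_sigma {S : Set (ℕ × Fin 4)} {x : ℕ × Fin 4} (hx : x ∈ S) :
    MeasurableSpace.comap (ν.coord x) inferInstance ≤ ν.sigma S :=
  le_iSup₂_of_le x hx le_rfl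

theorem Noise.measurable_sigma {S : Set (ℕ × Fin 4)} {x : ℕ × Fin 4} (hx : x ∈ S) :
    Measurable[ν.sigma S] (ν.coord x) :=
  measurable_iff_comap_le.2 (ν.comap_le_sigma hx)

/-- Coordinates that make up the history at step `i`. -/
def pastSet (i : ℕ) : Set (ℕ × Fin 4) := {x | x.1 < i ∨ (x.1 = i ∧ x.2 = 0)}

/-- Once information is described by a set of coordinates, independence amounts to disjointness of
index sets. -/
theorem Noise.history_eq (ν : Noise Ω) (i : ℕ) : ν.history i = ν.sigma (pastSet i) := by
  apply le_antisymm
  · refine sup_le (iSup₂_le fun j hj => ?_) (iSup₂_le fun j hj => sup_le (sup_le ?_ ?_) ?_)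
    · refine ν.comap_le_sigma (x := (j, 0)) ?_
      rcases lt_or_eq_of_le (Set.mem_Iic.1 hj) with h | h
      · exact Or.inl h
      · exact Or.inr ⟨h, rfl⟩
    · exact ν.comap_le_sigma (x := (j, 1)) (Or.inl hj)
    · exact ν.comap_le_sigma (x := (j, 2)) (Or.inl hj)
    · exact ν.comap_le_sigma (x := (j, 3)) (Or.inl hj)
  · refine iSup₂_le ?_
    rintro ⟨j, k⟩ hjk
    have hT : j ≤ i → MeasurableSpace.comap (ν.T j) inferInstance ≤ ν.history i := fun hj =>
      le_sup_of_le_left (le_iSup₂_of_le j hj le_rfl)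
    rcases hjk with h | ⟨h, h'⟩
    · have h' : j < i := h
      fin_cases k
      · exact hT h'.le
      · exact le_sup_of_le_right (le_iSup₂_of_le j h' (le_sup_of_le_left le_sup_left))
      · exact le_sup_of_le_right (le_iSup₂_of_le j h' (le_sup_of_le_left le_sup_right))
      · exact le_sup_of_le_right (le_iSup₂_of_le j h' le_sup_right)
    · have h1 : j = i := h
      have h2 : k = 0 := h'
      subst h2
      exact hT h1.le

theorem Noise.sigma_union (ν : Noise Ω) (S S' : Set (ℕ × Fin 4)) :
    ν.sigma S ⊔ ν.sigma S' = ν.sigma (S ∪ S') := iSup_union.symm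

theorem Noise.sigma_singleton (ν : Noise Ω) (x : ℕ × Fin 4) :
    ν.sigma {x} = MeasurableSpace.comap (ν.coord x) inferInstance := iSup_singleton

theorem Noise.sigma_mono (ν : Noise Ω) {S S' : Set (ℕ × Fin 4)} (h : S ⊆ S') :
    ν.sigma S ≤ ν.sigma S' := biSup_mono fun _ hx => h hx

theorem Noise.schedInfo_eq (ν : Noise Ω) (i : ℕ) :
    ν.schedInfo i = ν.sigma (pastSet i ∪ {(i, 2)}) := by
  rw [← ν.sigma_union, ν.sigma_singleton, ← ν.history_eq]; rfl

theorem Noise.sampInfo_eq (ν : Noise Ω) (i : ℕ) :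
    ν.sampInfo i = ν.sigma (pastSet i ∪ {(i, 2)} ∪ {(i, 3)}) := by
  rw [← ν.sigma_union, ν.sigma_singleton, ← ν.schedInfo_eq]; rfl

theorem Noise.doneInfo_eq (ν : Noise Ω) (i : ℕ) :
    ν.doneInfo i = ν.sigma (pastSet i ∪ {(i, 2)} ∪ {(i, 3)} ∪ {(i, 1)}) := by
  rw [← ν.sigma_union, ν.sigma_singleton, ← ν.sampInfo_eq]; rfl

theorem Noise.doneInfo_le_history (ν : Noise Ω) (i : ℕ) : ν.doneInfo i ≤ ν.history (i + 1) := by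
  rw [ν.doneInfo_eq, ν.history_eq]
  refine ν.sigma_mono ?_
  rintro ⟨j, k⟩ (((h | h) | h) | h) <;> simp [pastSet] at * <;> omega

theorem Noise.sampInfo_le_history (ν : Noise Ω) (i : ℕ) : ν.sampInfo i ≤ ν.history (i + 1) :=
  le_sup_left.trans (ν.doneInfo_le_history i)

theorem Noise.schedInfo_le_history (ν : Noise Ω) (i : ℕ) : ν.schedInfo i ≤ ν.history (i + 1) :=
  le_sup_left.trans (ν.sampInfo_le_history i)

theorem Noise.history_le_sampInfo (ν : Noise Ω) (i : ℕ) : ν.history i ≤ ν.sampInfo i :=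
  le_sup_of_le_left le_sup_left

theorem Noise.history_mono (ν : Noise Ω) : Monotone ν.history :=
  monotone_nat_of_le_succ fun i => (ν.history_le_sampInfo i).trans (ν.sampInfo_le_history i)

theorem Noise.sampInfo_mono (ν : Noise Ω) : Monotone ν.sampInfo :=
  monotone_nat_of_le_succ fun i =>
    (ν.sampInfo_le_history i).trans (ν.history_le_sampInfo (i + 1))

theorem Noise.measurable_T_history (ν : Noise Ω) {j i : ℕ} (h : j ≤ i) :
    Measurable[ν.history i] (ν.T j) := by
  rw [ν.history_eq]
  refine ν.measurable_sigma (x := (j, 0)) ?_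
  rcases lt_or_eq_of_le h with h | h
  · exact Or.inl h
  · exact Or.inr ⟨h, rfl⟩

theorem Noise.measurable_C_history (ν : Noise Ω) {j i : ℕ} (h : j < i) :
    Measurable[ν.history i] (ν.C j) := by
  rw [ν.history_eq]
  exact ν.measurable_sigma (x := (j, 1)) (Or.inl h)

theorem Noise.measurable_V_sampInfo (ν : Noise Ω) (i : ℕ) : Measurable[ν.sampInfo i] (ν.V i) := by
  rw [ν.sampInfo_eq]
  exact ν.measurable_sigma (x := (i, 3)) (Or.inr rfl)

theorem Noise.measurable_C_doneInfo (ν : Noise Ω) (i : ℕ) : Measurable[ν.doneInfo i] (ν.C i) := by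
  rw [ν.doneInfo_eq]
  exact ν.measurable_sigma (x := (i, 1)) (Or.inr rfl)

end Sigma

section Model
variable {Ω : Type*} [MeasurableSpace Ω] {P : Measure Ω} {μT μC : Measure ℝ} {ν : Noise Ω}

theorem Noise.IsModel.meas_T (h : ν.IsModel P μT μC) (i : ℕ) : Measurable (ν.T i) := h.meas (i, 0)
theorem Noise.IsModel.meas_C (h : ν.IsModel P μT μC) (i : ℕ) : Measurable (ν.C i) := h.meas (i, 1)
theorem Noise.IsModel.meas_U (h : ν.IsModel P μT μC) (i : ℕ) : Measurable (ν.U i) := h.meas (i, 2)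

theorem Noise.IsModel.sigma_le (h : ν.IsModel P μT μC) (S : Set (ℕ × Fin 4)) :
    ν.sigma S ≤ ‹MeasurableSpace Ω› :=
  iSup₂_le fun x _ => (h.meas x).comap_le

theorem Noise.IsModel.indep_sigma (h : ν.IsModel P μT μC) {S S' : Set (ℕ × Fin 4)}
    (hd : Disjoint S S') : Indep (ν.sigma S) (ν.sigma S') P :=
  indep_iSup_of_disjoint (fun x => (h.meas x).comap_le) h.indep hd

theorem Noise.IsModel.history_le (h : ν.IsModel P μT μC) (i : ℕ) :
    ν.history i ≤ ‹MeasurableSpace Ω› := ν.history_eq i ▸ h.sigma_le _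

theorem Noise.IsModel.sampInfo_le (h : ν.IsModel P μT μC) (i : ℕ) :
    ν.sampInfo i ≤ ‹MeasurableSpace Ω› := ν.sampInfo_eq i ▸ h.sigma_le _

/-- The pair `(C i, T (i+1))` is the noise that the `i`-th threshold meets; neither coordinate
enters the information from which the threshold is planned. -/
theorem Noise.IsModel.indep_sampInfo (h : ν.IsModel P μT μC) (i : ℕ) :
    Indep (ν.sampInfo i)
      (MeasurableSpace.comap (fun ω => (ν.C i ω, ν.T (i + 1) ω)) inferInstance) P := by
  rw [ν.sampInfo_eq]
  have hd : Disjoint (pastSet i ∪ {(i, 2)} ∪ {(i, 3)}) ({(i, 1), (i + 1, 0)} : Set (ℕ × Fin 4)) := by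
    rw [Set.disjoint_left]
    rintro ⟨j, k⟩ ((h | h) | h) <;> simp [pastSet] at * <;> omega
  refine indep_of_indep_of_le_right (h.indep_sigma hd) ?_
  refine Measurable.comap_le ?_
  exact (ν.measurable_sigma (x := (i, 1)) (by simp)).prodMk
    (ν.measurable_sigma (x := (i + 1, 0)) (by simp))

theorem Noise.IsModel.map_C_T [IsProbabilityMeasure P] (h : ν.IsModel P μT μC) (i : ℕ) :
    P.map (fun ω => (ν.C i ω, ν.T (i + 1) ω)) = μC.prod μT := by
  have hi : IndepFun (ν.C i) (ν.T (i + 1)) P :=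
    h.indep.indepFun (i := (i, 1)) (j := (i + 1, 0)) (by simp)
  rw [(indepFun_iff_map_prod_eq_prod_map_map (h.meas_C i).aemeasurable
    (h.meas_T _).aemeasurable).1 hi, h.law_C, h.law_T]

end Model

/-! ### Weighted averages and occupation laws along a path -/

/-- Two sequences have asymptotically the same weighted averages. -/
def WtEquiv (f g : ℕ → ℝ≥0) : Prop :=
  Tendsto (fun j => ∑' l, (wt j l : ℝ) * ((f l : ℝ) - g l)) atTop (𝓝 0)

/-- Weighted average of a sequence. -/
def wtAvg (f : ℕ → ℝ≥0) (j : ℕ) : ℝ≥0∞ := ∑' l, (wt j l : ℝ≥0∞) * f l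

theorem summable_wt_mul_nnreal {f : ℕ → ℝ≥0} {B : ℝ≥0} (hB : ∀ l, f l ≤ B) (j : ℕ) :
    Summable fun l => wt j l * f l :=
  NNReal.summable_of_le (fun l => mul_le_mul_of_nonneg_left (hB l) zero_le)
    ((summable_wt j).mul_right B)

theorem wtAvg_eq_coe {f : ℕ → ℝ≥0} {B : ℝ≥0} (hB : ∀ l, f l ≤ B) (j : ℕ) :
    wtAvg f j = ((∑' l, wt j l * f l : ℝ≥0) : ℝ≥0∞) := by
  rw [ENNReal.coe_tsum (summable_wt_mul_nnreal hB j)]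
  simp [wtAvg]

theorem WtEquiv.tendsto {f g : ℕ → ℝ≥0} (h : WtEquiv f g) {B B' : ℝ≥0} (hB : ∀ l, f l ≤ B)
    (hB' : ∀ l, g l ≤ B') {F : Filter ℕ} (hF : F ≤ atTop) {c : ℝ≥0∞} (hc : c ≠ ⊤)
    (hg : Tendsto (wtAvg g) F (𝓝 c)) : Tendsto (wtAvg f) F (𝓝 c) := by
  lift c to ℝ≥0 using hc
  have e1 : wtAvg f = fun j => ((∑' l, wt j l * f l : ℝ≥0) : ℝ≥0∞) := funext (wtAvg_eq_coe hB)
  have e2 : wtAvg g = fun j => ((∑' l, wt j l * g l : ℝ≥0) : ℝ≥0∞) := funext (wtAvg_eq_coe hB')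
  rw [e1, ENNReal.tendsto_coe, ← NNReal.tendsto_coe]
  rw [e2, ENNReal.tendsto_coe, ← NNReal.tendsto_coe] at hg
  have := (h.mono_left hF).add hg
  rw [zero_add] at this
  refine this.congr fun j => ?_
  simp only [NNReal.coe_tsum, NNReal.coe_mul]
  have s1 : Summable fun l => (wt j l : ℝ) * f l := by
    simpa using NNReal.summable_coe.2 (summable_wt_mul_nnreal hB j)
  have s2 : Summable fun l => (wt j l : ℝ) * g l := by
    simpa using NNReal.summable_coe.2 (summable_wt_mul_nnreal hB' j)
  have s3 : Summable fun l => (wt j l : ℝ) * ((f l : ℝ) - g l) := by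
    simpa [mul_sub] using s1.sub s2
  rw [← s3.tsum_add s2]
  congr 1; ext l; ring

/-- Removing finitely many terms does not affect limits of weighted averages. -/
theorem tendsto_wtAvg_tail {f : ℕ → ℝ≥0} {F : Filter ℕ} (hF : F ≤ atTop) {c : ℝ≥0∞}
    (h : Tendsto (wtAvg f) F (𝓝 c)) (hc : c ≠ ⊤) (L : ℕ) :
    Tendsto (fun j => ∑' l, (wt j (l + L) : ℝ≥0∞) * f (l + L)) F (𝓝 c) := by
  -- Each single weight vanishes as `j → ∞`, so a fixed finite block carries no mass in the limit.
  have hz : Tendsto (fun j => ∑ l ∈ Finset.range L, (wt j l : ℝ≥0∞) * f l) F (𝓝 0) := by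
    have : Tendsto (fun j => ∑ l ∈ Finset.range L, (wt j l : ℝ≥0∞) * f l) atTop
        (𝓝 (∑ l ∈ Finset.range L, 0 * (f l : ℝ≥0∞))) := by
      refine tendsto_finsetSum _ fun l _ => ?_
      refine ENNReal.Tendsto.mul_const ?_ (Or.inr ENNReal.coe_ne_top)
      exact ENNReal.coe_zero ▸ ENNReal.tendsto_coe.2 (tendsto_wt l)
    simpa using this.mono_left hF
  have := ENNReal.Tendsto.sub h hz (Or.inl hc)
  rw [tsub_zero] at this
  refine this.congr fun j => ?_
  rw [wtAvg, ← (ENNReal.summable (f := fun l =>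
    (wt j (l + L) : ℝ≥0∞) * f (l + L))).sum_add_tsum_nat_add' (f := fun l =>
    (wt j l : ℝ≥0∞) * f l)]
  refine ENNReal.add_sub_cancel_left (ENNReal.sum_ne_top.2 fun l _ => ?_)
  exact ENNReal.mul_ne_top ENNReal.coe_ne_top ENNReal.coe_ne_top

section Occupation
variable {X : Type*} [TopologicalSpace X] [MeasurableSpace X] [BorelSpace X]

/-- Weighted empirical law of a sequence. -/
def occupation (key : ℕ → X) (j : ℕ) : ProbabilityMeasure X :=
  ⟨Measure.sum fun l => (wt j l : ℝ≥0∞) • Measure.dirac (key l), ⟨by simp [tsum_coe_wt]⟩⟩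

theorem lintegral_occupation (key : ℕ → X) (j : ℕ) (φ : C(X, ℝ≥0)) :
    ∫⁻ x, φ x ∂(occupation key j : Measure X) = wtAvg (fun l => φ (key l)) j := by
  have hm : Measurable fun x => (φ x : ℝ≥0∞) := by fun_prop
  simp only [occupation, ProbabilityMeasure.coe_mk, lintegral_sum_measure, lintegral_smul_measure,
    lintegral_dirac' _ hm, smul_eq_mul, wtAvg]

theorem tendsto_wtAvg_of_occupation [CompactSpace X] {key : ℕ → X} {F : Filter ℕ}
    {η : ProbabilityMeasure X}
    (h : Tendsto (occupation key) F (𝓝 η)) (φ : C(X, ℝ≥0)) :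
    Tendsto (wtAvg fun l => φ (key l)) F (𝓝 (∫⁻ x, φ x ∂(η : Measure X))) := by
  refine (((continuous_lintegral_prob φ).tendsto η).comp h).congr fun j => ?_
  exact lintegral_occupation key j φ

end Occupation

theorem exists_bound_of_compact {X : Type*} [TopologicalSpace X] [CompactSpace X]
    (φ : C(X, ℝ≥0)) : ∃ B, ∀ x, φ x ≤ B := by
  obtain ⟨B, hB⟩ := (isCompact_range φ.continuous).bddAbove
  exact ⟨B, fun x => hB ⟨x, rfl⟩⟩

theorem tendsto_lintegral_of_tendsto_continuousMap {X : Type*} [TopologicalSpace X] [CompactSpace X]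
    [MeasurableSpace X] [OpensMeasurableSpace X] (μ : Measure X) [IsFiniteMeasure μ]
    {u : ℕ → C(X, ℝ≥0)} {φ : C(X, ℝ≥0)} (h : Tendsto u atTop (𝓝 φ)) :
    Tendsto (fun n => ∫⁻ x, u n x ∂μ) atTop (𝓝 (∫⁻ x, φ x ∂μ)) := by
  obtain ⟨B, hB⟩ := exists_bound_of_compact φ
  refine tendsto_lintegral_filter_of_dominated_convergence (fun _ => ((B + 1 : ℝ≥0) : ℝ≥0∞))
    (Eventually.of_forall fun n => by fun_prop) ?_ ?_ ?_
  · filter_upwards [Metric.tendsto_nhds.1 h 1 one_pos] with n hn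
    refine ae_of_all _ fun x => ENNReal.coe_le_coe.2 ?_
    have h1 := (ContinuousMap.dist_apply_le_dist (f := u n) (g := φ) x).trans hn.le
    rw [NNReal.dist_eq] at h1
    have h2 := (abs_le.1 h1).2
    have h3 := NNReal.coe_le_coe.2 (hB x)
    rw [← NNReal.coe_le_coe]
    push_cast
    linarith
  · simp [ENNReal.mul_eq_top]
  · refine ae_of_all _ fun x => ENNReal.tendsto_coe.2 ?_
    exact ((continuous_eval_const (F := C(X, ℝ≥0)) x).tendsto φ).comp h

/-! ### The pathwise lower bound -/

section LowerBoundPath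
variable {M : ℕ}

/-- Asymptotic decision laws are admissible. -/
theorem CostData.mem_admissible_of_tendsto (D : CostData) [IsProbabilityMeasure D.base]
    {key : ℕ → Key M} {F : Filter ℕ} [F.NeBot] (hF : F ≤ atTop) {η : ProbabilityMeasure (Key M)}
    (hη : Tendsto (occupation key) F (𝓝 η)) {𝒟 : Set C(ℝ≥0∞, ℝ≥0)} (h𝒟 : Dense 𝒟)
    (h : ∀ φ ∈ 𝒟, ∀ m, WtEquiv (fun l => srcInd m (key l) * φ (key l).2.1)
      (fun l => srcInd m (key l) * (∫⁻ t, φ t ∂D.base).toNNReal)) :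
    η ∈ D.admissible M := by
  intro m φ
  set pr : C(Key M, ℝ≥0∞) := ⟨fun x => x.2.1, by fun_prop⟩
  have hfin : ∀ φ : C(ℝ≥0∞, ℝ≥0), ∫⁻ t, φ t ∂D.base ≠ ⊤ := fun φ =>
    lintegral_ne_top_of_compact φ ⟨D.base, inferInstance⟩
  have hD : ∀ φ ∈ 𝒟, ∫⁻ x, srcInd m x * φ x.2.1 ∂(η : Measure (Key M)) =
      (∫⁻ x, srcInd m x ∂(η : Measure (Key M))) * ∫⁻ t, φ t ∂D.base := by
    intro φ hφ
    set c := (∫⁻ t, φ t ∂D.base).toNNReal with hc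
    have hcc : (c : ℝ≥0∞) = ∫⁻ t, φ t ∂D.base := ENNReal.coe_toNNReal (hfin φ)
    obtain ⟨B, hB⟩ := exists_bound_of_compact (srcInd m * φ.comp pr)
    obtain ⟨B', hB'⟩ := exists_bound_of_compact (srcInd m * ContinuousMap.const (Key M) c)
    have t1 := tendsto_wtAvg_of_occupation hη (srcInd m * φ.comp pr)
    have t2 := tendsto_wtAvg_of_occupation hη (srcInd m * ContinuousMap.const (Key M) c)
    have t3 := (h φ hφ m).tendsto (fun l => hB (key l)) (fun l => hB' (key l)) hF
      (lintegral_ne_top_of_compact _ η) t2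
    have := tendsto_nhds_unique t1 t3
    simp only [ContinuousMap.mul_apply, ContinuousMap.comp_apply, ContinuousMap.const_apply,
      ENNReal.coe_mul] at this
    rw [lintegral_mul_const _ (by fun_prop), hcc] at this
    exact this
  -- Both sides of the identity are continuous in `φ` for the uniform norm, so a dense set of test
  -- functions suffices.
  obtain ⟨u, hu, hlim⟩ := mem_closure_iff_seq_limit.1 (h𝒟 φ)
  have a1 := tendsto_lintegral_of_tendsto_continuousMap D.base hlim
  have hcont : Continuous fun φ : C(ℝ≥0∞, ℝ≥0) => srcInd m * φ.comp pr :=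
    continuous_const.mul (ContinuousMap.continuous_precomp pr)
  have a2 := tendsto_lintegral_of_tendsto_continuousMap (η : Measure (Key M))
    ((hcont.tendsto φ).comp hlim)
  simp only [Function.comp_apply, ContinuousMap.mul_apply, ContinuousMap.comp_apply,
    ENNReal.coe_mul] at a2
  have a3 := ENNReal.Tendsto.const_mul (a := ∫⁻ x, srcInd m x ∂(η : Measure (Key M))) a1
    (Or.inr (lintegral_ne_top_of_compact _ η))
  refine tendsto_nhds_unique a2 (a3.congr fun n => ?_)
  exact (hD (u n) (hu n)).symm

/-- Lower bound for the weighted peak ages along one path. -/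
theorem CostData.le_liminf_of_path (D : CostData) [IsProbabilityMeasure D.base] (w : Fin M → ℝ)
    (hpos : ∀ K θ, 0 < D.inc K θ) {key : ℕ → Key M} {𝒟 : Set C(ℝ≥0∞, ℝ≥0)} (h𝒟 : Dense 𝒟)
    (h : ∀ φ ∈ 𝒟, ∀ m, WtEquiv (fun l => srcInd m (key l) * φ (key l).2.1)
      (fun l => srcInd m (key l) * (∫⁻ t, φ t ∂D.base).toNNReal))
    {d : Fin M → ℕ → ℝ≥0} (hd1 : ∀ m l, d m l ≤ 1)
    (hd : ∀ m, WtEquiv (d m) fun l => D.rateFn m (key l))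
    {b : ℕ → Fin M → ℕ → ℝ≥0} (hbB : ∀ K m, ∃ B, ∀ l, b K m l ≤ B)
    (hb : ∀ K m, WtEquiv (b K m) fun l => D.gainFn K m (key l))
    {r : Fin M → ℕ → ℝ≥0∞} (hr : ∀ K m l, 1 ≤ l → (b K m l : ℝ≥0∞) ≤ r m l)
    {cnt : Fin M → ℕ → ℕ} (hcnt : ∀ m n, (cnt m n : ℝ≥0) = ∑ l ∈ Finset.range n, d m l)
    (hfreq : ∀ m, ∃ x : ℝ, Tendsto (fun n : ℕ => (cnt m n : ℝ) / n) atTop (𝓝 x))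
    {Q : Fin M → ℕ → ℝ≥0∞}
    (hQ : ∀ m j, ∑' l, (wt j (cnt m (l + 2)) : ℝ≥0∞) * r m (l + 1) ≤ Q m j)
    {V : ℝ≥0∞} (hV : ∀ η ∈ D.admissible M, V ≤ ⨆ K, D.cost w K (η : Measure (Key M))) :
    V ≤ liminf (fun j => ∑ m, ENNReal.ofReal (w m) * Q m j) atTop := by
  refine le_of_forall_gt_imp_ge_of_dense fun c hc => ?_
  have hfr := frequently_lt_of_liminf_lt (by isBoundedDefault) hc
  have hne : (atTop ⊓ 𝓟 {j | ∑ m, ENNReal.ofReal (w m) * Q m j < c}).NeBot :=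
    frequently_mem_iff_neBot.1 hfr
  -- An ultrafilter supported on indices where the weighted cost is below `c`: the occupation laws
  -- and all the `Q m` converge along it simultaneously.
  set 𝒰 := Ultrafilter.of (atTop ⊓ 𝓟 {j | ∑ m, ENNReal.ofReal (w m) * Q m j < c})
  have h𝒰 : (𝒰 : Filter ℕ) ≤ atTop := (Ultrafilter.of_le _).trans inf_le_left
  have h𝒰c : ∀ᶠ j in (𝒰 : Filter ℕ), ∑ m, ENNReal.ofReal (w m) * Q m j < c :=
    (Ultrafilter.of_le _).trans inf_le_right (mem_principal_self _)
  obtain ⟨η, -, hη⟩ := isCompact_univ.ultrafilter_le_nhds (𝒰.map (occupation key)) (by simp)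
  have hη : Tendsto (occupation key) 𝒰 (𝓝 η) := hη
  have hadm := D.mem_admissible_of_tendsto h𝒰 hη h𝒟 h
  refine (hV η hadm).trans (iSup_le fun K => ?_)
  have hq : ∀ m, ∃ q, Tendsto (Q m) 𝒰 (𝓝 q) := fun m => by
    obtain ⟨q, -, hq⟩ := isCompact_univ.ultrafilter_le_nhds (𝒰.map (Q m)) (by simp)
    exact ⟨q, hq⟩
  choose q hq using hq
  have hqc : ∑ m, ENNReal.ofReal (w m) * q m ≤ c := by
    refine le_of_tendsto (tendsto_finsetSum _ fun m _ =>
      ENNReal.Tendsto.const_mul (hq m) (Or.inr ENNReal.ofReal_ne_top)) ?_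
    exact h𝒰c.mono fun j hj => hj.le
  refine le_trans (Finset.sum_le_sum fun m _ => ?_) hqc
  refine mul_le_mul_of_nonneg_left ?_ zero_le
  obtain ⟨B, hB⟩ := hbB K m
  obtain ⟨B', hB'⟩ := exists_bound_of_compact (D.gainFn K m)
  obtain ⟨B'', hB''⟩ := exists_bound_of_compact (D.rateFn m)
  have hgfin := lintegral_ne_top_of_compact (D.gainFn K m) η
  have hrfin := lintegral_ne_top_of_compact (D.rateFn m) η
  have tg := (hb K m).tendsto hB (fun l => hB' (key l)) h𝒰 hgfin
    (tendsto_wtAvg_of_occupation hη (D.gainFn K m))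
  have tr := (hd m).tendsto (hd1 m) (fun l => hB'' (key l)) h𝒰 hrfin
    (tendsto_wtAvg_of_occupation hη (D.rateFn m))
  set γ := ∫⁻ x, D.gainFn K m x ∂(η : Measure (Key M))
  set ρ := ∫⁻ x, D.rateFn m x ∂(η : Measure (Key M))
  obtain ⟨x, hx⟩ := hfreq m
  -- the Cesàro frequency is at most the weighted one
  have hxρ : ENNReal.ofReal x ≤ ρ := by
    -- The Abelian comparison bounds weighted averages only from above, so it is applied to the
    -- fraction of packets that do not count for `m`; passing to complements gives `x ≤ ρ`.
    have hcmp := limsup_wt_le fun l => ((1 - d m l : ℝ≥0) : ℝ≥0∞)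
    have hsum : ∀ n : ℕ, ∑ l ∈ Finset.range n, (1 - d m l) + cnt m n = (n : ℝ≥0) := by
      intro n
      rw [hcnt, ← Finset.sum_add_distrib]
      simp [tsub_add_cancel_of_le (hd1 m _)]
    have hces : Tendsto (fun n : ℕ => (∑ l ∈ Finset.range n, ((1 - d m l : ℝ≥0) : ℝ≥0∞)) / n) atTop
        (𝓝 (ENNReal.ofReal (1 - x))) := by
      have t := (ENNReal.continuous_ofReal.tendsto _).comp (hx.const_sub 1)
      refine t.congr' ?_
      filter_upwards [eventually_gt_atTop 0] with n hn
      have hn' : (0 : ℝ) < n := by exact_mod_cast hn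
      have e : 1 - (cnt m n : ℝ) / n = (∑ l ∈ Finset.range n, (1 - d m l) : ℝ≥0) / (n : ℝ) := by
        have := congrArg (fun y : ℝ≥0 => (y : ℝ)) (hsum n)
        push_cast at this ⊢
        field_simp
        linarith
      simp only [Function.comp_apply]
      rw [e, ENNReal.ofReal_div_of_pos hn', ENNReal.ofReal_coe_nnreal, ENNReal.ofReal_natCast,
        ENNReal.ofNNReal_finsetSum]
    rw [hces.limsup_eq] at hcmp
    have hone : ∀ j, wtAvg (d m) j + wtAvg (fun l => 1 - d m l) j = 1 := by
      intro j
      rw [wtAvg, wtAvg, ← ENNReal.tsum_add, ← tsum_coe_wt j]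
      refine tsum_congr fun l => ?_
      rw [← mul_add, ← ENNReal.coe_add, add_tsub_cancel_of_le (hd1 m l)]
      simp
    have t1 : Tendsto (wtAvg fun l => 1 - d m l) 𝒰 (𝓝 (1 - ρ)) := by
      have := ENNReal.Tendsto.sub (tendsto_const_nhds (x := (1 : ℝ≥0∞))) tr
        (Or.inl ENNReal.one_ne_top)
      refine this.congr fun j => ?_
      have hf : wtAvg (d m) j ≠ ⊤ := by rw [wtAvg_eq_coe (hd1 m)]; exact ENNReal.coe_ne_top
      rw [← hone j, ENNReal.add_sub_cancel_left hf]
    have hle : 1 - ρ ≤ ENNReal.ofReal (1 - x) := by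
      refine le_trans ?_ hcmp
      refine le_of_forall_gt_imp_ge_of_dense fun a ha => ?_
      have := (eventually_lt_of_limsup_lt ha).filter_mono h𝒰
      exact le_of_tendsto t1 (this.mono fun j hj => hj.le)
    have hx1 : x ≤ 1 := by
      refine le_of_tendsto hx (Eventually.of_forall fun n => ?_)
      refine div_le_one_of_le₀ ?_ (Nat.cast_nonneg n)
      have : (cnt m n : ℝ≥0) ≤ n := by rw [← hsum n]; exact le_add_self
      exact_mod_cast this
    have hx0 : 0 ≤ x := ge_of_tendsto hx (Eventually.of_forall fun n => by positivity)
    rw [tsub_le_iff_right] at hle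
    have h1 : ENNReal.ofReal (1 - x) + ENNReal.ofReal x = 1 := by
      rw [← ENNReal.ofReal_add (by linarith) hx0]; simp
    rw [← h1] at hle
    exact (ENNReal.add_le_add_iff_left ENNReal.ofReal_ne_top).1 hle
  -- rescaling
  have hy : ∀ y : ℝ≥0, ρ < y → γ / y ≤ q m := by
    intro y hy
    have hy0 : 0 < y := by
      have := lt_of_le_of_lt zero_le hy
      exact_mod_cast this
    have hxy : x < y := by
      have := lt_of_le_of_lt hxρ hy
      rw [← ENNReal.ofReal_coe_nnreal] at this
      exact (ENNReal.ofReal_lt_ofReal_iff (by exact_mod_cast hy0)).1 this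
    -- Counts grow at rate `x ≤ ρ < y`; the summand 1 matches the `+ 1` in the base of the power
    -- weights.
    have hev : ∀ᶠ n : ℕ in atTop, (cnt m n : ℝ≥0) + 1 ≤ y * n := by
      have t := (hx.add (tendsto_inv_atTop_nhds_zero_nat (𝕜 := ℝ)))
      rw [add_zero] at t
      filter_upwards [t.eventually (gt_mem_nhds hxy), eventually_gt_atTop 0] with n hn hn0
      have hn' : (0 : ℝ) < n := by exact_mod_cast hn0
      rw [← NNReal.coe_le_coe]
      push_cast
      rw [inv_eq_one_div, ← add_div, div_lt_iff₀ hn'] at hn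
      exact hn.le
    obtain ⟨n0, hn0⟩ := eventually_atTop.1 hev
    -- Each delivery-index weight is compared with the packet-index weight by `wt_scale`; the terms
    -- before `n0` are discarded.
    have hlow : ∀ j, (((y ^ wtExp j)⁻¹ : ℝ≥0) : ℝ≥0∞) *
        ∑' l, (wt j (l + (n0 + 1)) : ℝ≥0∞) * b K m (l + (n0 + 1)) ≤ Q m j := by
      intro j
      refine le_trans ?_ (hQ m j)
      refine le_trans ?_ (ENNReal.tsum_comp_le_tsum_of_injective
        (add_left_injective n0) _)
      rw [← ENNReal.tsum_mul_left]
      refine ENNReal.tsum_le_tsum fun l => ?_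
      rw [← mul_assoc, ← ENNReal.coe_mul]
      refine mul_le_mul' (ENNReal.coe_le_coe.2 ?_) (hr K m _ (by omega))
      refine wt_scale ?_ j
      have := hn0 (l + n0 + 2) (by omega)
      push_cast at this ⊢
      refine this.trans (le_of_eq ?_)
      ring
    have t1 : Tendsto (fun j => (((y ^ wtExp j)⁻¹ : ℝ≥0) : ℝ≥0∞)) 𝒰 (𝓝 ((y⁻¹ : ℝ≥0) : ℝ≥0∞)) := by
      refine ENNReal.tendsto_coe.2 (Tendsto.mono_left ?_ h𝒰)
      refine Tendsto.inv₀ ?_ hy0.ne'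
      have := (tendsto_const_nhds (x := y)).nnrpow tendsto_wtExp (Or.inl hy0.ne')
      simpa using this
    have t2 := ENNReal.Tendsto.mul t1 (Or.inr hgfin) (tendsto_wtAvg_tail h𝒰 tg hgfin (n0 + 1))
      (Or.inr ENNReal.coe_ne_top)
    have := le_of_tendsto_of_tendsto' t2 (hq m) hlow
    rwa [ENNReal.coe_inv hy0.ne', mul_comm, ← div_eq_mul_inv] at this
  have hγ0 : γ ≠ 0 := by
    intro h0
    rw [lintegral_eq_zero_iff (by fun_prop)] at h0
    obtain ⟨z, hz⟩ := h0.exists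
    have := hpos K z.2.2
    simp only [gainFn, ContinuousMap.add_apply, ContinuousMap.comp_apply, ContinuousMap.coe_mk,
      Pi.zero_apply, ENNReal.coe_eq_zero, add_eq_zero] at hz
    exact this.ne' hz.1
  -- Letting `y` decrease to `ρ`. Since `γ ≠ 0`, this also covers `ρ = 0`, where the quotient is
  -- infinite.
  have hlim : Tendsto (fun n : ℕ => γ / ((ρ.toNNReal + (n + 1 : ℝ≥0)⁻¹ : ℝ≥0) : ℝ≥0∞)) atTop
      (𝓝 (γ / ρ)) := by
    refine ENNReal.Tendsto.div tendsto_const_nhds (Or.inl hγ0) ?_ (Or.inr hgfin)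
    conv => rhs; rw [← ENNReal.coe_toNNReal hrfin]
    refine ENNReal.tendsto_coe.2 ?_
    have : Tendsto (fun n : ℕ => ((n : ℝ≥0) + 1)⁻¹) atTop (𝓝 0) := by
      rw [← NNReal.tendsto_coe]
      simpa using tendsto_one_div_add_atTop_nhds_zero_nat (𝕜 := ℝ)
    simpa using this.const_add ρ.toNNReal
  refine le_of_tendsto' hlim fun n => hy _ ?_
  conv_lhs => rw [← ENNReal.coe_toNNReal hrfin]
  rw [ENNReal.coe_lt_coe]
  exact lt_add_of_pos_right _ (by positivity)

end LowerBoundPath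

/-! ### Peak ages expressed through delivery counts -/

section Path
variable {Ω : Type*} {M : ℕ}

open Classical in
/-- Number of delivered packets of source `m` among the packets `1, …, n`. -/
def recvCount (srv : Server) (ν : Noise Ω) (ξ : Scheduler Ω M) (Z : Sampler Ω) (m : Fin M) (ω : Ω)
    (n : ℕ) : ℕ := ((Finset.Icc 1 n).filter (ReceivedFrom srv ν ξ Z m ω)).card

/-- Time from generation to delivery. -/
def sysTime (srv : Server) (ν : Noise Ω) (Z : Sampler Ω) (i : ℕ) (ω : Ω) : ℝ :=
  ν.T i ω + waiting srv ν Z i ω + ν.C i ω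

open Classical in
/-- The peak age expressed through the delivery counts; `0` when there is no such delivery. -/
def countedPeak (srv : Server) (ν : Noise Ω) (ξ : Scheduler Ω M) (Z : Sampler Ω) (m : Fin M)
    (k : ℕ) (ω : Ω) : ℝ≥0∞ :=
  (∑' i, if recvCount srv ν ξ Z m ω i = k then ENNReal.ofReal (Z i ω) else 0) +
  ∑' i, if recvCount srv ν ξ Z m ω i = k + 1 ∧ ReceivedFrom srv ν ξ Z m ω i then
    ENNReal.ofReal (sysTime srv ν Z i ω) else 0

variable {srv : Server} {ν : Noise Ω} {ξ : Scheduler Ω M} {Z : Sampler Ω} {m : Fin M} {ω : Ω}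

open Classical in
theorem recvCount_eq_count (n : ℕ) :
    recvCount srv ν ξ Z m ω n = Nat.count (ReceivedFrom srv ν ξ Z m ω) (n + 1) := by
  rw [recvCount, Nat.count_eq_card_filter_range]
  congr 1
  ext i
  simp only [Finset.mem_filter, Finset.mem_Icc, Finset.mem_range]
  constructor
  · rintro ⟨⟨_, h⟩, hp⟩; exact ⟨by omega, hp⟩
  · rintro ⟨h, hp⟩; exact ⟨⟨hp.1, by omega⟩, hp⟩

theorem recvCount_zero : recvCount srv ν ξ Z m ω 0 = 0 := by simp [recvCount]

open Classical in
theorem recvCount_succ (n : ℕ) : recvCount srv ν ξ Z m ω (n + 1) =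
    recvCount srv ν ξ Z m ω n + if ReceivedFrom srv ν ξ Z m ω (n + 1) then 1 else 0 := by
  rw [recvCount_eq_count, Nat.count_succ, recvCount_eq_count]

theorem recvCount_mono : Monotone (recvCount srv ν ξ Z m ω) := by
  classical
  exact monotone_nat_of_le_succ fun n => by rw [recvCount_succ]; omega

theorem recvCount_pos {i : ℕ} (h : ReceivedFrom srv ν ξ Z m ω i) :
    1 ≤ recvCount srv ν ξ Z m ω i := by
  classical
  obtain ⟨n, rfl⟩ : ∃ n, i = n + 1 := ⟨i - 1, by have := h.1; omega⟩
  rw [recvCount_succ, if_pos h]; omega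

theorem genTime_sub (i j : ℕ) (hji : j ≤ i) (hZ : ∀ n, 0 ≤ Z n ω) :
    ENNReal.ofReal (genTime ν Z i ω - genTime ν Z j ω) =
      ∑ n ∈ Finset.Ico j i, ENNReal.ofReal (Z n ω) := by
  rw [← ENNReal.ofReal_sum_of_nonneg fun n _ => hZ n]
  congr 1
  induction i, hji using Nat.le_induction with
  | base => simp
  | succ i hji ih => rw [Finset.sum_Ico_succ_top hji, ← ih, genTime]; ring

theorem genTime_mono (hZ : ∀ n, 0 ≤ Z n ω) : Monotone fun i => genTime ν Z i ω :=
  monotone_nat_of_le_succ fun i => by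
    have := hZ i
    simp only [genTime]; linarith

/-- The interval between two consecutive deliveries of `m` is exactly the set of packets at which
the count has a fixed value. Indicators of count values replace random summation limits, which
allows sums to be exchanged in `tsum_mul_countedPeak`. -/
theorem peakAge_eq_countedPeak (hZ : ∀ n, 0 ≤ Z n ω) (hA : ∀ n, 0 ≤ sysTime srv ν Z n ω) (k : ℕ)
    (h : Nat.nth (ReceivedFrom srv ν ξ Z m ω) k ≠ 0) :
    peakAge srv ν ξ Z m (k + 1) ω = countedPeak srv ν ξ Z m k ω := by
  classical
  set p := ReceivedFrom srv ν ξ Z m ω with hp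
  have hcard : ∀ hf : (Set.ofPred p).Finite, k < hf.toFinset.card := by
    intro hf
    by_contra hle
    exact h (Nat.nth_of_card_le hf (not_lt.1 hle))
  set i := Nat.nth p k with hi
  have hpi : p i := Nat.nth_mem k hcard
  have hci : Nat.count p i = k := Nat.count_nth hcard
  set j := recvIndex srv ν ξ Z m ω k with hj
  -- The count includes packet `n` itself, so it equals `k` from the `k`-th delivered packet up to
  -- just before the next one.
  have hrange : ∀ n, recvCount srv ν ξ Z m ω n = k ↔ j ≤ n ∧ n < i := by
    intro n
    rw [recvCount_eq_count]
    have hni : n < i ↔ Nat.count p (n + 1) ≤ k := by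
      constructor
      · intro hn; rw [← hci]; exact Nat.count_monotone p hn
      · intro hn; by_contra hle
        have h1 := Nat.count_monotone p (show i + 1 ≤ n + 1 by omega)
        rw [Nat.count_succ, if_pos hpi, hci] at h1
        omega
    have hnj : j ≤ n ↔ k ≤ Nat.count p (n + 1) := by
      cases k with
      | zero => simp [hj, recvIndex]
      | succ k =>
        have hcard' : ∀ hf : (Set.ofPred p).Finite, k < hf.toFinset.card :=
          fun hf => (Nat.lt_succ_self k).trans (hcard hf)
        have hpj : p j := Nat.nth_mem k hcard'
        have hcj : Nat.count p j = k := Nat.count_nth hcard'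
        constructor
        · intro hn
          have h1 := Nat.count_monotone p (show j + 1 ≤ n + 1 by omega)
          rw [Nat.count_succ, if_pos hpj, hcj] at h1
          exact h1
        · intro hn; by_contra hle
          have h1 := Nat.count_monotone p (show n + 1 ≤ j by omega)
          omega
    rw [hnj, hni, le_antisymm_iff, and_comm]
  have hji : j ≤ i := by
    by_contra hlt
    have hcc : recvCount srv ν ξ Z m ω (i - 1) = k := by
      rw [recvCount_eq_count, Nat.sub_add_cancel (Nat.one_le_iff_ne_zero.2 h), hci]
    have := (hrange _).1 hcc
    omega
  have hone : ∀ n, (recvCount srv ν ξ Z m ω n = k + 1 ∧ p n) ↔ n = i := by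
    intro n
    rw [recvCount_eq_count]
    constructor
    · rintro ⟨h1, h2⟩
      rw [← hp, Nat.count_succ, if_pos h2] at h1
      have h3 : Nat.count p n = k := by omega
      rw [hi, ← h3, Nat.nth_count h2]
    · rintro rfl
      rw [← hp, Nat.count_succ, if_pos hpi, hci]
      exact ⟨rfl, hpi⟩
  unfold peakAge
  have e1 : recvIndex srv ν ξ Z m ω (k + 1) = i := rfl
  simp only [e1, Nat.add_sub_cancel]
  rw [← hj, if_neg h, countedPeak, ENNReal.ofReal_add
    (sub_nonneg.2 (genTime_mono hZ hji)) (by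
      have := hA i
      simp only [deliveryTime, sysTime] at *
      linarith), genTime_sub i j hji hZ]
  congr 1
  · rw [tsum_eq_sum (s := Finset.Ico j i)]
    · refine Finset.sum_congr rfl fun n hn => ?_
      rw [if_pos ((hrange n).2 (Finset.mem_Ico.1 hn))]
    · intro n hn
      rw [if_neg fun h' => hn (Finset.mem_Ico.2 ((hrange n).1 h'))]
  · rw [tsum_eq_single i]
    · rw [if_pos ((hone i).2 rfl)]
      congr 1
      simp only [deliveryTime, sysTime]; ring
    · intro n hn
      rw [if_neg fun h' => hn ((hone n).1 h')]

/-- A missing delivery has infinite peak age, so this direction needs no assumption that deliveries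
continue. -/
theorem countedPeak_le (hZ : ∀ n, 0 ≤ Z n ω) (hA : ∀ n, 0 ≤ sysTime srv ν Z n ω) (k : ℕ) :
    countedPeak srv ν ξ Z m k ω ≤ peakAge srv ν ξ Z m (k + 1) ω := by
  by_cases h : Nat.nth (ReceivedFrom srv ν ξ Z m ω) k = 0
  · have e : recvIndex srv ν ξ Z m ω (k + 1) = 0 := h
    simp [peakAge, e]
  · exact (peakAge_eq_countedPeak hZ hA k h).ge

theorem peakAge_eq_of_tendsto (hZ : ∀ n, 0 ≤ Z n ω) (hA : ∀ n, 0 ≤ sysTime srv ν Z n ω) (k : ℕ)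
    (h : Tendsto (recvCount srv ν ξ Z m ω) atTop atTop) :
    peakAge srv ν ξ Z m (k + 1) ω = countedPeak srv ν ξ Z m k ω := by
  classical
  refine peakAge_eq_countedPeak hZ hA k ?_
  have hinf : (Set.ofPred (ReceivedFrom srv ν ξ Z m ω)).Infinite := by
    intro hfin
    obtain ⟨n, hn⟩ := (h.eventually_gt_atTop hfin.toFinset.card).exists
    refine absurd hn (not_lt.2 (Finset.card_le_card fun i hi => ?_))
    exact hfin.mem_toFinset.2 (Finset.mem_filter.1 hi).2
  have := Nat.nth_mem_of_infinite hinf k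
  intro h0
  rw [h0] at this
  exact absurd this.1 (by norm_num)

open Classical in
/-- Exchange of summation for weighted sums of peak ages. -/
theorem tsum_mul_countedPeak (a : ℕ → ℝ≥0∞) :
    ∑' k, a k * countedPeak srv ν ξ Z m k ω =
      (∑' i, a (recvCount srv ν ξ Z m ω i) * ENNReal.ofReal (Z i ω)) +
      ∑' i, if ReceivedFrom srv ν ξ Z m ω i then
        a (recvCount srv ν ξ Z m ω i - 1) * ENNReal.ofReal (sysTime srv ν Z i ω) else 0 := by
  simp only [countedPeak, mul_add, ← ENNReal.tsum_mul_left]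
  rw [ENNReal.tsum_add, ENNReal.tsum_comm, ENNReal.tsum_comm (f := fun k i => a k *
    if recvCount srv ν ξ Z m ω i = k + 1 ∧ ReceivedFrom srv ν ξ Z m ω i then
      ENNReal.ofReal (sysTime srv ν Z i ω) else 0)]
  congr 1
  · refine tsum_congr fun i => ?_
    rw [tsum_eq_single (recvCount srv ν ξ Z m ω i)]
    · simp
    · intro k hk
      rw [if_neg (Ne.symm hk), mul_zero]
  · refine tsum_congr fun i => ?_
    by_cases hp : ReceivedFrom srv ν ξ Z m ω i
    · have := recvCount_pos hp
      rw [if_pos hp, tsum_eq_single (recvCount srv ν ξ Z m ω i - 1)]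
      · rw [if_pos ⟨by omega, hp⟩]
      · intro k hk
        rw [if_neg fun h => hk (by omega), mul_zero]
    · simp [hp]

end Path

section Measurability
variable {Ω : Type*} [MeasurableSpace Ω] {M : ℕ} {srv : Server} {ν : Noise Ω}
  {ξ : Scheduler Ω M} {Z : Sampler Ω}

theorem measurable_waiting (hT : ∀ i, Measurable (ν.T i)) (hC : ∀ i, Measurable (ν.C i))
    (hZ : ∀ i, Measurable (Z i)) (i : ℕ) : Measurable (waiting srv ν Z i) := by
  induction i with
  | zero => exact measurable_const
  | succ i ih =>
    cases srv
    · have := hT i; have := hC i; have := hZ i; have := hT (i + 1)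
      change Measurable fun ω => max 0 (ν.T i ω + waiting .nonpreemptive ν Z i ω + ν.C i ω - Z i ω -
        ν.T (i + 1) ω)
      fun_prop
    · exact measurable_const

theorem measurable_genTime (hT : ∀ i, Measurable (ν.T i)) (hC : ∀ i, Measurable (ν.C i))
    (hZ : ∀ i, Measurable (Z i)) (i : ℕ) : Measurable (genTime ν Z i) := by
  induction i with
  | zero => exact ((hT 0).add (hC 0)).neg
  | succ i ih => exact ih.add (hZ i)

theorem measurableSet_receivedFrom (hT : ∀ i, Measurable (ν.T i)) (hC : ∀ i, Measurable (ν.C i))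
    (hZ : ∀ i, Measurable (Z i)) (hξ : ∀ i, Measurable (ξ (i + 1))) (m : Fin M) (i : ℕ) :
    MeasurableSet {ω | ReceivedFrom srv ν ξ Z m ω i} := by
  rcases i with _ | i
  · simp [ReceivedFrom]
  · have h1 : MeasurableSet {ω | ξ (i + 1) ω = m} := hξ i (measurableSet_singleton m)
    have h2 : MeasurableSet {ω | Received srv ν Z (i + 1) ω} := by
      cases srv
      · simp [Received]
      · have a := measurable_genTime hT hC hZ
        exact measurableSet_le (((a _).add (hT _)).add (hC _)) ((a _).add (hT _))
    convert h1.inter h2 using 1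
    ext ω; simp [ReceivedFrom]

theorem measurable_recvCount (hT : ∀ i, Measurable (ν.T i)) (hC : ∀ i, Measurable (ν.C i))
    (hZ : ∀ i, Measurable (Z i)) (hξ : ∀ i, Measurable (ξ (i + 1))) (m : Fin M) (n : ℕ) :
    Measurable fun ω => recvCount srv ν ξ Z m ω n := by
  classical
  induction n with
  | zero => simp only [recvCount_zero]; exact measurable_const
  | succ n ih =>
    simp only [recvCount_succ]
    exact ih.add (Measurable.ite (measurableSet_receivedFrom hT hC hZ hξ m _) measurable_const
      measurable_const)

theorem measurable_sysTime (hT : ∀ i, Measurable (ν.T i)) (hC : ∀ i, Measurable (ν.C i))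
    (hZ : ∀ i, Measurable (Z i)) (i : ℕ) : Measurable (sysTime srv ν Z i) :=
  ((hT i).add (measurable_waiting hT hC hZ i)).add (hC i)

theorem measurable_countedPeak (hT : ∀ i, Measurable (ν.T i)) (hC : ∀ i, Measurable (ν.C i))
    (hZ : ∀ i, Measurable (Z i)) (hξ : ∀ i, Measurable (ξ (i + 1))) (m : Fin M) (k : ℕ) :
    Measurable (countedPeak srv ν ξ Z m k) := by
  classical
  unfold countedPeak
  have hc : ∀ i k, MeasurableSet {ω | recvCount srv ν ξ Z m ω i = k} := fun i k =>
    measurable_recvCount hT hC hZ hξ m i (measurableSet_singleton k)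
  refine Measurable.add (Measurable.tsum fun i => ?_) (Measurable.tsum fun i => ?_)
  · exact Measurable.ite (hc i k) (hZ i).ennreal_ofReal measurable_const
  · exact Measurable.ite ((hc i (k + 1)).inter (measurableSet_receivedFrom hT hC hZ hξ m i))
      (measurable_sysTime hT hC hZ i).ennreal_ofReal measurable_const

end Measurability

/-! ### From the pathwise bound to the expected cost -/

section Fatou
variable {Ω : Type*} [MeasurableSpace Ω] {M : ℕ} {srv : Server} {ν : Noise Ω} {P : Measure Ω}
  [IsProbabilityMeasure P] {ξ : Scheduler Ω M} {Z : Sampler Ω}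

/-- Along an ultrafilter finer than `atTop` every summand converges, and the sum of the limits lies
between the two sides. The lemma is needed because the cost takes a separate limsup for each source.
-/
theorem liminf_sum_le_sum_limsup {ι : Type*} (s : Finset ι) (f : ι → ℕ → ℝ≥0∞) :
    liminf (fun j => ∑ i ∈ s, f i j) atTop ≤ ∑ i ∈ s, limsup (f i) atTop := by
  set 𝒰 := Ultrafilter.of (atTop : Filter ℕ)
  have h𝒰 : (𝒰 : Filter ℕ) ≤ atTop := Ultrafilter.of_le _
  have hq : ∀ i, ∃ q, Tendsto (f i) 𝒰 (𝓝 q) := fun i => by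
    obtain ⟨q, -, hq⟩ := isCompact_univ.ultrafilter_le_nhds (𝒰.map (f i)) (by simp)
    exact ⟨q, hq⟩
  choose q hq using hq
  calc liminf (fun j => ∑ i ∈ s, f i j) atTop ≤ liminf (fun j => ∑ i ∈ s, f i j) 𝒰 :=
        liminf_le_liminf_of_le h𝒰
    _ = ∑ i ∈ s, q i := (tendsto_finsetSum _ fun i _ => hq i).liminf_eq
    _ ≤ _ := Finset.sum_le_sum fun i _ => by
        rw [← (hq i).limsup_eq]; exact limsup_le_limsup_of_le h𝒰

/-- A pathwise lower bound on the weighted peak ages bounds the average cost. -/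
theorem le_avgPAoI_of_ae (hT : ∀ i, Measurable (ν.T i)) (hC : ∀ i, Measurable (ν.C i))
    (hZm : ∀ i, Measurable (Z i)) (hξ : ∀ i, Measurable (ξ (i + 1))) (w : Fin M → ℝ)
    (hZ : ∀ᵐ ω ∂P, ∀ n, 0 ≤ Z n ω) (hA : ∀ᵐ ω ∂P, ∀ n, 0 ≤ sysTime srv ν Z n ω) {V : ℝ≥0∞}
    (hV : ∀ᵐ ω ∂P, V ≤ liminf (fun j => ∑ m, ENNReal.ofReal (w m) *
      ∑' k, (wt j k : ℝ≥0∞) * countedPeak srv ν ξ Z m k ω) atTop) :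
    V ≤ avgPAoI srv ν P w ξ Z := by
  have hm := measurable_countedPeak (srv := srv) hT hC hZm hξ
  -- The power-weighted mean of the expected peak ages is controlled by their Cesàro limsup.
  have hmean : ∀ m, limsup (fun j => ∫⁻ ω, ∑' k, (wt j k : ℝ≥0∞) * countedPeak srv ν ξ Z m k ω ∂P)
      atTop ≤ limsup (fun N : ℕ => meanPeakAge srv ν P ξ Z m N) atTop := by
    intro m
    have h := limsup_wt_le fun k => ∫⁻ ω, peakAge srv ν ξ Z m (k + 1) ω ∂P
    refine le_trans (limsup_le_limsup (Eventually.of_forall fun j => ?_)) (h.trans (le_of_eq ?_))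
    · change ∫⁻ ω, ∑' k, (wt j k : ℝ≥0∞) * countedPeak srv ν ξ Z m k ω ∂P ≤ _
      rw [lintegral_tsum fun k => ((hm m k).const_mul _).aemeasurable]
      refine ENNReal.tsum_le_tsum fun k => ?_
      rw [lintegral_const_mul _ (hm m k)]
      gcongr 1
      refine lintegral_mono_ae ?_
      filter_upwards [hZ, hA] with ω h1 h2
      exact countedPeak_le h1 h2 k
    · congr 1
      ext N
      rw [meanPeakAge, show Finset.Icc 1 N = Finset.Ico 1 (N + 1) by ext; simp,
        Finset.sum_Ico_eq_sum_range]
      simp [add_comm]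
  calc V = ∫⁻ _, V ∂P := by simp
    _ ≤ ∫⁻ ω, liminf (fun j => ∑ m, ENNReal.ofReal (w m) *
        ∑' k, (wt j k : ℝ≥0∞) * countedPeak srv ν ξ Z m k ω) atTop ∂P := lintegral_mono_ae hV
    _ ≤ liminf (fun j => ∫⁻ ω, ∑ m, ENNReal.ofReal (w m) *
        ∑' k, (wt j k : ℝ≥0∞) * countedPeak srv ν ξ Z m k ω ∂P) atTop :=
        lintegral_liminf_le fun j => Finset.measurable_sum _ fun m _ =>
          (Measurable.tsum fun k => (hm m k).const_mul _).const_mul _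
    _ = liminf (fun j => ∑ m, ENNReal.ofReal (w m) *
        ∫⁻ ω, ∑' k, (wt j k : ℝ≥0∞) * countedPeak srv ν ξ Z m k ω ∂P) atTop := by
        congr 1; ext j
        rw [lintegral_finsetSum _ fun m _ =>
          (Measurable.tsum fun k => (hm m k).const_mul _).const_mul _]
        refine Finset.sum_congr rfl fun m _ => ?_
        rw [lintegral_const_mul _ (Measurable.tsum fun k => (hm m k).const_mul _)]
    _ ≤ ∑ m, limsup (fun j => ENNReal.ofReal (w m) *
        ∫⁻ ω, ∑' k, (wt j k : ℝ≥0∞) * countedPeak srv ν ξ Z m k ω ∂P) atTop :=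
        liminf_sum_le_sum_limsup _ _
    _ ≤ avgPAoI srv ν P w ξ Z := Finset.sum_le_sum fun m _ => by
        rw [ENNReal.limsup_const_mul_of_ne_top ENNReal.ofReal_ne_top]
        exact mul_le_mul_of_nonneg_left (hmean m) zero_le

end Fatou

/-! ### One-step quantities and their continuity in the threshold -/

section MeanMap
variable {𝒴 : Type*} [MeasurableSpace 𝒴]

/-- Bounded measurable functions of threshold and noise that are almost surely continuous in the
threshold. -/
structure IsRegular (lN : Measure 𝒴) (G : ℝ≥0∞ → 𝒴 → ℝ≥0∞) : Prop where
  meas : Measurable (Function.uncurry G)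
  bdd : ∃ B : ℝ≥0, ∀ θ n, G θ n ≤ B
  cont : ∀ θ, ∀ᵐ n ∂lN, ContinuousAt (fun θ => G θ n) θ

theorem IsRegular.lintegral_ne_top {lN : Measure 𝒴} [IsProbabilityMeasure lN]
    {G : ℝ≥0∞ → 𝒴 → ℝ≥0∞} (h : IsRegular lN G) (θ : ℝ≥0∞) : ∫⁻ n, G θ n ∂lN ≠ ⊤ := by
  obtain ⟨B, hB⟩ := h.bdd
  refine ne_top_of_le_ne_top (ENNReal.coe_ne_top (r := B)) ?_
  calc ∫⁻ n, G θ n ∂lN ≤ ∫⁻ _, B ∂lN := lintegral_mono fun n => hB θ n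
    _ = B := by simp

/-- Mean over the noise as a continuous function of the threshold. -/
def meanMap (lN : Measure 𝒴) [IsProbabilityMeasure lN] {G : ℝ≥0∞ → 𝒴 → ℝ≥0∞}
    (h : IsRegular lN G) : C(ℝ≥0∞, ℝ≥0) where
  toFun θ := (∫⁻ n, G θ n ∂lN).toNNReal
  continuous_toFun := by
    rw [continuous_iff_continuousAt]
    intro θ
    obtain ⟨B, hB⟩ := h.bdd
    refine (ENNReal.tendsto_toNNReal (h.lintegral_ne_top θ)).comp ?_
    refine tendsto_lintegral_filter_of_dominated_convergence (fun _ => (B : ℝ≥0∞))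
      (Eventually.of_forall fun θ => h.meas.of_uncurry_left)
      (Eventually.of_forall fun θ => ae_of_all _ fun n => hB θ n) (by simp) (h.cont θ)

theorem coe_meanMap (lN : Measure 𝒴) [IsProbabilityMeasure lN] {G : ℝ≥0∞ → 𝒴 → ℝ≥0∞}
    (h : IsRegular lN G) (θ : ℝ≥0∞) : (meanMap lN h θ : ℝ≥0∞) = ∫⁻ n, G θ n ∂lN :=
  ENNReal.coe_toNNReal (h.lintegral_ne_top θ)

end MeanMap

/-- Truncation level. -/
abbrev lvl (K : ℕ) : ℝ≥0∞ := (K : ℝ≥0∞) + 1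

/-- Computation time spent before the planned generation time. -/
def runG (K : ℕ) (θ : ℝ≥0∞) (n : ℝ × ℝ) : ℝ≥0∞ := min θ (min (ENNReal.ofReal n.1) (lvl K))

/-- Waiting time of the next packet in the queue. -/
def waitG (K : ℕ) (θ : ℝ≥0∞) (n : ℝ × ℝ) : ℝ≥0∞ :=
  min (ENNReal.ofReal n.1) (lvl K) - θ - ENNReal.ofReal n.2

/-- Truncated transmission time of the next packet. -/
def transG (K : ℕ) (_ : ℝ≥0∞) (n : ℝ × ℝ) : ℝ≥0∞ := min (ENNReal.ofReal n.2) (lvl K)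

/-- Truncated computation time. -/
def compG (K : ℕ) (_ : ℝ≥0∞) (n : ℝ × ℝ) : ℝ≥0∞ := min (ENNReal.ofReal n.1) (lvl K)

open Classical in
/-- Delivery indicator under preemption. -/
def recvG (θ : ℝ≥0∞) (n : ℝ × ℝ) : ℝ≥0∞ :=
  if ENNReal.ofReal n.1 ≤ θ + ENNReal.ofReal n.2 then 1 else 0

theorem lvl_ne_top (K : ℕ) : lvl K ≠ ⊤ := by simp

theorem lvl_eq (K : ℕ) : lvl K = ((K + 1 : ℝ≥0) : ℝ≥0∞) := by simp

section Regular
variable {lN : Measure (ℝ × ℝ)}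

theorem isRegular_runG (K : ℕ) : IsRegular lN (runG K) where
  meas := by unfold runG Function.uncurry; fun_prop
  bdd := ⟨K + 1, fun θ n => by
    rw [← lvl_eq]; exact (min_le_right _ _).trans (min_le_right _ _)⟩
  cont θ := ae_of_all _ fun n => by
    unfold runG
    exact (continuous_id.min continuous_const).continuousAt

theorem isRegular_waitG (K : ℕ) : IsRegular lN (waitG K) where
  meas := by unfold waitG Function.uncurry; fun_prop
  bdd := ⟨K + 1, fun θ n => by
    rw [← lvl_eq]; exact tsub_le_self.trans (tsub_le_self.trans (min_le_right _ _))⟩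
  cont θ := ae_of_all _ fun n => by
    unfold waitG
    have h1 : Continuous fun θ => min (ENNReal.ofReal n.1) (lvl K) - θ :=
      ENNReal.continuous_sub_left (ne_top_of_le_ne_top (lvl_ne_top K) (min_le_right _ _))
    exact ((ENNReal.continuous_sub_right _).comp h1).continuousAt

theorem isRegular_transG (K : ℕ) : IsRegular lN (transG K) where
  meas := by unfold transG Function.uncurry; fun_prop
  bdd := ⟨K + 1, fun θ n => by rw [← lvl_eq]; exact min_le_right _ _⟩
  cont θ := ae_of_all _ fun n => continuousAt_const

theorem isRegular_compG (K : ℕ) : IsRegular lN (compG K) where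
  meas := by unfold compG Function.uncurry; fun_prop
  bdd := ⟨K + 1, fun θ n => by rw [← lvl_eq]; exact min_le_right _ _⟩
  cont θ := ae_of_all _ fun n => continuousAt_const

theorem measurable_recvG : Measurable (Function.uncurry recvG) := by
  classical
  unfold recvG Function.uncurry
  refine Measurable.ite (measurableSet_le ?_ ?_) measurable_const measurable_const <;> fun_prop

theorem recvG_le_one (θ : ℝ≥0∞) (n : ℝ × ℝ) : recvG θ n ≤ 1 := by
  unfold recvG; split_ifs <;> simp

variable {μT μC : Measure ℝ}

/-- The indicator can jump at `θ` only when `C = θ + T`. For fixed `C` this prescribes a single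
value of `T`, a null event since the law of `T` has a density. -/
theorem continuousAt_recvG (hT : IsTimeLaw μT) (θ : ℝ≥0∞) :
    ∀ᵐ n ∂(μC.prod μT), ContinuousAt (fun θ => recvG θ n) θ := by
  have := hT.isProbability
  have hne : ∀ᵐ n ∂(μC.prod μT), ENNReal.ofReal n.1 ≠ θ + ENNReal.ofReal n.2 := by
    rw [Measure.ae_prod_iff_ae_ae]
    · refine ae_of_all _ fun c => ?_
      have hatom : ∀ᵐ t ∂μT, t ≠ (ENNReal.ofReal c - θ).toReal := by
        refine hT.density.ae_le ?_
        exact Measure.ae_ne volume _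
      filter_upwards [hatom, hT.pos] with t ht hpos heq
      apply ht
      have hθ : θ ≠ ⊤ := by
        rintro rfl
        simp at heq
      rw [heq, ENNReal.add_sub_cancel_left hθ, ENNReal.toReal_ofReal hpos.le]
    · exact (measurableSet_eq_fun (by fun_prop) (by fun_prop)).compl
  filter_upwards [hne] with n hn
  have hc : Continuous fun θ => θ + ENNReal.ofReal n.2 := by fun_prop
  rcases lt_or_gt_of_ne hn with h | h
  · refine (continuousAt_const (y := (1 : ℝ≥0∞))).congr ?_
    filter_upwards [hc.continuousAt.eventually (lt_mem_nhds h)] with θ' h'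
    exact (if_pos h'.le).symm
  · refine (continuousAt_const (y := (0 : ℝ≥0∞))).congr ?_
    filter_upwards [hc.continuousAt.eventually (gt_mem_nhds h)] with θ' h'
    exact (if_neg (not_le.2 h')).symm

theorem isRegular_recvG (hT : IsTimeLaw μT) : IsRegular (μC.prod μT) recvG where
  meas := measurable_recvG
  bdd := ⟨1, fun θ n => recvG_le_one θ n⟩
  cont := continuousAt_recvG hT

theorem isRegular_recvG_mul (hT : IsTimeLaw μT) (K : ℕ) :
    IsRegular (μC.prod μT) (fun θ n => compG K θ n * recvG θ n) where
  meas := (isRegular_compG (lN := μC.prod μT) K).meas.mul measurable_recvG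
  bdd := ⟨K + 1, fun θ n => by
    rw [← lvl_eq, ← mul_one (lvl K)]
    exact mul_le_mul' (min_le_right _ _) (recvG_le_one θ n)⟩
  cont θ := by
    filter_upwards [continuousAt_recvG hT θ] with n hn
    have hc : compG K 0 n ≠ ⊤ := ne_top_of_le_ne_top (lvl_ne_top K) (min_le_right _ _)
    exact ENNReal.Tendsto.const_mul hn (Or.inr hc)

end Regular

/-- Truncation of the side information. -/
def truncMap (K : ℕ) : C(ℝ≥0∞, ℝ≥0) where
  toFun t := (min t (lvl K)).toNNReal
  continuous_toFun := by
    rw [continuous_iff_continuousAt]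
    intro t
    refine (ENNReal.tendsto_toNNReal ?_).comp
      ((continuous_id.min continuous_const : Continuous fun t => min t (lvl K)).tendsto t)
    exact ne_top_of_le_ne_top (lvl_ne_top K) (min_le_right _ _)

theorem coe_truncMap (K : ℕ) (t : ℝ≥0∞) : (truncMap K t : ℝ≥0∞) = min t (lvl K) :=
  ENNReal.coe_toNNReal (ne_top_of_le_ne_top (lvl_ne_top K) (min_le_right _ _))

section Data
variable {μT μC : Measure ℝ}

/-- Cost data of the non-preemptive server; no side information is used. -/
def nonpreData (hT : IsTimeLaw μT) (hC : IsTimeLaw μC) : CostData :=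
  haveI := hT.isProbability
  haveI := hC.isProbability
  { base := Measure.dirac 0
    rate := 1
    inc := fun K => meanMap (μC.prod μT) (isRegular_transG K) +
      (meanMap (μC.prod μT) (isRegular_runG K) + meanMap (μC.prod μT) (isRegular_waitG K))
    sys := fun K => (meanMap (μC.prod μT) (isRegular_transG K) +
      meanMap (μC.prod μT) (isRegular_waitG K) + meanMap (μC.prod μT) (isRegular_compG K)).comp
        ⟨Prod.snd, continuous_snd⟩ }

/-- Cost data of the preemptive server; the side information is the transmission time. -/
def preData (hT : IsTimeLaw μT) (hC : IsTimeLaw μC) : CostData :=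
  haveI := hT.isProbability
  haveI := hC.isProbability
  { base := μT.map ENNReal.ofReal
    rate := meanMap (μC.prod μT) (isRegular_recvG hT)
    inc := fun K => meanMap (μC.prod μT) (isRegular_transG K) +
      meanMap (μC.prod μT) (isRegular_runG K)
    sys := fun K => (truncMap K).comp ⟨Prod.fst, continuous_fst⟩ *
        (meanMap (μC.prod μT) (isRegular_recvG hT)).comp ⟨Prod.snd, continuous_snd⟩ +
      (meanMap (μC.prod μT) (isRegular_recvG_mul hT K)).comp ⟨Prod.snd, continuous_snd⟩ }

/-- Cost data of either server. -/
def Server.data (srv : Server) (hT : IsTimeLaw μT) (hC : IsTimeLaw μC) : CostData :=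
  match srv with
  | .nonpreemptive => nonpreData hT hC
  | .preemptive => preData hT hC

theorem isProbabilityMeasure_base (srv : Server) (hT : IsTimeLaw μT) (hC : IsTimeLaw μC) :
    IsProbabilityMeasure (srv.data hT hC).base := by
  have := hT.isProbability
  cases srv
  · exact Measure.dirac.isProbabilityMeasure
  · exact Measure.isProbabilityMeasure_map (by fun_prop)

/-- The mean truncated transmission time alone is positive. This keeps numerators of the cost away
from zero and makes zero delivery rates infinitely expensive. -/
theorem inc_pos (srv : Server) (hT : IsTimeLaw μT) (hC : IsTimeLaw μC) (K : ℕ) (θ : ℝ≥0∞) :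
    0 < (srv.data hT hC).inc K θ := by
  have := hT.isProbability
  have := hC.isProbability
  have h : 0 < meanMap (μC.prod μT) (isRegular_transG K) θ := by
    rw [← ENNReal.coe_pos, coe_meanMap, pos_iff_ne_zero]
    intro h0
    rw [lintegral_eq_zero_iff (isRegular_transG (lN := μC.prod μT) K).meas.of_uncurry_left] at h0
    have hp : ∀ᵐ n ∂(μC.prod μT), 0 < n.2 :=
      Measure.quasiMeasurePreserving_snd.ae hT.pos
    obtain ⟨n, hn, hn'⟩ := (h0.and hp).exists
    have : 0 < transG K θ n := lt_min (ENNReal.ofReal_pos.2 hn') (by simp)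
    exact this.ne' hn
  cases srv
  · exact lt_of_lt_of_le h le_self_add
  · exact lt_of_lt_of_le h le_self_add

end Data

/-! ### Replacing noise by conditional means -/

theorem WtEquiv.refl (f : ℕ → ℝ≥0) : WtEquiv f f := by simp [WtEquiv]

theorem WtEquiv.add {f g f' g' : ℕ → ℝ≥0} (h : WtEquiv f g) (h' : WtEquiv f' g')
    {B : ℝ≥0} (hf : ∀ l, f l ≤ B) (hg : ∀ l, g l ≤ B) (hf' : ∀ l, f' l ≤ B) (hg' : ∀ l, g' l ≤ B) :
    WtEquiv (fun l => f l + f' l) (fun l => g l + g' l) := by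
  have := Tendsto.add h h'
  rw [add_zero] at this
  refine this.congr fun j => ?_
  have s : ∀ {u v : ℕ → ℝ≥0}, (∀ l, u l ≤ B) → (∀ l, v l ≤ B) →
      Summable fun l => (wt j l : ℝ) * ((u l : ℝ) - v l) := fun {u v} hu hv =>
    summable_wt_mul (B := B) (fun l => by
      have h1 := NNReal.coe_le_coe.2 (hu l)
      have h2 := NNReal.coe_le_coe.2 (hv l)
      have h3 := NNReal.coe_nonneg (u l)
      have h4 := NNReal.coe_nonneg (v l)
      exact abs_le.2 ⟨by linarith, by linarith⟩) j
  rw [← (s hf hg).tsum_add (s hf' hg')]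
  refine tsum_congr fun l => ?_
  push_cast; ring

section Model
variable {Ω : Type*} [MeasurableSpace Ω] {P : Measure Ω}
  {μT μC : Measure ℝ} {ν : Noise Ω}

/-- The weighted law of large numbers for the model noise. The shift `s` accommodates quantities of
stage `l` that are decided, or met by noise, at step `l + 1`. -/
theorem Noise.IsModel.ae_wtEquiv [IsProbabilityMeasure P] (hν : ν.IsModel P μT μC) (s : ℕ)
    {𝒳 : Type*} [MeasurableSpace 𝒳]
    {X : ℕ → Ω → 𝒳} (hX : ∀ l, Measurable[ν.sampInfo (l + s)] (X l)) {h : 𝒳 → ℝ × ℝ → ℝ≥0∞}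
    (hm : Measurable (Function.uncurry h)) {B : ℝ≥0} (hB : ∀ x n, h x n ≤ B) :
    ∀ᵐ ω ∂P, WtEquiv (fun l => (h (X l ω) (ν.C (l + s) ω, ν.T (l + s + 1) ω)).toNNReal)
      (fun l => (∫⁻ n, h (X l ω) n ∂(μC.prod μT)).toNNReal) := by
  have hN : ∀ l, Measurable[ν.sampInfo (l + 1 + s)]
      (fun ω => (ν.C (l + s) ω, ν.T (l + s + 1) ω)) := fun l =>
    Measurable.mono ((ν.measurable_C_history (by omega)).prodMk (ν.measurable_T_history (by omega)))
      (ν.history_le_sampInfo (l + 1 + s)) le_rfl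
  have key := ae_tendsto_wt_sub (P := P) (𝒢 := fun l => ν.sampInfo (l + s))
    (fun l => hν.sampInfo_le _) (fun a b hab => ν.sampInfo_mono (by omega)) hX hN
    (fun l => hν.map_C_T _) (fun l => hν.indep_sampInfo _)
    (ψ := fun p => (h p.1 p.2).toReal) (hm.ennreal_toReal) (B := B) (fun p => by
      rw [abs_of_nonneg ENNReal.toReal_nonneg]
      exact ENNReal.toReal_mono ENNReal.coe_ne_top (hB p.1 p.2))
  filter_upwards [key] with ω hω
  refine hω.congr fun j => tsum_congr fun l => ?_
  rw [integral_toReal hm.of_uncurry_left.aemeasurable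
    (ae_of_all _ fun n => (hB _ n).trans_lt ENNReal.coe_lt_top)]
  rfl

theorem Noise.IsModel.ae_T_pos (hν : ν.IsModel P μT μC) (hT : IsTimeLaw μT) :
    ∀ᵐ ω ∂P, ∀ i, 0 < ν.T i ω :=
  ae_all_iff.2 fun i => ae_of_ae_map (hν.meas_T i).aemeasurable (by rw [hν.law_T]; exact hT.pos)

theorem Noise.IsModel.ae_C_pos (hν : ν.IsModel P μT μC) (hC : IsTimeLaw μC) :
    ∀ᵐ ω ∂P, ∀ i, 0 < ν.C i ω :=
  ae_all_iff.2 fun i => ae_of_ae_map (hν.meas_C i).aemeasurable (by rw [hν.law_C]; exact hC.pos)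

end Model

/-! ### Consequences of a threshold rule along a path -/

theorem waiting_nonneg {Ω : Type*} (srv : Server) (ν : Noise Ω) (Z : Sampler Ω) (i : ℕ) (ω : Ω) :
    0 ≤ waiting srv ν Z i ω := by
  cases i with
  | zero => exact le_rfl
  | succ i =>
    cases srv
    · exact le_max_left _ _
    · exact le_rfl

/-- Pathwise consequences of a threshold rule for packet `i`. -/
structure FollowsThreshold {Ω : Type*} (srv : Server) (ν : Noise Ω) (Z : Sampler Ω) (Θ : ℝ≥0∞)
    (ω : Ω) (i : ℕ) : Prop where
  le : ENNReal.ofReal (ν.T i ω) + ENNReal.ofReal (waiting srv ν Z i ω) +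
    min Θ (ENNReal.ofReal (ν.C i ω)) ≤ ENNReal.ofReal (Z i ω)
  wait : srv = .nonpreemptive → ENNReal.ofReal (waiting srv ν Z (i + 1) ω) =
    ENNReal.ofReal (ν.C i ω) - Θ - ENNReal.ofReal (ν.T (i + 1) ω)
  recv : srv = .preemptive → (Received srv ν Z i ω ↔
    ENNReal.ofReal (ν.C i ω) ≤ Θ + ENNReal.ofReal (ν.T (i + 1) ω))

/-- If the computation outlasts `Θ`, everything follows from the exact value of `Z`. Otherwise the
packet is finished before the next one is generated: the next wait is zero and the packet is
delivered. The free delay after completion survives only in the inequality for `Z`. -/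
theorem followsThreshold {Ω : Type*} {srv : Server} {ν : Noise Ω} {Z : Sampler Ω} {Θ : ℝ≥0∞}
    {ω : Ω} {i : ℕ} (hT : ∀ i, 0 < ν.T i ω) (hC : 0 < ν.C i ω)
    (h1 : Θ < ENNReal.ofReal (ν.C i ω) →
      Z i ω = ν.T i ω + waiting srv ν Z i ω + Θ.toReal)
    (h2 : ENNReal.ofReal (ν.C i ω) ≤ Θ →
      ν.T i ω + waiting srv ν Z i ω + ν.C i ω ≤ Z i ω) :
    FollowsThreshold srv ν Z Θ ω i := by
  have hW := waiting_nonneg srv ν Z i ω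
  have hTi := hT i
  have hTi' := hT (i + 1)
  have hwait : waiting .nonpreemptive ν Z (i + 1) ω = max 0 (ν.T i ω +
    waiting .nonpreemptive ν Z i ω + ν.C i ω - Z i ω - ν.T (i + 1) ω) := rfl
  have hrecv : Received .preemptive ν Z i ω ↔ ν.T i ω + ν.C i ω ≤ Z i ω + ν.T (i + 1) ω := by
    simp only [Received, genTime]
    constructor <;> intro h <;> linarith
  rcases lt_or_ge Θ (ENNReal.ofReal (ν.C i ω)) with h | h
  · have hZ := h1 h
    obtain ⟨θ, hθ0, rfl⟩ : ∃ θ : ℝ, 0 ≤ θ ∧ Θ = ENNReal.ofReal θ :=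
      ⟨Θ.toReal, ENNReal.toReal_nonneg, (ENNReal.ofReal_toReal h.ne_top).symm⟩
    rw [ENNReal.toReal_ofReal hθ0] at hZ
    refine ⟨?_, ?_, ?_⟩
    · rw [min_eq_left h.le, hZ, ENNReal.ofReal_add (by positivity) hθ0,
        ENNReal.ofReal_add hTi.le hW]
    · rintro rfl
      rw [hwait, hZ, ← ENNReal.ofReal_sub _ hθ0, ← ENNReal.ofReal_sub _ hTi'.le]
      rcases le_total 0 (ν.C i ω - θ - ν.T (i + 1) ω) with h' | h'
      · rw [max_eq_right (by linarith)]; congr 1; ring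
      · rw [max_eq_left (by linarith), ENNReal.ofReal_of_nonpos h']; simp
    · rintro rfl
      have hw0 : waiting .preemptive ν Z i ω = 0 := by cases i <;> rfl
      rw [hrecv, hZ, hw0, ← ENNReal.ofReal_add hθ0 hTi'.le, ENNReal.ofReal_le_ofReal_iff (by linarith)]
      constructor <;> intro h <;> linarith
  · have hZ := h2 h
    refine ⟨?_, ?_, ?_⟩
    · rw [min_eq_right h, ← ENNReal.ofReal_add hTi.le hW, ← ENNReal.ofReal_add (by positivity) hC.le]
      exact ENNReal.ofReal_le_ofReal hZ
    · rintro rfl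
      rw [hwait, tsub_eq_zero_of_le h, max_eq_left (by linarith)]
      simp
    · rintro rfl
      rw [hrecv]
      exact ⟨fun _ => h.trans le_self_add, fun _ => by
        have hw0 : waiting .preemptive ν Z i ω = 0 := by cases i <;> rfl
        rw [hw0] at hZ
        linarith⟩

section PathBound
variable {Ω : Type*} {ν : Noise Ω} {M : ℕ} {ξ : Scheduler Ω M} {Z : Sampler Ω}

open Classical in
/-- Indicator of a delivery of source `m`. -/
def recvInd (srv : Server) (ν : Noise Ω) (ξ : Scheduler Ω M) (Z : Sampler Ω) (ω : Ω) (m : Fin M)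
    (l : ℕ) : ℝ≥0 := if ReceivedFrom srv ν ξ Z m ω (l + 1) then 1 else 0

theorem coe_recvCount (srv : Server) (ω : Ω) (m : Fin M) (n : ℕ) :
    (recvCount srv ν ξ Z m ω n : ℝ≥0) = ∑ l ∈ Finset.range n, recvInd srv ν ξ Z ω m l := by
  classical
  induction n with
  | zero => simp [recvCount_zero]
  | succ n ih =>
    rw [recvCount_succ, Finset.sum_range_succ, ← ih, recvInd]
    push_cast
    rfl

open Classical in
/-- Time from generation to delivery of the delivered packets of source `m`. -/
def recvSys (srv : Server) (ν : Noise Ω) (ξ : Scheduler Ω M) (Z : Sampler Ω) (ω : Ω) (m : Fin M)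
    (i : ℕ) : ℝ≥0∞ :=
  if ReceivedFrom srv ν ξ Z m ω i then ENNReal.ofReal (sysTime srv ν Z i ω) else 0

theorem recvSys_of_received {srv : Server} {ω : Ω} {m : Fin M} {i : ℕ}
    (h : ReceivedFrom srv ν ξ Z m ω i) :
    recvSys srv ν ξ Z ω m i = ENNReal.ofReal (sysTime srv ν Z i ω) := if_pos h

theorem recvSys_of_not_received {srv : Server} {ω : Ω} {m : Fin M} {i : ℕ}
    (h : ¬ ReceivedFrom srv ν ξ Z m ω i) : recvSys srv ν ξ Z ω m i = 0 := if_neg h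

theorem ofReal_sysTime {srv : Server} {ω : Ω} {i : ℕ} (hT : 0 ≤ ν.T i ω) (hC : 0 ≤ ν.C i ω) :
    ENNReal.ofReal (sysTime srv ν Z i ω) = ENNReal.ofReal (ν.T i ω) +
      ENNReal.ofReal (waiting srv ν Z i ω) + ENNReal.ofReal (ν.C i ω) := by
  have hW := waiting_nonneg srv ν Z i ω
  rw [sysTime, ENNReal.ofReal_add (add_nonneg hT hW) hC, ENNReal.ofReal_add hT hW]

/-- The weighted peak ages along a path dominate the weighted sums of per-packet terms. -/
theorem path_lower_bound {srv : Server} {ω : Ω} (m : Fin M) (j : ℕ) {x y : ℕ → ℝ≥0∞}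
    (h : ∀ i, 1 ≤ i → x i + y i ≤ ENNReal.ofReal (Z i ω))
    (s : ℕ) (hs : s ≤ 1) :
    ∑' l, (wt j (recvCount srv ν ξ Z m ω (l + 2)) : ℝ≥0∞) *
      (x (l + 2) + y (l + 1 + s) + recvSys srv ν ξ Z ω m (l + 2)) ≤
    ∑' k, (wt j k : ℝ≥0∞) * countedPeak srv ν ξ Z m k ω := by
  classical
  rw [tsum_mul_countedPeak]
  simp only [mul_add]
  rw [ENNReal.tsum_add, ENNReal.tsum_add]
  refine add_le_add ?_ ?_
  · calc _ ≤ (∑' l, (wt j (recvCount srv ν ξ Z m ω (l + 1)) : ℝ≥0∞) * x (l + 1)) +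
          ∑' l, (wt j (recvCount srv ν ξ Z m ω (l + 1)) : ℝ≥0∞) * y (l + 1) := by
          refine add_le_add (ENNReal.tsum_comp_le_tsum_of_injective (add_left_injective 1)
            (fun l => (wt j (recvCount srv ν ξ Z m ω (l + 1)) : ℝ≥0∞) * x (l + 1))) ?_
          refine le_trans (ENNReal.tsum_le_tsum fun l => ?_)
            (ENNReal.tsum_comp_le_tsum_of_injective (add_left_injective s)
              (fun l => (wt j (recvCount srv ν ξ Z m ω (l + 1)) : ℝ≥0∞) * y (l + 1)))
          -- Attaching `y (l + 1 + s)` to the weight of packet `l + 2` can only decrease the sum, as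
          -- counts increase and weights decrease.
          rw [show l + s + 1 = l + 1 + s by ring]
          gcongr
          exact wt_antitone j (recvCount_mono (by omega))
      _ = ∑' l, (wt j (recvCount srv ν ξ Z m ω (l + 1)) : ℝ≥0∞) * (x (l + 1) + y (l + 1)) := by
          rw [← ENNReal.tsum_add]; simp only [mul_add]
      _ ≤ ∑' l, (wt j (recvCount srv ν ξ Z m ω (l + 1)) : ℝ≥0∞) * ENNReal.ofReal (Z (l + 1) ω) :=
          ENNReal.tsum_le_tsum fun l => mul_le_mul_of_nonneg_left (h _ (by omega)) zero_le
      _ ≤ _ := ENNReal.tsum_comp_le_tsum_of_injective (add_left_injective 1)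
          (fun i => (wt j (recvCount srv ν ξ Z m ω i) : ℝ≥0∞) * ENNReal.ofReal (Z i ω))
  · refine le_trans (ENNReal.tsum_le_tsum fun l => ?_)
      (ENNReal.tsum_comp_le_tsum_of_injective (add_left_injective 2) _)
    by_cases hp : ReceivedFrom srv ν ξ Z m ω (l + 2)
    · rw [if_pos hp]
      refine mul_le_mul' (ENNReal.coe_le_coe.2 (wt_antitone j (Nat.sub_le _ _))) ?_
      exact (recvSys_of_received hp).le
    · rw [recvSys_of_not_received hp]; simp

end PathBound

/-! ### The lower bound for every feasible policy -/

section LowerBound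
variable {Ω : Type*} [MeasurableSpace Ω] {P : Measure Ω}
  {μT μC : Measure ℝ} {ν : Noise Ω} {M : ℕ} {ξ : Scheduler Ω M} {Z : Sampler Ω}

theorem CausalSampler.exists_threshold (hν : ν.IsModel P μT μC) (hT : IsTimeLaw μT)
    (hC : IsTimeLaw μC) {srv : Server} (hZ : CausalSampler srv ν P Z) :
    ∃ Θ : ℕ → Ω → ℝ≥0∞, (∀ i, Measurable[ν.sampInfo i] (Θ i)) ∧
      ∀ᵐ ω ∂P, ∀ i, 1 ≤ i → FollowsThreshold srv ν Z (Θ i ω) ω i := by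
  obtain ⟨-, -, -, Θ, hΘ, h⟩ := hZ
  refine ⟨Θ, hΘ, ?_⟩
  have h' := ae_all_iff.2 fun i => (ae_all_iff (ι := 1 ≤ i)).2 (h i)
  filter_upwards [h', hν.ae_T_pos hT, hν.ae_C_pos hC] with ω h1 h2 h3 i hi
  exact followsThreshold h2 (h3 i) (h1 i hi).1 (h1 i hi).2

theorem CausalSampler.measurable (hν : ν.IsModel P μT μC) {srv : Server}
    (hZ : CausalSampler srv ν P Z) (i : ℕ) : Measurable (Z i) :=
  (hZ.1 i).mono ((ν.doneInfo_le_history i).trans (hν.history_le _)) le_rfl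

theorem CausalScheduler.measurable (hν : ν.IsModel P μT μC) (hξ : CausalScheduler ν ξ) (i : ℕ) :
    Measurable (ξ (i + 1)) :=
  (hξ i).mono ((ν.schedInfo_le_history i).trans (hν.history_le _)) le_rfl

theorem CausalSampler.ae_nonneg (hν : ν.IsModel P μT μC) (hT : IsTimeLaw μT) {srv : Server}
    (hZ : CausalSampler srv ν P Z) : ∀ᵐ ω ∂P, ∀ i, 0 ≤ Z i ω := by
  filter_upwards [ae_all_iff.2 hZ.2.2.1, hν.ae_T_pos hT] with ω h1 h2 i
  have := h1 i
  have := h2 i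
  have := waiting_nonneg srv ν Z i ω
  linarith

theorem ae_sysTime_nonneg (hν : ν.IsModel P μT μC) (hT : IsTimeLaw μT) (hC : IsTimeLaw μC)
    (srv : Server) (Z : Sampler Ω) : ∀ᵐ ω ∂P, ∀ i, 0 ≤ sysTime srv ν Z i ω := by
  filter_upwards [hν.ae_T_pos hT, hν.ae_C_pos hC] with ω h2 h3 i
  have := h2 i
  have := h3 i
  have := waiting_nonneg srv ν Z i ω
  unfold sysTime; linarith

end LowerBound

section
variable {M : ℕ}

/-- Source indicator with extended values. -/
def srcOne (m i : Fin M) : ℝ≥0∞ := if i = m then 1 else 0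

theorem srcOne_le (m i : Fin M) : srcOne m i ≤ 1 := by
  unfold srcOne; split_ifs <;> simp

theorem srcOne_ne_top (m i : Fin M) : srcOne m i ≠ ⊤ :=
  ne_top_of_le_ne_top ENNReal.one_ne_top (srcOne_le m i)

theorem coe_srcInd (m : Fin M) (x : Key M) : (srcInd m x : ℝ≥0∞) = srcOne m x.1 := by
  change (((if x.1 = m then (1 : ℝ≥0) else 0) : ℝ≥0) : ℝ≥0∞) = _
  unfold srcOne; split_ifs <;> simp

theorem measurable_srcOne (m : Fin M) : Measurable (srcOne m) := measurable_from_top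

end

/-- Separability lets an almost sure statement about each test function hold for a dense family
simultaneously. -/
theorem exists_countable_dense_continuousMap :
    ∃ 𝒟 : Set C(ℝ≥0∞, ℝ≥0), 𝒟.Countable ∧ Dense 𝒟 :=
  TopologicalSpace.exists_countable_dense _

section LowerBound
variable {Ω : Type*} [MeasurableSpace Ω] {P : Measure Ω} [IsProbabilityMeasure P]
  {μT μC : Measure ℝ} {ν : Noise Ω} {M : ℕ} {ξ : Scheduler Ω M} {Z : Sampler Ω}

/-- The threshold planned during the computation of packet `l` governs the wait of packet `l + 1`,
so it is paired with the source of packet `l + 1`, already chosen at that time. No side information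
is needed. -/
theorem le_liminf_nonpreemptive (hν : ν.IsModel P μT μC) (hT : IsTimeLaw μT) (hC : IsTimeLaw μC)
    (w : Fin M → ℝ) (hF : Feasible .nonpreemptive ν P ξ Z) {V : ℝ≥0∞}
    (hV : ∀ η ∈ (nonpreData hT hC).admissible M,
      V ≤ ⨆ K, (nonpreData hT hC).cost w K (η : Measure (Key M))) :
    ∀ᵐ ω ∂P, V ≤ liminf (fun j => ∑ m, ENNReal.ofReal (w m) *
      ∑' k, (wt j k : ℝ≥0∞) * countedPeak .nonpreemptive ν ξ Z m k ω) atTop := by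
  classical
  have := hT.isProbability
  have := hC.isProbability
  obtain ⟨hξ, hZ, hfreq⟩ := hF
  obtain ⟨Θ, hΘ, hthr⟩ := CausalSampler.exists_threshold hν hT hC hZ
  set D := nonpreData hT hC with hD
  have : IsProbabilityMeasure D.base := isProbabilityMeasure_base .nonpreemptive hT hC
  -- `h1` collects what is determined by the noise `(C l, T (l+1))` of stage `l`; `h2` is the
  -- computation time of packet `l + 1`, which belongs to the next noise and is averaged with shift
  -- 1.
  let h1 : ℕ → Fin M → Fin M × ℝ≥0∞ → ℝ × ℝ → ℝ≥0∞ := fun K m x n =>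
    transG K 0 n + (runG K x.2 n + waitG K x.2 n) + srcOne m x.1 * (transG K 0 n + waitG K x.2 n)
  let h2 : ℕ → Fin M → Fin M → ℝ × ℝ → ℝ≥0∞ := fun K m i n => srcOne m i * compG K 0 n
  have mT := fun K => (isRegular_transG (lN := μC.prod μT) K).meas
  have mR := fun K => (isRegular_runG (lN := μC.prod μT) K).meas
  have mW := fun K => (isRegular_waitG (lN := μC.prod μT) K).meas
  have mC := fun K => (isRegular_compG (lN := μC.prod μT) K).meas
  have bT : ∀ K θ n, transG K θ n ≤ lvl K := fun K θ n => min_le_right _ _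
  have bC : ∀ K θ n, compG K θ n ≤ lvl K := fun K θ n => min_le_right _ _
  have bR : ∀ K θ n, runG K θ n ≤ lvl K := fun K θ n => (min_le_right _ _).trans (min_le_right _ _)
  have bW : ∀ K θ n, waitG K θ n ≤ lvl K := fun K θ n =>
    tsub_le_self.trans (tsub_le_self.trans (min_le_right _ _))
  have hm1 : ∀ K m, Measurable (Function.uncurry (h1 K m)) := by
    intro K m
    have a := (mT K).comp (measurable_const.prodMk measurable_snd :
      Measurable fun p : (Fin M × ℝ≥0∞) × (ℝ × ℝ) => ((0 : ℝ≥0∞), p.2))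
    have e : Measurable fun p : (Fin M × ℝ≥0∞) × (ℝ × ℝ) => (p.1.2, p.2) := by fun_prop
    have b := (mR K).comp e
    have c := (mW K).comp e
    have d : Measurable fun p : (Fin M × ℝ≥0∞) × (ℝ × ℝ) => srcOne m p.1.1 :=
      (measurable_srcOne m).comp (measurable_fst.comp measurable_fst)
    exact (a.add (b.add c)).add (d.mul (a.add c))
  have hm2 : ∀ K m, Measurable (Function.uncurry (h2 K m)) := by
    intro K m
    exact ((measurable_srcOne m).comp measurable_fst).mul ((mC K).comp
      (measurable_const.prodMk measurable_snd :
        Measurable fun p : Fin M × (ℝ × ℝ) => ((0 : ℝ≥0∞), p.2)))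
  have hb1 : ∀ K m x n, h1 K m x n ≤ ((5 * (K + 1) : ℝ≥0) : ℝ≥0∞) := by
    intro K m x n
    have : h1 K m x n ≤ lvl K + (lvl K + lvl K) + 1 * (lvl K + lvl K) :=
      add_le_add (add_le_add (bT _ _ _) (add_le_add (bR _ _ _) (bW _ _ _)))
        (mul_le_mul' (srcOne_le _ _) (add_le_add (bT _ _ _) (bW _ _ _)))
    refine this.trans (le_of_eq ?_)
    rw [lvl_eq]; norm_cast; ring
  have hb2 : ∀ K m x n, h2 K m x n ≤ ((K + 1 : ℝ≥0) : ℝ≥0∞) := by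
    intro K m x n
    have : h2 K m x n ≤ 1 * lvl K := mul_le_mul' (srcOne_le _ _) (bC _ _ _)
    rwa [one_mul, lvl_eq] at this
  have hξ' : ∀ l, Measurable[ν.sampInfo l] (ξ (l + 1)) := fun l => (hξ l).mono le_sup_left le_rfl
  have ae1 := ae_all_iff.2 fun K => ae_all_iff.2 fun m => hν.ae_wtEquiv 0
    (X := fun l ω => (ξ (l + 1) ω, Θ l ω)) (fun l => (hξ' l).prodMk (hΘ l)) (hm1 K m) (hb1 K m)
  have ae2 := ae_all_iff.2 fun K => ae_all_iff.2 fun m => hν.ae_wtEquiv 1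
    (X := fun l ω => ξ (l + 1) ω)
    (fun l => (hξ' l).mono (ν.sampInfo_mono (Nat.le_succ l)) le_rfl) (hm2 K m) (hb2 K m)
  filter_upwards [ae1, ae2, hthr, hfreq, hν.ae_T_pos hT, hν.ae_C_pos hC] with ω e1 e2 hthr hfreq
    hTp hCp
  set key : ℕ → Key M := fun l => (ξ (l + 1) ω, 0, Θ l ω) with hkey
  set b1 : ℕ → Fin M → ℕ → ℝ≥0 := fun K m l =>
    (h1 K m (ξ (l + 1) ω, Θ l ω) (ν.C l ω, ν.T (l + 1) ω)).toNNReal with hb1def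
  set b2 : ℕ → Fin M → ℕ → ℝ≥0 := fun K m l =>
    (h2 K m (ξ (l + 1) ω) (ν.C (l + 1) ω, ν.T (l + 1 + 1) ω)).toNNReal with hb2def
  have c1 : ∀ K m l, (b1 K m l : ℝ≥0∞) =
      h1 K m (ξ (l + 1) ω, Θ l ω) (ν.C l ω, ν.T (l + 1) ω) := fun K m l =>
    ENNReal.coe_toNNReal (ne_top_of_le_ne_top ENNReal.coe_ne_top (hb1 K m _ _))
  have c2 : ∀ K m l, (b2 K m l : ℝ≥0∞) =
      h2 K m (ξ (l + 1) ω) (ν.C (l + 1) ω, ν.T (l + 1 + 1) ω) := fun K m l =>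
    ENNReal.coe_toNNReal (ne_top_of_le_ne_top ENNReal.coe_ne_top (hb2 K m _ _))
  have B1 : ∀ K m l, b1 K m l ≤ 5 * (K + 1) := fun K m l => by
    rw [← ENNReal.coe_le_coe, c1]; exact hb1 K m _ _
  have B2 : ∀ K m l, b2 K m l ≤ 5 * (K + 1) := fun K m l => by
    have : b2 K m l ≤ 1 * (K + 1) := by
      rw [← ENNReal.coe_le_coe, c2, one_mul]; exact hb2 K m _ _
    refine this.trans ?_
    gcongr
    norm_num
  have I1 : ∀ K m x, ∫⁻ n, h1 K m x n ∂(μC.prod μT) ≤ ((5 * (K + 1) : ℝ≥0) : ℝ≥0∞) :=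
    fun K m x => (lintegral_mono fun n => hb1 K m x n).trans (by simp)
  have I2 : ∀ K m x, ∫⁻ n, h2 K m x n ∂(μC.prod μT) ≤ ((5 * (K + 1) : ℝ≥0) : ℝ≥0∞) :=
    fun K m x => (lintegral_mono fun n => (hb2 K m x n).trans
      (show ((K + 1 : ℝ≥0) : ℝ≥0∞) ≤ ((5 * (K + 1) : ℝ≥0) : ℝ≥0∞) by
        norm_cast; omega)).trans (by simp)
  have t1 := fun K θ => coe_meanMap (μC.prod μT) (isRegular_transG (lN := μC.prod μT) K) θ
  have t2 := fun K θ => coe_meanMap (μC.prod μT) (isRegular_runG (lN := μC.prod μT) K) θ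
  have t3 := fun K θ => coe_meanMap (μC.prod μT) (isRegular_waitG (lN := μC.prod μT) K) θ
  have t4 := fun K θ => coe_meanMap (μC.prod μT) (isRegular_compG (lN := μC.prod μT) K) θ
  have hgain : ∀ K m l, D.gainFn K m (key l) =
      (∫⁻ n, h1 K m (ξ (l + 1) ω, Θ l ω) n ∂(μC.prod μT)).toNNReal +
      (∫⁻ n, h2 K m (ξ (l + 1) ω) n ∂(μC.prod μT)).toNNReal := by
    intro K m l
    rw [← ENNReal.coe_inj, ENNReal.coe_add,
      ENNReal.coe_toNNReal (ne_top_of_le_ne_top ENNReal.coe_ne_top (I1 K m _)),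
      ENNReal.coe_toNNReal (ne_top_of_le_ne_top ENNReal.coe_ne_top (I2 K m _))]
    have u1 : Measurable (transG K 0) := (mT K).of_uncurry_left
    have u2 : Measurable (runG K (Θ l ω)) := (mR K).of_uncurry_left
    have u3 : Measurable (waitG K (Θ l ω)) := (mW K).of_uncurry_left
    have u4 : Measurable (compG K 0) := (mC K).of_uncurry_left
    simp only [h1, h2]
    have u5 : Measurable fun n => runG K (Θ l ω) n + waitG K (Θ l ω) n := u2.add u3
    have u6 : Measurable fun n => transG K 0 n + (runG K (Θ l ω) n + waitG K (Θ l ω) n) := u1.add u5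
    have u7 : Measurable fun n => transG K 0 n + waitG K (Θ l ω) n := u1.add u3
    rw [lintegral_add_left u6, lintegral_add_left u1, lintegral_add_left u2,
      lintegral_const_mul _ u7, lintegral_add_left u1, lintegral_const_mul _ u4]
    change ((meanMap _ (isRegular_transG K) (Θ l ω) + (meanMap _ (isRegular_runG K) (Θ l ω) +
      meanMap _ (isRegular_waitG K) (Θ l ω)) + srcInd m (key l) *
      (meanMap _ (isRegular_transG K) (Θ l ω) + meanMap _ (isRegular_waitG K) (Θ l ω) +
        meanMap _ (isRegular_compG K) (Θ l ω)) : ℝ≥0) : ℝ≥0∞) = _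
    simp only [ENNReal.coe_add, ENNReal.coe_mul, coe_srcInd, t1, t2, t3, t4]
    simp only [hkey, mul_add, add_assoc]
    rfl
  obtain ⟨𝒟, -, h𝒟⟩ := exists_countable_dense_continuousMap
  refine D.le_liminf_of_path (key := key) w (inc_pos .nonpreemptive hT hC) h𝒟
    (fun φ _ m => ?_) (d := recvInd .nonpreemptive ν ξ Z ω) (fun m l => ?_) (fun m => ?_)
    (b := fun K m l => b1 K m l + b2 K m l)
    (fun K m => ⟨5 * (K + 1) + 5 * (K + 1), fun l => add_le_add (B1 K m l) (B2 K m l)⟩)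
    (fun K m => ?_)
    (r := fun m l => ENNReal.ofReal (ν.T (l + 1) ω) +
      ENNReal.ofReal (waiting .nonpreemptive ν Z (l + 1) ω) +
      min (Θ (l + 0) ω) (ENNReal.ofReal (ν.C (l + 0) ω)) +
      recvSys .nonpreemptive ν ξ Z ω m (l + 1))
    (fun K m l hl => ?_) (cnt := fun m n => recvCount .nonpreemptive ν ξ Z m ω n)
    (fun m n => coe_recvCount _ ω m n) (fun m => ?_) (fun m j => ?_) hV
  -- For a point mass at 0 and constant side information 0, the admissibility condition is trivial.
  · have : (∫⁻ t, φ t ∂D.base) = φ 0 := lintegral_dirac' (0 : ℝ≥0∞) (by fun_prop)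
    rw [this]
    exact WtEquiv.refl _
  · unfold recvInd; split_ifs <;> simp
  · have : recvInd .nonpreemptive ν ξ Z ω m = fun l => D.rateFn m (key l) := by
      ext l
      have e : D.rateFn m (key l) = srcInd m (key l) := mul_one _
      rw [e]
      change _ = ((if ξ (l + 1) ω = m then (1 : ℝ≥0) else 0 : ℝ≥0) : ℝ)
      simp [recvInd, ReceivedFrom, Received]
    rw [this]
    exact WtEquiv.refl _
  · have := (e1 K m).add (e2 K m) (B := 5 * (K + 1)) (B1 K m) (fun l => by
        rw [← ENNReal.coe_le_coe, ENNReal.coe_toNNReal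
          (ne_top_of_le_ne_top ENNReal.coe_ne_top (I1 K m _))]; exact I1 K m _) (B2 K m) (fun l => by
        rw [← ENNReal.coe_le_coe, ENNReal.coe_toNNReal
          (ne_top_of_le_ne_top ENNReal.coe_ne_top (I2 K m _))]; exact I2 K m _)
    simpa only [hgain] using! this
  · have hw := (hthr l hl).wait rfl
    rw [ENNReal.coe_add, c1, c2]
    have a1 : transG K 0 (ν.C l ω, ν.T (l + 1) ω) ≤ ENNReal.ofReal (ν.T (l + 1) ω) :=
      min_le_left _ _
    have a2 : waitG K (Θ l ω) (ν.C l ω, ν.T (l + 1) ω) ≤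
        ENNReal.ofReal (waiting .nonpreemptive ν Z (l + 1) ω) := by
      rw [hw]; exact tsub_le_tsub_right (tsub_le_tsub_right (min_le_left _ _) _) _
    have a3 : runG K (Θ l ω) (ν.C l ω, ν.T (l + 1) ω) ≤ min (Θ l ω) (ENNReal.ofReal (ν.C l ω)) :=
      min_le_min_left _ (min_le_left _ _)
    have a4 : compG K 0 (ν.C (l + 1) ω, ν.T (l + 1 + 1) ω) ≤ ENNReal.ofReal (ν.C (l + 1) ω) :=
      min_le_left _ _
    simp only [h1, h2, srcOne, add_zero]
    by_cases hm : ξ (l + 1) ω = m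
    · have hr : ReceivedFrom .nonpreemptive ν ξ Z m ω (l + 1) := ⟨by omega, hm, trivial⟩
      rw [if_pos hm, recvSys_of_received hr, one_mul, one_mul, ofReal_sysTime (hTp _).le (hCp _).le]
      calc _ ≤ ENNReal.ofReal (ν.T (l + 1) ω) + (min (Θ l ω) (ENNReal.ofReal (ν.C l ω)) +
              ENNReal.ofReal (waiting .nonpreemptive ν Z (l + 1) ω)) +
            (ENNReal.ofReal (ν.T (l + 1) ω) +
              ENNReal.ofReal (waiting .nonpreemptive ν Z (l + 1) ω)) +
            ENNReal.ofReal (ν.C (l + 1) ω) := by gcongr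
        _ = _ := by ring
    · rw [if_neg hm, recvSys_of_not_received fun h => hm h.2.1, zero_mul, zero_mul, add_zero,
        add_zero, add_zero]
      calc _ ≤ ENNReal.ofReal (ν.T (l + 1) ω) + (min (Θ l ω) (ENNReal.ofReal (ν.C l ω)) +
              ENNReal.ofReal (waiting .nonpreemptive ν Z (l + 1) ω)) := by gcongr
        _ = _ := by ring
  · convert! hfreq m
  -- Shift 0: the stage of packet `l + 1` contains the computation time spent on packet `l`.
  · exact path_lower_bound m j (fun i hi => (hthr i hi).le) 0 zero_le_one

/-- Whether packet `l + 1` is delivered is governed by its own threshold, planned when `T (l+1)` is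
known; this time is the side information. The source was chosen before `T (l+1)` was revealed, which
is the independence required of admissible laws. -/
theorem le_liminf_preemptive (hν : ν.IsModel P μT μC) (hT : IsTimeLaw μT) (hC : IsTimeLaw μC)
    (w : Fin M → ℝ) (hF : Feasible .preemptive ν P ξ Z) {V : ℝ≥0∞}
    (hV : ∀ η ∈ (preData hT hC).admissible M,
      V ≤ ⨆ K, (preData hT hC).cost w K (η : Measure (Key M))) :
    ∀ᵐ ω ∂P, V ≤ liminf (fun j => ∑ m, ENNReal.ofReal (w m) *
      ∑' k, (wt j k : ℝ≥0∞) * countedPeak .preemptive ν ξ Z m k ω) atTop := by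
  classical
  have := hT.isProbability
  have := hC.isProbability
  obtain ⟨hξ, hZ, hfreq⟩ := hF
  obtain ⟨Θ, hΘ, hthr⟩ := CausalSampler.exists_threshold hν hT hC hZ
  set D := preData hT hC with hD
  have : IsProbabilityMeasure D.base := isProbabilityMeasure_base .preemptive hT hC
  -- `h0` is the transmission time of packet `l + 1` as noise of step `l`, averaged over its law;
  -- `h1` and `h2` treat it as known and average over the noise of step `l + 1`. `h3` tests the side
  -- information against the source.
  let h0 : ℕ → Unit → ℝ × ℝ → ℝ≥0∞ := fun K _ n => transG K 0 n
  let h1 : ℕ → Fin M → Key M → ℝ × ℝ → ℝ≥0∞ := fun K m x n =>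
    runG K x.2.2 n + srcOne m x.1 * (min x.2.1 (lvl K) * recvG x.2.2 n +
      compG K x.2.2 n * recvG x.2.2 n)
  let h2 : Fin M → Key M → ℝ × ℝ → ℝ≥0∞ := fun m x n => srcOne m x.1 * recvG x.2.2 n
  let h3 : C(ℝ≥0∞, ℝ≥0) → Fin M → Fin M → ℝ × ℝ → ℝ≥0∞ := fun φ m i n =>
    srcOne m i * φ (ENNReal.ofReal n.2)
  have mT := fun K => (isRegular_transG (lN := μC.prod μT) K).meas
  have mR := fun K => (isRegular_runG (lN := μC.prod μT) K).meas
  have mD := measurable_recvG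
  have mC := fun K => (isRegular_compG (lN := μC.prod μT) K).meas
  have bT : ∀ K θ n, transG K θ n ≤ lvl K := fun K θ n => min_le_right _ _
  have bC : ∀ K θ n, compG K θ n ≤ lvl K := fun K θ n => min_le_right _ _
  have bR : ∀ K θ n, runG K θ n ≤ lvl K := fun K θ n => (min_le_right _ _).trans (min_le_right _ _)
  have hm0 : ∀ K, Measurable (Function.uncurry (h0 K)) := fun K =>
    (mT K).comp (measurable_const.prodMk measurable_snd :
      Measurable fun p : Unit × (ℝ × ℝ) => ((0 : ℝ≥0∞), p.2))
  have e : Measurable fun p : Key M × (ℝ × ℝ) => (p.1.2.2, p.2) := by fun_prop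
  have d : ∀ m, Measurable fun p : Key M × (ℝ × ℝ) => srcOne m p.1.1 := fun m =>
    (measurable_srcOne m).comp (measurable_fst.comp measurable_fst)
  have hm1 : ∀ K m, Measurable (Function.uncurry (h1 K m)) := by
    intro K m
    have a : Measurable fun p : Key M × (ℝ × ℝ) => min p.1.2.1 (lvl K) := by fun_prop
    exact ((mR K).comp e).add ((d m).mul ((a.mul (mD.comp e)).add
      (((mC K).comp e).mul (mD.comp e))))
  have hm2 : ∀ m, Measurable (Function.uncurry (h2 m)) := fun m => (d m).mul (mD.comp e)
  have hm3 : ∀ φ m, Measurable (Function.uncurry (h3 φ m)) := by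
    intro φ m
    have a : Measurable fun p : Fin M × (ℝ × ℝ) => (φ (ENNReal.ofReal p.2.2) : ℝ≥0∞) := by fun_prop
    exact ((measurable_srcOne m).comp measurable_fst).mul a
  have hb0 : ∀ K x n, h0 K x n ≤ ((3 * (K + 1) : ℝ≥0) : ℝ≥0∞) := by
    intro K x n
    refine (bT K 0 n).trans ?_
    rw [lvl_eq]; norm_cast; omega
  have hb1 : ∀ K m x n, h1 K m x n ≤ ((3 * (K + 1) : ℝ≥0) : ℝ≥0∞) := by
    intro K m x n
    have : h1 K m x n ≤ lvl K + 1 * (lvl K * 1 + lvl K * 1) :=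
      add_le_add (bR _ _ _) (mul_le_mul' (srcOne_le _ _) (add_le_add
        (mul_le_mul' (min_le_right _ _) (recvG_le_one _ _))
        (mul_le_mul' (bC _ _ _) (recvG_le_one _ _))))
    refine this.trans (le_of_eq ?_)
    rw [lvl_eq]; norm_cast; ring
  have hb2 : ∀ m x n, h2 m x n ≤ ((1 : ℝ≥0) : ℝ≥0∞) := fun m x n => by
    have : h2 m x n ≤ 1 * 1 := mul_le_mul' (srcOne_le _ _) (recvG_le_one _ _)
    simpa using this
  obtain ⟨𝒟, h𝒟c, h𝒟⟩ := exists_countable_dense_continuousMap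
  have hξ' : ∀ l, Measurable[ν.sampInfo l] (ξ (l + 1)) := fun l => (hξ l).mono le_sup_left le_rfl
  have hkeym : ∀ l, Measurable[ν.sampInfo (l + 1)]
      fun ω => (ξ (l + 1) ω, ENNReal.ofReal (ν.T (l + 1) ω), Θ (l + 1) ω) := fun l =>
    ((hξ' l).mono (ν.sampInfo_mono (Nat.le_succ l)) le_rfl).prodMk
      (Measurable.prodMk ((ν.measurable_T_history le_rfl).mono (ν.history_le_sampInfo _)
        le_rfl).ennreal_ofReal (hΘ (l + 1)))
  have ae0 := ae_all_iff.2 fun K => hν.ae_wtEquiv 0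
    (X := fun _ _ => ()) (fun l => measurable_const) (hm0 K) (hb0 K)
  have ae1 := ae_all_iff.2 fun K => ae_all_iff.2 fun m => hν.ae_wtEquiv 1 hkeym (hm1 K m) (hb1 K m)
  have ae2 := ae_all_iff.2 fun m => hν.ae_wtEquiv 1 hkeym (hm2 m) (hb2 m)
  have ae3 : ∀ᵐ ω ∂P, ∀ φ ∈ 𝒟, ∀ m, WtEquiv
      (fun l => (h3 φ m (ξ (l + 1) ω) (ν.C (l + 0) ω, ν.T (l + 0 + 1) ω)).toNNReal)
      (fun l => (∫⁻ n, h3 φ m (ξ (l + 1) ω) n ∂(μC.prod μT)).toNNReal) := by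
    refine (ae_ball_iff h𝒟c).2 fun φ _ => ae_all_iff.2 fun m => ?_
    obtain ⟨B, hB⟩ := exists_bound_of_compact φ
    refine hν.ae_wtEquiv 0 (B := B) hξ' (hm3 φ m) fun x n => ?_
    have : h3 φ m x n ≤ 1 * B := mul_le_mul' (srcOne_le _ _) (ENNReal.coe_le_coe.2 (hB _))
    simpa using this
  filter_upwards [ae0, ae1, ae2, ae3, hthr, hfreq, hν.ae_T_pos hT, hν.ae_C_pos hC]
    with ω e0 e1 e2 e3 hthr hfreq hTp hCp
  set key : ℕ → Key M := fun l => (ξ (l + 1) ω, ENNReal.ofReal (ν.T (l + 1) ω), Θ (l + 1) ω)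
    with hkey
  set b0 : ℕ → ℕ → ℝ≥0 := fun K l => (h0 K () (ν.C l ω, ν.T (l + 1) ω)).toNNReal
  set b1 : ℕ → Fin M → ℕ → ℝ≥0 := fun K m l =>
    (h1 K m (key l) (ν.C (l + 1) ω, ν.T (l + 1 + 1) ω)).toNNReal
  have c0 : ∀ K l, (b0 K l : ℝ≥0∞) = h0 K () (ν.C l ω, ν.T (l + 1) ω) := fun K l =>
    ENNReal.coe_toNNReal (ne_top_of_le_ne_top ENNReal.coe_ne_top (hb0 K () _))
  have c1 : ∀ K m l, (b1 K m l : ℝ≥0∞) =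
      h1 K m (key l) (ν.C (l + 1) ω, ν.T (l + 1 + 1) ω) := fun K m l =>
    ENNReal.coe_toNNReal (ne_top_of_le_ne_top ENNReal.coe_ne_top (hb1 K m _ _))
  have B0 : ∀ K l, b0 K l ≤ 3 * (K + 1) := fun K l => by
    rw [← ENNReal.coe_le_coe, c0]; exact hb0 K () _
  have B1 : ∀ K m l, b1 K m l ≤ 3 * (K + 1) := fun K m l => by
    rw [← ENNReal.coe_le_coe, c1]; exact hb1 K m _ _
  have I0 : ∀ K x, ∫⁻ n, h0 K x n ∂(μC.prod μT) ≤ ((3 * (K + 1) : ℝ≥0) : ℝ≥0∞) :=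
    fun K x => (lintegral_mono fun n => hb0 K x n).trans (by simp)
  have I1 : ∀ K m x, ∫⁻ n, h1 K m x n ∂(μC.prod μT) ≤ ((3 * (K + 1) : ℝ≥0) : ℝ≥0∞) :=
    fun K m x => (lintegral_mono fun n => hb1 K m x n).trans (by simp)
  have t1 := fun K θ => coe_meanMap (μC.prod μT) (isRegular_transG (lN := μC.prod μT) K) θ
  have t2 := fun K θ => coe_meanMap (μC.prod μT) (isRegular_runG (lN := μC.prod μT) K) θ
  have t3 := fun θ => coe_meanMap (μC.prod μT) (isRegular_recvG (μC := μC) hT) θ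
  have t4 := fun K θ => coe_meanMap (μC.prod μT) (isRegular_recvG_mul (μC := μC) hT K) θ
  have hgain : ∀ K m l, D.gainFn K m (key l) = (∫⁻ n, h0 K () n ∂(μC.prod μT)).toNNReal +
      (∫⁻ n, h1 K m (key l) n ∂(μC.prod μT)).toNNReal := by
    intro K m l
    rw [← ENNReal.coe_inj, ENNReal.coe_add,
      ENNReal.coe_toNNReal (ne_top_of_le_ne_top ENNReal.coe_ne_top (I0 K ())),
      ENNReal.coe_toNNReal (ne_top_of_le_ne_top ENNReal.coe_ne_top (I1 K m _))]
    generalize key l = x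
    have u2 : Measurable (runG K x.2.2) := (mR K).of_uncurry_left
    have u3 : Measurable (recvG x.2.2) := mD.of_uncurry_left
    have u4 : Measurable (compG K x.2.2) := (mC K).of_uncurry_left
    have u5 : Measurable fun n => min x.2.1 (lvl K) * recvG x.2.2 n := u3.const_mul _
    have u6 : Measurable fun n => min x.2.1 (lvl K) * recvG x.2.2 n +
      compG K x.2.2 n * recvG x.2.2 n := u5.add (u4.mul u3)
    simp only [h0, h1]
    rw [lintegral_add_left u2, lintegral_const_mul _ u6, lintegral_add_left u5,
      lintegral_const_mul _ u3]
    change ((meanMap _ (isRegular_transG K) x.2.2 + meanMap _ (isRegular_runG K) x.2.2 +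
      srcInd m x * (truncMap K x.2.1 * meanMap _ (isRegular_recvG hT) x.2.2 +
        meanMap _ (isRegular_recvG_mul hT K) x.2.2) : ℝ≥0) : ℝ≥0∞) = _
    simp only [ENNReal.coe_add, ENNReal.coe_mul, coe_srcInd, t1, t2, t3, t4, coe_truncMap,
      add_assoc]
    rfl
  have hrecv : ∀ m l, (h2 m (key l) (ν.C (l + 1) ω, ν.T (l + 1 + 1) ω)) =
      recvInd .preemptive ν ξ Z ω m l := by
    intro m l
    simp only [h2, srcOne, recvG, hkey, recvInd, ReceivedFrom, (hthr (l + 1) (by omega)).recv rfl]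
    by_cases h : ξ (l + 1) ω = m <;>
      by_cases h' : ENNReal.ofReal (ν.C (l + 1) ω) ≤ Θ (l + 1) ω + ENNReal.ofReal (ν.T (l + 1 + 1) ω)
        <;> simp [h, h']
  refine D.le_liminf_of_path (key := key) w (inc_pos .preemptive hT hC) h𝒟
    (fun φ hφ m => ?_) (d := recvInd .preemptive ν ξ Z ω) (fun m l => ?_) (fun m => ?_)
    (b := fun K m l => b0 K l + b1 K m l)
    (fun K m => ⟨3 * (K + 1) + 3 * (K + 1), fun l => add_le_add (B0 K l) (B1 K m l)⟩)
    (fun K m => ?_)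
    (r := fun m l => ENNReal.ofReal (ν.T (l + 1) ω) +
      ENNReal.ofReal (waiting .preemptive ν Z (l + 1) ω) +
      min (Θ (l + 1) ω) (ENNReal.ofReal (ν.C (l + 1) ω)) +
      recvSys .preemptive ν ξ Z ω m (l + 1))
    (fun K m l hl => ?_) (cnt := fun m n => recvCount .preemptive ν ξ Z m ω n)
    (fun m n => coe_recvCount _ ω m n) (fun m => ?_) (fun m j => ?_) hV
  · refine (e3 φ hφ m).congr fun j => tsum_congr fun l => ?_
    have hb : ∫⁻ t, φ t ∂D.base = ∫⁻ n, φ (ENNReal.ofReal n.2) ∂(μC.prod μT) := by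
      have a : Measurable fun t : ℝ => (φ (ENNReal.ofReal t) : ℝ≥0∞) := by fun_prop
      have h1 : ∫⁻ t, φ t ∂D.base = ∫⁻ t, φ (ENNReal.ofReal t) ∂μT :=
        lintegral_map (by fun_prop) (by fun_prop)
      have h2 : ∫⁻ n, φ (ENNReal.ofReal n.2) ∂(μC.prod μT) =
          ∫⁻ _, ∫⁻ t, φ (ENNReal.ofReal t) ∂μT ∂μC :=
        lintegral_prod _ (a.comp measurable_snd).aemeasurable
      rw [h1, h2]
      simp
    have a : Measurable fun n : ℝ × ℝ => (φ (ENNReal.ofReal n.2) : ℝ≥0∞) := by fun_prop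
    have hs : srcInd m (key l) = (srcOne m (ξ (l + 1) ω)).toNNReal := by
      rw [← ENNReal.coe_inj, coe_srcInd, ENNReal.coe_toNNReal (srcOne_ne_top _ _)]
    simp only [h3]
    rw [lintegral_const_mul _ a, ENNReal.toNNReal_mul, ENNReal.toNNReal_mul, ← hb, ← hs,
      ENNReal.toNNReal_coe]
  · unfold recvInd; split_ifs <;> simp
  · refine (e2 m).congr fun j => tsum_congr fun l => ?_
    have e4 : (∫⁻ n, h2 m (key l) n ∂(μC.prod μT)).toNNReal = D.rateFn m (key l) := by
      have u3 : Measurable (recvG (key l).2.2) := mD.of_uncurry_left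
      simp only [h2]
      rw [lintegral_const_mul _ u3, ← t3, ← coe_srcInd, ← ENNReal.coe_mul, ENNReal.toNNReal_coe]
      rfl
    have e5 := congrArg ENNReal.toNNReal (hrecv m l)
    rw [ENNReal.toNNReal_coe] at e5
    rw [← e5]
    beta_reduce
    rw [← e4]
  · have := (e0 K).add (e1 K m) (B := 3 * (K + 1)) (B0 K) (fun l => by
        rw [← ENNReal.coe_le_coe, ENNReal.coe_toNNReal
          (ne_top_of_le_ne_top ENNReal.coe_ne_top (I0 K ()))]; exact I0 K ()) (B1 K m) (fun l => by
        rw [← ENNReal.coe_le_coe, ENNReal.coe_toNNReal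
          (ne_top_of_le_ne_top ENNReal.coe_ne_top (I1 K m _))]; exact I1 K m _)
    simpa only [hgain] using! this
  · have h2e := hrecv m l
    rw [ENNReal.coe_add, c0, c1]
    have a1 : transG K 0 (ν.C l ω, ν.T (l + 1) ω) ≤ ENNReal.ofReal (ν.T (l + 1) ω) :=
      min_le_left _ _
    have a3 : runG K (Θ (l + 1) ω) (ν.C (l + 1) ω, ν.T (l + 1 + 1) ω) ≤
        min (Θ (l + 1) ω) (ENNReal.ofReal (ν.C (l + 1) ω)) := min_le_min_left _ (min_le_left _ _)
    have a4 : compG K (Θ (l + 1) ω) (ν.C (l + 1) ω, ν.T (l + 1 + 1) ω) ≤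
        ENNReal.ofReal (ν.C (l + 1) ω) := min_le_left _ _
    have a5 : min (ENNReal.ofReal (ν.T (l + 1) ω)) (lvl K) ≤ ENNReal.ofReal (ν.T (l + 1) ω) :=
      min_le_left _ _
    have a6 : srcOne m (key l).1 * (min (key l).2.1 (lvl K) *
        recvG (key l).2.2 (ν.C (l + 1) ω, ν.T (l + 1 + 1) ω) +
        compG K (key l).2.2 (ν.C (l + 1) ω, ν.T (l + 1 + 1) ω) *
        recvG (key l).2.2 (ν.C (l + 1) ω, ν.T (l + 1 + 1) ω)) ≤
        recvSys .preemptive ν ξ Z ω m (l + 1) := by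
      rw [← add_mul, mul_left_comm]
      change _ * h2 m (key l) (ν.C (l + 1) ω, ν.T (l + 1 + 1) ω) ≤ _
      rw [h2e]
      by_cases hp : ReceivedFrom .preemptive ν ξ Z m ω (l + 1)
      · rw [recvSys_of_received hp, ofReal_sysTime (hTp _).le (hCp _).le, recvInd, if_pos hp,
          ENNReal.coe_one, mul_one]
        exact add_le_add (a5.trans le_self_add) a4
      · rw [recvInd, if_neg hp]; simp
    calc _ ≤ ENNReal.ofReal (ν.T (l + 1) ω) + (min (Θ (l + 1) ω) (ENNReal.ofReal (ν.C (l + 1) ω)) +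
          recvSys .preemptive ν ξ Z ω m (l + 1)) := add_le_add a1 (add_le_add a3 a6)
      _ ≤ _ := by
        rw [← add_assoc]
        gcongr
        exact le_self_add
  · convert! hfreq m
  -- Shift 1: transmission and computation of the same packet form one stage.
  · exact path_lower_bound m j (fun i hi => (hthr i hi).le) 1 le_rfl

/-- Lower bound for the cost of every feasible policy. -/
theorem le_avgPAoI (hν : ν.IsModel P μT μC) (hT : IsTimeLaw μT) (hC : IsTimeLaw μC)
    (w : Fin M → ℝ) (srv : Server) (hF : Feasible srv ν P ξ Z) {V : ℝ≥0∞}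
    (hV : ∀ η ∈ (srv.data hT hC).admissible M,
      V ≤ ⨆ K, (srv.data hT hC).cost w K (η : Measure (Key M))) :
    V ≤ avgPAoI srv ν P w ξ Z := by
  refine le_avgPAoI_of_ae hν.meas_T hν.meas_C (hF.2.1.measurable hν) (hF.1.measurable hν) w
    (hF.2.1.ae_nonneg hν hT) (ae_sysTime_nonneg hν hT hC srv Z) ?_
  cases srv
  · exact le_liminf_nonpreemptive hν hT hC w hF hV
  · exact le_liminf_preemptive hν hT hC w hF hV

end LowerBound

/-! ### Variables independent of the past -/

section Fresh
variable {Ω 𝒳 𝒴 : Type*} [MeasurableSpace 𝒳] [MeasurableSpace 𝒴]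

/-- `X` has law `l`, is independent of `𝒢`, and is known under the finer information `𝒢'`. -/
structure IsFresh (𝒢 𝒢' : MeasurableSpace Ω) {mΩ : MeasurableSpace Ω} (P : Measure Ω) (X : Ω → 𝒳)
    (l : Measure 𝒳) : Prop where
  le : 𝒢 ≤ 𝒢'
  le_ambient : 𝒢' ≤ mΩ
  meas : Measurable[𝒢'] X
  indep : Indep 𝒢 (MeasurableSpace.comap X inferInstance) P
  map : P.map X = l

variable {𝒢 𝒢' 𝒢'' 𝒢₀ : MeasurableSpace Ω} {mΩ : MeasurableSpace Ω} {P : Measure Ω} {X : Ω → 𝒳}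
  {Y : Ω → 𝒴} {l : Measure 𝒳} {l' : Measure 𝒴}

theorem IsFresh.measurable (h : IsFresh 𝒢 𝒢' P X l) : Measurable X := h.meas.mono h.le_ambient le_rfl

theorem IsFresh.mono (h : IsFresh 𝒢 𝒢' P X l) (h0 : 𝒢₀ ≤ 𝒢) (h1 : 𝒢' ≤ 𝒢'')
    (h2 : 𝒢'' ≤ mΩ) : IsFresh 𝒢₀ 𝒢'' P X l :=
  ⟨h0.trans (h.le.trans h1), h2, h.meas.mono h1 le_rfl, indep_of_indep_of_le_left h.indep h0, h.map⟩

theorem IsFresh.comp (h : IsFresh 𝒢 𝒢' P X l) {g : 𝒳 → 𝒴} (hg : Measurable g) :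
    IsFresh 𝒢 𝒢' P (fun ω => g (X ω)) (l.map g) where
  le := h.le
  le_ambient := h.le_ambient
  meas := hg.comp h.meas
  indep := indep_of_indep_of_le_right h.indep (by
    rintro s ⟨t, ht, rfl⟩
    exact ⟨g ⁻¹' t, hg ht, rfl⟩)
  map := by rw [← h.map, Measure.map_map hg h.measurable]; rfl

theorem IsFresh.measure_inter (h : IsFresh 𝒢 𝒢' P X l) {G : Set Ω} (hG : MeasurableSet[𝒢] G)
    {A : Set 𝒳} (hA : MeasurableSet A) : P (G ∩ X ⁻¹' A) = P G * l A := by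
  rw [(Indep_iff _ _ _).1 h.indep G _ hG ⟨A, hA, rfl⟩, ← h.map, Measure.map_apply h.measurable hA]

/-- Variables revealed one after another, each independent of everything known before, are jointly
independent of the initial information and have product law. -/
theorem IsFresh.pair [IsProbabilityMeasure P] (h : IsFresh 𝒢 𝒢' P X l)
    (h' : IsFresh 𝒢' 𝒢'' P Y l') : IsFresh 𝒢 𝒢'' P (fun ω => (X ω, Y ω)) (l.prod l') := by
  have : IsProbabilityMeasure l := h.map ▸ Measure.isProbabilityMeasure_map h.measurable.aemeasurable
  have : IsProbabilityMeasure l' :=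
    h'.map ▸ Measure.isProbabilityMeasure_map h'.measurable.aemeasurable
  have hm : Measurable fun ω => (X ω, Y ω) := h.measurable.prodMk h'.measurable
  -- The event that `G` holds and `X ∈ A` belongs to `𝒢'`, so freshness of `Y` applies to it;
  -- rectangles determine the law.
  have key : ∀ G, MeasurableSet[𝒢] G → (P.restrict G).map (fun ω => (X ω, Y ω)) = P G • l.prod l' := by
    intro G hG
    have : IsFiniteMeasure ((P.restrict G).map fun ω => (X ω, Y ω)) :=
      Measure.isFiniteMeasure_map _ _
    refine Measure.ext_prod fun {A B} hA hB => ?_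
    rw [Measure.map_apply hm (hA.prod hB), Measure.restrict_apply (hm (hA.prod hB)),
      Measure.smul_apply, Measure.prod_prod, smul_eq_mul, ← mul_assoc, ← h.measure_inter hG hA,
      ← h'.measure_inter ((h.le _ hG).inter (h.meas hA)) hB]
    congr 1
    ext ω
    simp only [Set.mem_inter_iff, Set.mem_preimage, Set.mem_prod]
    tauto
  have hmap : P.map (fun ω => (X ω, Y ω)) = l.prod l' := by
    have := key Set.univ MeasurableSet.univ
    rwa [Measure.restrict_univ, measure_univ, one_smul] at this
  refine ⟨h.le.trans h'.le, h'.le_ambient, (h.meas.mono h'.le le_rfl).prodMk h'.meas, ?_, hmap⟩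
  rw [Indep_iff]
  rintro G _ hG ⟨A, hA, rfl⟩
  rw [← Measure.map_apply hm hA, hmap, Set.inter_comm, ← Measure.restrict_apply (hm hA),
    ← Measure.map_apply hm hA, key G hG, Measure.smul_apply, smul_eq_mul]

theorem IsFresh.lintegral_indicator_mul (h : IsFresh 𝒢 𝒢' P X l) {G : Set Ω}
    (hG : MeasurableSet[𝒢] G) {y : 𝒳 → ℝ≥0∞} (hy : Measurable y) :
    ∫⁻ ω, G.indicator 1 ω * y (X ω) ∂P = P G * ∫⁻ x, y x ∂l := by
  have hc : MeasurableSpace.comap X inferInstance ≤ mΩ :=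
    measurable_iff_comap_le.1 h.measurable
  have hle := h.le.trans h.le_ambient
  have h1 : Measurable[𝒢] (G.indicator (1 : Ω → ℝ≥0∞)) :=
    (measurable_const (a := (1 : ℝ≥0∞))).indicator hG
  have h2 : Measurable[MeasurableSpace.comap X inferInstance] fun ω => y (X ω) :=
    hy.comp (comap_measurable X)
  rw [lintegral_mul_eq_lintegral_mul_lintegral_of_independent_measurableSpace hle hc h.indep h1 h2,
    lintegral_indicator_one (hle _ hG), ← h.map, lintegral_map hy h.measurable]

end Fresh

/-! ### A renewal reward theorem with delayed information -/

section Renewal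

theorem tendsto_average_of_even_odd {x : ℕ → ℝ} {r : ℝ}
    (h0 : Tendsto (fun n : ℕ => (∑ i ∈ Finset.range n, x (2 * i)) / n) atTop (𝓝 r))
    (h1 : Tendsto (fun n : ℕ => (∑ i ∈ Finset.range n, x (2 * i + 1)) / n) atTop (𝓝 r)) :
    Tendsto (fun n : ℕ => (∑ i ∈ Finset.range n, x i) / n) atTop (𝓝 r) := by
  have hsum : ∀ n : ℕ, ∑ i ∈ Finset.range n, x i =
      ∑ i ∈ Finset.range ((n + 1) / 2), x (2 * i) + ∑ i ∈ Finset.range (n / 2), x (2 * i + 1) := by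
    intro n
    induction n with
    | zero => simp
    | succ n ih =>
      rw [Finset.sum_range_succ, ih]
      rcases Nat.even_or_odd' n with ⟨k, rfl | rfl⟩
      · rw [show (2 * k + 1 + 1) / 2 = k + 1 by omega, show (2 * k + 1) / 2 = k by omega,
          show 2 * k / 2 = k by omega, Finset.sum_range_succ]
        ring
      · rw [show (2 * k + 1 + 1 + 1) / 2 = k + 1 by omega, show (2 * k + 1 + 1) / 2 = k + 1 by omega,
          show (2 * k + 1) / 2 = k by omega, Finset.sum_range_succ _ k, Finset.sum_range_succ _ k]
        ring
  have hfl : Tendsto (fun n : ℕ => ((n / 2 : ℕ) : ℝ) / n) atTop (𝓝 (1 / 2)) := by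
    have := (tendsto_nat_floor_mul_div_atTop (R := ℝ) (a := 1 / 2) (by norm_num)).comp
      tendsto_natCast_atTop_atTop
    refine this.congr fun n => ?_
    simp only [Function.comp_apply]
    rw [show (1 / 2 : ℝ) * n = (n : ℝ) / ((2 : ℕ) : ℝ) by push_cast; ring, Nat.floor_div_eq_div]
  have hcl : Tendsto (fun n : ℕ => (((n + 1) / 2 : ℕ) : ℝ) / n) atTop (𝓝 (1 / 2)) := by
    have h := hfl.const_sub 1
    rw [show (1 : ℝ) - 1 / 2 = 1 / 2 by norm_num] at h
    refine h.congr' ?_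
    filter_upwards [eventually_gt_atTop 0] with n hn
    have hn' : (n : ℝ) ≠ 0 := by positivity
    have : (n / 2 : ℕ) + ((n + 1) / 2 : ℕ) = n := by omega
    have : ((n / 2 : ℕ) : ℝ) + (((n + 1) / 2 : ℕ) : ℝ) = n := by exact_mod_cast this
    field_simp
    linarith
  have t0 : Tendsto (fun n : ℕ => (n + 1) / 2) atTop atTop :=
    tendsto_atTop.2 fun b => eventually_atTop.2 ⟨2 * b, fun n hn => by omega⟩
  have t1 : Tendsto (fun n : ℕ => n / 2) atTop atTop :=
    tendsto_atTop.2 fun b => eventually_atTop.2 ⟨2 * b, fun n hn => by omega⟩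
  have := ((h0.comp t0).mul hcl).add ((h1.comp t1).mul hfl)
  rw [show r * (1 / 2) + r * (1 / 2) = r by ring] at this
  refine this.congr' ?_
  filter_upwards [eventually_gt_atTop 1] with n hn
  have a0 : (((n + 1) / 2 : ℕ) : ℝ) ≠ 0 := by
    have : (n + 1) / 2 ≠ 0 := by omega
    exact_mod_cast this
  have a1 : ((n / 2 : ℕ) : ℝ) ≠ 0 := by
    have : n / 2 ≠ 0 := by omega
    exact_mod_cast this
  simp only [Function.comp_apply]
  rw [hsum, div_mul_div_cancel₀ a0, div_mul_div_cancel₀ a1, add_div]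

theorem tendsto_atTop_of_average {a : ℕ → ℕ} {r : ℝ} (hr : 0 < r)
    (h : Tendsto (fun n : ℕ => (a n : ℝ) / n) atTop (𝓝 r)) : Tendsto a atTop atTop := by
  have := h.pos_mul_atTop hr tendsto_natCast_atTop_atTop
  rw [← tendsto_natCast_atTop_iff (R := ℝ)]
  refine this.congr' ?_
  filter_upwards [eventually_gt_atTop 0] with n hn
  have : (n : ℝ) ≠ 0 := by positivity
  field_simp

variable {Ω 𝒩 : Type*}

open Classical in
/-- Number of visits of `N 0, …, N (n - 1)` to `B`. -/
def visits (N : ℕ → Ω → 𝒩) (B : Set 𝒩) (n : ℕ) (ω : Ω) : ℕ :=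
  ∑ l ∈ Finset.range n, if N l ω ∈ B then 1 else 0

variable {N : ℕ → Ω → 𝒩} {B : Set 𝒩}

open Classical in
theorem visits_succ (n : ℕ) (ω : Ω) :
    visits N B (n + 1) ω = visits N B n ω + if N n ω ∈ B then 1 else 0 := Finset.sum_range_succ _ _

theorem visits_mono (ω : Ω) : Monotone fun n => visits N B n ω :=
  monotone_nat_of_le_succ fun n => by rw [visits_succ]; omega

theorem visits_succ_le (n : ℕ) (ω : Ω) : visits N B (n + 1) ω ≤ visits N B n ω + 1 := by
  rw [visits_succ]; split_ifs <;> omega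

variable [MeasurableSpace 𝒩] {ℋ : ℕ → MeasurableSpace Ω} {mΩ : MeasurableSpace Ω} {P : Measure Ω}
  {l : Measure 𝒩}

/-- `N k` is known only from `ℋ (k + 2)` on, so `ℋ n` sees the first `n - 1` terms. This delay is
the reason for the `n - 1` in `early`. -/
theorem measurable_visits (hmono : Monotone ℋ) (h : ∀ n, IsFresh (ℋ n) (ℋ (n + 2)) P (N n) l)
    (hB : MeasurableSet B) (n : ℕ) : Measurable[ℋ n] (visits N B (n - 1)) := by
  classical
  unfold visits
  refine Finset.measurable_fun_sum _ fun k hk => ?_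
  have hk' : k + 2 ≤ n := by have := Finset.mem_range.1 hk; omega
  exact Measurable.ite ((h k).meas.mono (hmono hk') le_rfl hB) measurable_const measurable_const

/-- Strong law for the visits of a sequence that is fresh after two steps. -/
theorem ae_tendsto_visits [IsProbabilityMeasure P] (hmono : Monotone ℋ)
    (h : ∀ n, IsFresh (ℋ n) (ℋ (n + 2)) P (N n) l) (hB : MeasurableSet B) :
    ∀ᵐ ω ∂P, Tendsto (fun n : ℕ => (visits N B n ω : ℝ) / n) atTop (𝓝 (l B).toReal) := by
  classical
  set g : 𝒩 → ℝ := B.indicator 1 with hg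
  have hgm : Measurable g := measurable_one.indicator hB
  have hlaw : ∀ n, IdentDistrib (fun ω => g (N n ω)) (fun ω => g (N 0 ω)) P P := fun n =>
    IdentDistrib.comp ⟨(h n).measurable.aemeasurable, (h 0).measurable.aemeasurable, by
      rw [(h n).map, (h 0).map]⟩ hgm
  have hmean : ∫ ω, g (N 0 ω) ∂P = (l B).toReal := by
    have : ∫ ω, g (N 0 ω) ∂P = ∫ x, g x ∂l := by
      rw [← (h 0).map, integral_map (h 0).measurable.aemeasurable hgm.aestronglyMeasurable]
    rw [this, hg, integral_indicator_one hB]; rfl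
  have hint : ∀ n, Integrable (fun ω => g (N n ω)) P := fun n =>
    Integrable.of_bound (hgm.comp (h n).measurable).aestronglyMeasurable 1 (ae_of_all _ fun ω => by
      simp only [hg, Set.indicator_apply]; split_ifs <;> simp)
  have hpair : ∀ s, Pairwise fun i j : ℕ =>
      IndepFun (fun ω => g (N (2 * i + s) ω)) (fun ω => g (N (2 * j + s) ω)) P := by
    -- Terms two steps apart are independent, so the even and the odd subsequences are pairwise
    -- independent and the strong law applies to each.
    have aux : ∀ s i j : ℕ, i < j →
        IndepFun (fun ω => g (N (2 * i + s) ω)) (fun ω => g (N (2 * j + s) ω)) P := by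
      intro s i j hij
      have h1 : Measurable[ℋ (2 * j + s)] (N (2 * i + s)) :=
        (h _).meas.mono (hmono (by omega)) le_rfl
      have h2 : IndepFun (N (2 * i + s)) (N (2 * j + s)) P :=
        indep_of_indep_of_le_left (h (2 * j + s)).indep h1.comap_le
      exact h2.comp hgm hgm
    intro s i j hij
    rcases lt_or_gt_of_ne hij with hlt | hlt
    · exact aux s i j hlt
    · exact (aux s j i hlt).symm
  have slln : ∀ s, ∀ᵐ ω ∂P, Tendsto (fun n : ℕ =>
      (∑ i ∈ Finset.range n, g (N (2 * i + s) ω)) / n) atTop (𝓝 (l B).toReal) := by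
    intro s
    have := strong_law_ae_real (fun i ω => g (N (2 * i + s) ω)) (hint _) (hpair s)
      fun i => (hlaw (2 * i + s)).trans (hlaw (2 * 0 + s)).symm
    have e := (hlaw (2 * 0 + s)).integral_eq
    rw [hmean] at e
    rwa [e] at this
  filter_upwards [slln 0, slln 1] with ω h0 h1
  simp only [add_zero] at h0
  refine (tendsto_average_of_even_odd (x := fun i => g (N i ω)) h0 h1).congr fun n => ?_
  simp [visits, hg, Set.indicator_apply]

end Renewal

section Renewal
variable {Ω 𝒩 : Type*} {N : ℕ → Ω → 𝒩} {B : Set 𝒩}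

open Classical in
-- Exactly the first `K` visits are counted.
theorem tsum_visits_lt {ω : Ω} (h : Tendsto (fun n => visits N B n ω) atTop atTop) (K : ℕ) :
    ∑' n, (if visits N B n ω < K then 1 else 0) * (if N n ω ∈ B then 1 else 0) = (K : ℝ≥0∞) := by
  have hsum : ∀ n, ∑ i ∈ Finset.range n,
      (if visits N B i ω < K then 1 else 0) * (if N i ω ∈ B then 1 else 0) =
      ((min K (visits N B n ω) : ℕ) : ℝ≥0∞) := by
    intro n
    induction n with
    | zero => simp [visits]
    | succ n ih =>
      rw [Finset.sum_range_succ, ih, visits_succ]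
      by_cases h1 : visits N B n ω < K <;> by_cases h2 : N n ω ∈ B
      · rw [if_pos h1, if_pos h2, if_pos h2, min_eq_right h1.le, min_eq_right (by omega)]
        push_cast; simp
      · simp [h2]
      · rw [if_neg h1, min_eq_left (by omega), min_eq_left (by omega)]; simp
      · simp [h2]
  refine tendsto_nhds_unique (ENNReal.tendsto_nat_tsum _) ?_
  simp only [hsum]
  refine tendsto_const_nhds.congr' ?_
  filter_upwards [h.eventually_ge_atTop K] with n hn
  rw [min_eq_left hn]

/-- Indicator that there are fewer than `K` visits before step `n - 1`. -/
def early (N : ℕ → Ω → 𝒩) (B : Set 𝒩) (K n : ℕ) : Ω → ℝ≥0∞ :=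
  {ω | visits N B (n - 1) ω < K}.indicator 1

open Classical in
theorem early_apply (K n : ℕ) (ω : Ω) :
    early N B K n ω = if visits N B (n - 1) ω < K then 1 else 0 := by
  simp [early, Set.indicator_apply]

variable [MeasurableSpace 𝒩] {ℋ : ℕ → MeasurableSpace Ω} {mΩ : MeasurableSpace Ω} {P : Measure Ω}
  {l : Measure 𝒩}

/-- Wald's argument: whether the `n`-th reward is collected is decided by `ℋ n`, of which `N n` is
independent. -/
theorem lintegral_early_mul (hmono : Monotone ℋ) (h : ∀ n, IsFresh (ℋ n) (ℋ (n + 2)) P (N n) l)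
    (hB : MeasurableSet B) (K n : ℕ) {y : 𝒩 → ℝ≥0∞} (hy : Measurable y) :
    ∫⁻ ω, early N B K n ω * y (N n ω) ∂P = (∫⁻ ω, early N B K n ω ∂P) * ∫⁻ x, y x ∂l := by
  have hm : MeasurableSet[ℋ n] {ω | visits N B (n - 1) ω < K} :=
    measurable_visits hmono h hB n measurableSet_Iio
  have hm' := (h n).le.trans (h n).le_ambient _ hm
  rw [early, (h n).lintegral_indicator_mul hm hy, lintegral_indicator_one hm']

theorem measurable_early (hmono : Monotone ℋ) (h : ∀ n, IsFresh (ℋ n) (ℋ (n + 2)) P (N n) l)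
    (hB : MeasurableSet B) (K n : ℕ) : Measurable (early N B K n) := by
  have hm : MeasurableSet[ℋ n] {ω | visits N B (n - 1) ω < K} :=
    measurable_visits hmono h hB n measurableSet_Iio
  exact measurable_one.indicator ((h n).le.trans (h n).le_ambient _ hm)

variable [IsProbabilityMeasure P]

/-- Wald's identity with the indicator of `B` as reward counts visits; the delay of one step lets at
most one additional visit through. -/
theorem tsum_early_bounds (hmono : Monotone ℋ) (h : ∀ n, IsFresh (ℋ n) (ℋ (n + 2)) P (N n) l)
    (hB : MeasurableSet B) (hpos : l B ≠ 0) (K : ℕ) :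
    (K : ℝ≥0∞) ≤ (∑' n, ∫⁻ ω, early N B K n ω ∂P) * l B ∧
    (∑' n, ∫⁻ ω, early N B K n ω ∂P) * l B ≤ K + 1 := by
  classical
  have hl : IsProbabilityMeasure l :=
    (h 0).map ▸ Measure.isProbabilityMeasure_map (h 0).measurable.aemeasurable
  have hinf : ∀ᵐ ω ∂P, Tendsto (fun n => visits N B n ω) atTop atTop := by
    filter_upwards [ae_tendsto_visits hmono h hB] with ω hω
    exact tendsto_atTop_of_average (ENNReal.toReal_pos hpos (measure_ne_top _ _)) hω
  have hb : Measurable (B.indicator (1 : 𝒩 → ℝ≥0∞)) := measurable_one.indicator hB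
  have e : (∑' n, ∫⁻ ω, early N B K n ω ∂P) * l B =
      ∫⁻ ω, ∑' n, early N B K n ω * (if N n ω ∈ B then 1 else 0) ∂P := by
    have hm : ∀ n, Measurable fun ω => early N B K n ω * (if N n ω ∈ B then 1 else 0) := fun n =>
      (measurable_early hmono h hB K n).mul (hb.comp (h n).measurable)
    rw [lintegral_tsum fun n => (hm n).aemeasurable, ← ENNReal.tsum_mul_right]
    refine tsum_congr fun n => ?_
    have := lintegral_early_mul hmono h hB K n hb
    rw [lintegral_indicator_one hB] at this
    exact this.symm
  rw [e]
  constructor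
  · calc (K : ℝ≥0∞) = ∫⁻ _, K ∂P := by simp
      _ ≤ _ := lintegral_mono_ae (by
        filter_upwards [hinf] with ω hω
        rw [← tsum_visits_lt hω K]
        refine ENNReal.tsum_le_tsum fun n => ?_
        gcongr
        rw [early_apply]
        have := visits_mono (N := N) (B := B) ω (Nat.sub_le n 1)
        split_ifs with h1 h2 <;> first | rfl | exact zero_le | (exfalso; exact h2 (this.trans_lt h1)))
  · calc _ ≤ ∫⁻ _, ((K + 1 : ℕ) : ℝ≥0∞) ∂P := lintegral_mono_ae (by
        filter_upwards [hinf] with ω hω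
        rw [← tsum_visits_lt hω (K + 1)]
        refine ENNReal.tsum_le_tsum fun n => ?_
        gcongr
        rw [early_apply]
        have hv : visits N B n ω ≤ visits N B (n - 1) ω + 1 := by
          rcases n with _ | n
          · exact Nat.le_succ _
          · exact visits_succ_le n ω
        split_ifs with h1 h2 <;> first | rfl | exact zero_le | (exfalso; omega))
      _ = _ := by simp

/-- Renewal reward limit for a sequence that is fresh after two steps: the mean reward collected
until the `K`-th visit grows linearly. -/
theorem tendsto_lintegral_div (hmono : Monotone ℋ) (h : ∀ n, IsFresh (ℋ n) (ℋ (n + 2)) P (N n) l)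
    (hB : MeasurableSet B) (hpos : l B ≠ 0) {y : 𝒩 → ℝ≥0∞} (hy : Measurable y)
    (hfin : ∫⁻ x, y x ∂l ≠ ⊤) {S : ℕ → Ω → ℝ≥0∞} {S₀ : Ω → ℝ≥0∞} (hS₀ : Measurable S₀)
    (hS₀' : ∫⁻ ω, S₀ ω ∂P ≠ ⊤)
    (hle : ∀ K, ∀ᵐ ω ∂P, S K ω ≤ S₀ ω + ∑' n, early N B K n ω * y (N n ω))
    (hge : ∀ K, ∀ᵐ ω ∂P, ∑' n, early N B K (n + 1) ω * y (N (n + 1) ω) ≤ S (K + 2) ω) :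
    Tendsto (fun K : ℕ => (∫⁻ ω, S K ω ∂P) / K) atTop (𝓝 ((∫⁻ x, y x ∂l) / l B)) := by
  have hl : IsProbabilityMeasure l :=
    (h 0).map ▸ Measure.isProbabilityMeasure_map (h 0).measurable.aemeasurable
  have htop : l B ≠ ⊤ := measure_ne_top _ _
  set μ := ∫⁻ x, y x ∂l with hμ
  set c := μ / l B with hc
  have hcfin : c ≠ ⊤ := ENNReal.div_ne_top hfin hpos
  have hcμ : ∀ x : ℝ≥0∞, x * l B * c = x * μ := fun x => by
    rw [mul_assoc, hc, ENNReal.mul_div_cancel hpos htop]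
  have hm : ∀ K n, Measurable fun ω => early N B K n ω * y (N n ω) := fun K n =>
    (measurable_early hmono h hB K n).mul (hy.comp (h n).measurable)
  -- The expected number of collected rewards is at most `(K + 1) / l B`.
  have upper : ∀ K, ∫⁻ ω, S K ω ∂P ≤ (∫⁻ ω, S₀ ω ∂P) + (K + 1) * c := by
    intro K
    refine (lintegral_mono_ae (hle K)).trans ?_
    rw [lintegral_add_left hS₀, lintegral_tsum fun n => (hm K n).aemeasurable]
    simp only [lintegral_early_mul hmono h hB K _ hy]
    rw [ENNReal.tsum_mul_right, ← hcμ]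
    gcongr
    exact (tsum_early_bounds hmono h hB hpos K).2
  -- The comparison from below omits the reward with index 0, whose mean is at most `μ`.
  have lower : ∀ K : ℕ, K * c ≤ (∫⁻ ω, S (K + 2) ω ∂P) + μ := by
    intro K
    calc K * c ≤ (∑' n, ∫⁻ ω, early N B K n ω ∂P) * l B * c := by
          gcongr; exact (tsum_early_bounds hmono h hB hpos K).1
      _ = (∑' n, (∫⁻ ω, early N B K (n + 1) ω ∂P) * μ) + (∫⁻ ω, early N B K 0 ω ∂P) * μ := by
          rw [hcμ, tsum_eq_zero_add' ENNReal.summable, add_comm, add_mul, ENNReal.tsum_mul_right]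
      _ ≤ (∫⁻ ω, S (K + 2) ω ∂P) + 1 * μ := by
          refine add_le_add ?_ ?_
          · simp only [hμ, ← lintegral_early_mul hmono h hB K _ hy]
            rw [← lintegral_tsum fun n => (hm K (n + 1)).aemeasurable]
            exact lintegral_mono_ae (hge K)
          · gcongr
            calc ∫⁻ ω, early N B K 0 ω ∂P ≤ ∫⁻ _, 1 ∂P := lintegral_mono fun ω => by
                  rw [early_apply]; split_ifs <;> simp
              _ = 1 := by simp
      _ = _ := by rw [one_mul]
  have hSfin : ∀ K, ∫⁻ ω, S K ω ∂P ≠ ⊤ := fun K =>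
    ne_top_of_le_ne_top (ENNReal.add_ne_top.2 ⟨hS₀', ENNReal.mul_ne_top (by simp) hcfin⟩) (upper K)
  have hreal : Tendsto (fun K : ℕ => (∫⁻ ω, S K ω ∂P).toReal / K) atTop (𝓝 c.toReal) := by
    have u : Tendsto (fun K : ℕ => ((∫⁻ ω, S₀ ω ∂P).toReal + c.toReal) / (K : ℝ) + c.toReal) atTop
        (𝓝 c.toReal) := by
      simpa using (tendsto_const_div_atTop_nhds_zero_nat
        ((∫⁻ ω, S₀ ω ∂P).toReal + c.toReal)).add_const c.toReal
    have v : Tendsto (fun K : ℕ => c.toReal - (2 * c.toReal + μ.toReal) / (K : ℝ)) atTop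
        (𝓝 c.toReal) := by
      simpa using (tendsto_const_div_atTop_nhds_zero_nat (2 * c.toReal + μ.toReal)).const_sub c.toReal
    refine tendsto_of_tendsto_of_tendsto_of_le_of_le' v u ?_ ?_
    · filter_upwards [eventually_ge_atTop 2] with K hK
      obtain ⟨k, rfl⟩ := Nat.exists_eq_add_of_le' hK
      have h1 := ENNReal.toReal_mono (ENNReal.add_ne_top.2 ⟨hSfin _, hfin⟩) (lower k)
      rw [ENNReal.toReal_mul, ENNReal.toReal_natCast, ENNReal.toReal_add (hSfin _) hfin] at h1
      have hK' : (0 : ℝ) < ((k + 2 : ℕ) : ℝ) := by positivity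
      rw [sub_le_iff_le_add, ← add_div, le_div_iff₀ hK']
      push_cast
      linarith
    · filter_upwards [eventually_gt_atTop 0] with K hK
      have h1 := ENNReal.toReal_mono (ENNReal.add_ne_top.2
        ⟨hS₀', ENNReal.mul_ne_top (by simp) hcfin⟩) (upper K)
      rw [ENNReal.toReal_add hS₀' (ENNReal.mul_ne_top (by simp) hcfin), ENNReal.toReal_mul,
        show ((K : ℝ≥0∞) + 1) = ((K + 1 : ℕ) : ℝ≥0∞) by simp, ENNReal.toReal_natCast] at h1
      have hK' : (0 : ℝ) < (K : ℝ) := by positivity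
      rw [div_le_iff₀ hK', add_mul, div_mul_cancel₀ _ hK'.ne']
      push_cast at h1
      linarith
  rw [← ENNReal.ofReal_toReal hcfin]
  refine (ENNReal.tendsto_ofReal hreal).congr' ?_
  filter_upwards [eventually_gt_atTop 0] with K hK
  rw [← ENNReal.toReal_natCast, ← ENNReal.toReal_div, ENNReal.ofReal_toReal]
  exact ENNReal.div_ne_top (hSfin K) (by positivity)

end Renewal

/-! ### Mean peak ages under decisions independent of the past -/

section PeakAge
variable {Ω : Type*} {mΩ : MeasurableSpace Ω} {P : Measure Ω} {M : ℕ} {srv : Server} {ν : Noise Ω}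
  {ξ : Scheduler Ω M} {Z : Sampler Ω} {m : Fin M}

/-- Infinitely many deliveries rule out the default value `∞` of the peak age. -/
theorem meanPeakAge_eq (hT : ∀ i, Measurable (ν.T i)) (hC : ∀ i, Measurable (ν.C i))
    (hZm : ∀ i, Measurable (Z i)) (hξ : ∀ i, Measurable (ξ (i + 1)))
    (hZ : ∀ᵐ ω ∂P, ∀ n, 0 ≤ Z n ω) (hA : ∀ᵐ ω ∂P, ∀ n, 0 ≤ sysTime srv ν Z n ω)
    (h : ∀ᵐ ω ∂P, Tendsto (recvCount srv ν ξ Z m ω) atTop atTop) (K : ℕ) :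
    meanPeakAge srv ν P ξ Z m K =
      (∫⁻ ω, ∑ k ∈ Finset.range K, countedPeak srv ν ξ Z m k ω ∂P) / K := by
  rw [meanPeakAge, lintegral_finsetSum _ fun k _ => measurable_countedPeak hT hC hZm hξ m k]
  congr 1
  have e : Finset.Icc 1 K = Finset.Ico 1 (K + 1) := by
    ext i; simp only [Finset.mem_Icc, Finset.mem_Ico]; omega
  rw [e, Finset.sum_Ico_eq_sum_range]
  refine Finset.sum_congr rfl fun k _ => lintegral_congr_ae ?_
  filter_upwards [hZ, hA, h] with ω h1 h2 h3
  rw [add_comm 1 k]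
  exact peakAge_eq_of_tendsto h1 h2 k h3

open Classical in
theorem sum_countedPeak (ω : Ω) (K : ℕ) :
    ∑ k ∈ Finset.range K, countedPeak srv ν ξ Z m k ω =
      (∑' i, if recvCount srv ν ξ Z m ω i < K then ENNReal.ofReal (Z i ω) else 0) +
      ∑' i, if recvCount srv ν ξ Z m ω i - 1 < K then recvSys srv ν ξ Z ω m i else 0 := by
  have := tsum_mul_countedPeak (srv := srv) (ν := ν) (ξ := ξ) (Z := Z) (m := m) (ω := ω)
    fun k => if k < K then 1 else 0
  have e : ∑ k ∈ Finset.range K, countedPeak srv ν ξ Z m k ω =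
      ∑' k, (if k < K then 1 else 0) * countedPeak srv ν ξ Z m k ω := by
    rw [tsum_eq_sum (s := Finset.range K) fun k hk => by
      rw [if_neg (by simpa using hk), zero_mul]]
    exact Finset.sum_congr rfl fun k hk => by rw [if_pos (Finset.mem_range.1 hk), one_mul]
  rw [e, this]
  congr 1 <;> refine tsum_congr fun i => ?_
  · split_ifs <;> simp
  · unfold recvSys
    split_ifs <;> simp

end PeakAge

section FreshPolicy
variable {Ω 𝒩 : Type*} {N : ℕ → Ω → 𝒩} {B : Set 𝒩} {M : ℕ} {srv : Server} {ν : Noise Ω}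
  {ξ : Scheduler Ω M} {Z : Sampler Ω} {m : Fin M}

theorem recvCount_eq_visits {ω : Ω} (h : ∀ n, ReceivedFrom srv ν ξ Z m ω (n + 1) ↔ N n ω ∈ B)
    (n : ℕ) : recvCount srv ν ξ Z m ω n = visits N B n ω := by
  classical
  induction n with
  | zero => simp [recvCount_zero, visits]
  | succ n ih => rw [recvCount_succ, visits_succ, ih]; simp only [h]

variable [MeasurableSpace 𝒩] {ℋ : ℕ → MeasurableSpace Ω} {mΩ : MeasurableSpace Ω}
  {P : Measure Ω} {l : Measure 𝒩}

theorem ae_tendsto_frequency [IsProbabilityMeasure P] (hmono : Monotone ℋ)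
    (hN : ∀ n, IsFresh (ℋ n) (ℋ (n + 2)) P (N n) l) (hB : MeasurableSet B)
    (h : ∀ᵐ ω ∂P, ∀ n, ReceivedFrom srv ν ξ Z m ω (n + 1) ↔ N n ω ∈ B) :
    ∀ᵐ ω ∂P, Tendsto (fun n : ℕ => (recvCount srv ν ξ Z m ω n : ℝ) / n) atTop
      (𝓝 (l B).toReal) := by
  filter_upwards [h, ae_tendsto_visits hmono hN hB] with ω h1 h2
  simpa only [recvCount_eq_visits h1] using h2

/-- The first `K` peak ages collect the inter-generation and system times of packets up to the
`K`-th delivery, up to bounded shifts of the stopping index. The lower inequality is required only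
from packet 2 on, because packet 1 follows the special packet 0. -/
theorem tendsto_meanPeakAge_of_fresh [IsProbabilityMeasure P]
    (hT : ∀ i, Measurable (ν.T i)) (hC : ∀ i, Measurable (ν.C i))
    (hZm : ∀ i, Measurable (Z i)) (hξ : ∀ i, Measurable (ξ (i + 1)))
    (hZ : ∀ᵐ ω ∂P, ∀ n, 0 ≤ Z n ω) (hA : ∀ᵐ ω ∂P, ∀ n, 0 ≤ sysTime srv ν Z n ω)
    (hmono : Monotone ℋ) (hN : ∀ n, IsFresh (ℋ n) (ℋ (n + 2)) P (N n) l) (hB : MeasurableSet B)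
    (hpos : l B ≠ 0) {y : 𝒩 → ℝ≥0∞} (hy : Measurable y) (hfin : ∫⁻ x, y x ∂l ≠ ⊤)
    (hZ0 : ∫⁻ ω, ENNReal.ofReal (Z 0 ω) ∂P ≠ ⊤)
    (hrecv : ∀ᵐ ω ∂P, ∀ n, ReceivedFrom srv ν ξ Z m ω (n + 1) ↔ N n ω ∈ B)
    (hle : ∀ᵐ ω ∂P, ∀ n, ENNReal.ofReal (Z (n + 1) ω) + recvSys srv ν ξ Z ω m (n + 1) ≤ y (N n ω))
    (hge : ∀ᵐ ω ∂P, ∀ n, y (N (n + 1) ω) ≤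
      ENNReal.ofReal (Z (n + 2) ω) + recvSys srv ν ξ Z ω m (n + 2)) :
    Tendsto (fun K : ℕ => meanPeakAge srv ν P ξ Z m K) atTop (𝓝 ((∫⁻ x, y x ∂l) / l B)) := by
  classical
  have hl : IsProbabilityMeasure l :=
    (hN 0).map ▸ Measure.isProbabilityMeasure_map (hN 0).measurable.aemeasurable
  have hinf : ∀ᵐ ω ∂P, Tendsto (recvCount srv ν ξ Z m ω) atTop atTop := by
    filter_upwards [ae_tendsto_frequency hmono hN hB hrecv] with ω hω
    exact tendsto_atTop_of_average (ENNReal.toReal_pos hpos (measure_ne_top _ _)) hω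
  simp only [meanPeakAge_eq hT hC hZm hξ hZ hA hinf]
  refine tendsto_lintegral_div hmono hN hB hpos hy hfin (S₀ := fun ω => ENNReal.ofReal (Z 0 ω))
    (hZm 0).ennreal_ofReal hZ0 (fun K => ?_) (fun K => ?_)
  · filter_upwards [hrecv, hle] with ω h1 h2
    have hc := recvCount_eq_visits h1
    rw [sum_countedPeak, tsum_eq_zero_add' ENNReal.summable, tsum_eq_zero_add' (f := fun i =>
      if recvCount srv ν ξ Z m ω i - 1 < K then recvSys srv ν ξ Z ω m i else 0) ENNReal.summable]
    have h0 : recvSys srv ν ξ Z ω m 0 = 0 := recvSys_of_not_received fun h => by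
      have := h.1; omega
    rw [h0, ite_self, zero_add, add_assoc, ← ENNReal.tsum_add]
    refine add_le_add ?_ (ENNReal.tsum_le_tsum fun n => ?_)
    · split_ifs <;> simp
    · refine le_trans ?_ (mul_le_mul_of_nonneg_left (h2 n) zero_le)
      rw [early_apply, mul_add, ite_mul, ite_mul, one_mul, zero_mul, one_mul, zero_mul]
      have hv := visits_mono (N := N) (B := B) ω (show n - 1 ≤ n + 1 by omega)
      have hv' := visits_mono (N := N) (B := B) ω (show n - 1 ≤ n by omega)
      simp only at hv hv'
      simp only [hc]
      refine add_le_add ?_ ?_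
      · split_ifs with a b
        · exact le_rfl
        · omega
        · exact zero_le
        · exact zero_le
      · by_cases hr : ReceivedFrom srv ν ξ Z m ω (n + 1)
        · have := visits_succ (N := N) (B := B) n ω
          rw [if_pos ((h1 n).1 hr)] at this
          split_ifs with a b
          · exact le_rfl
          · omega
          · exact zero_le
          · exact zero_le
        · rw [recvSys_of_not_received hr]; simp
  · filter_upwards [hrecv, hge] with ω h1 h2
    have hc := recvCount_eq_visits h1
    rw [sum_countedPeak]
    refine le_trans ?_ (add_le_add
      (ENNReal.tsum_comp_le_tsum_of_injective (add_left_injective 2) _)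
      (ENNReal.tsum_comp_le_tsum_of_injective (add_left_injective 2) _))
    rw [← ENNReal.tsum_add]
    refine ENNReal.tsum_le_tsum fun n => ?_
    refine (mul_le_mul_of_nonneg_left (h2 n) zero_le).trans ?_
    rw [early_apply, Nat.add_sub_cancel]
    have e1 := visits_succ_le (N := N) (B := B) n ω
    have e2 : visits N B (n + 2) ω ≤ visits N B (n + 1) ω + 1 := visits_succ_le (n + 1) ω
    simp only [hc]
    -- Two more packets add at most two deliveries, whence `K + 2` on the right.
    by_cases h : visits N B n ω < K
    · rw [if_pos h, one_mul, if_pos (by omega), if_pos (by omega)]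
    · rw [if_neg h, zero_mul]; exact zero_le

end FreshPolicy

/-! ### Samplers defined by thresholds -/

section ThresholdSampler
variable {Ω : Type*}

/-- Computation time of packet `i` that the sampler waits for under the thresholds `Θ`; all of it
for packet `0`. -/
def elapsed (ν : Noise Ω) (Θ : ℕ → Ω → ℝ≥0∞) : ℕ → Ω → ℝ
  | 0, ω => ν.C 0 ω
  | i + 1, ω => (min (Θ (i + 1) ω) (ENNReal.ofReal (ν.C (i + 1) ω))).toReal

/-- Waiting times under the thresholds `Θ`. -/
def queueing (srv : Server) (ν : Noise Ω) (Θ : ℕ → Ω → ℝ≥0∞) : ℕ → Ω → ℝ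
  | 0, _ => 0
  | i + 1, ω =>
    match srv with
    | .nonpreemptive => max 0 (ν.C i ω - elapsed ν Θ i ω - ν.T (i + 1) ω)
    | .preemptive => 0

/-- The sampler that generates the next packet at the planned time or when the computation ends. -/
def thresholdSampler (srv : Server) (ν : Noise Ω) (Θ : ℕ → Ω → ℝ≥0∞) : Sampler Ω := fun i ω =>
  ν.T i ω + queueing srv ν Θ i ω + elapsed ν Θ i ω

variable {srv : Server} {ν : Noise Ω} {Θ : ℕ → Ω → ℝ≥0∞}

/-- The sampler absorbs the current `T + W` into `Z`, so these terms cancel in the recursion and a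
wait depends only on the preceding stage. -/
theorem waiting_thresholdSampler (i : ℕ) (ω : Ω) :
    waiting srv ν (thresholdSampler srv ν Θ) i ω = queueing srv ν Θ i ω := by
  induction i with
  | zero => rfl
  | succ i ih =>
    cases srv
    · change max 0 (ν.T i ω + waiting .nonpreemptive ν _ i ω + ν.C i ω -
        (ν.T i ω + queueing .nonpreemptive ν Θ i ω + elapsed ν Θ i ω) - ν.T (i + 1) ω) =
        max 0 (ν.C i ω - elapsed ν Θ i ω - ν.T (i + 1) ω)
      rw [ih]
      congr 1; ring
    · rfl

theorem elapsed_nonneg {ω : Ω} (h0 : 0 < ν.C 0 ω) (i : ℕ) : 0 ≤ elapsed ν Θ i ω := by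
  cases i with
  | zero => exact h0.le
  | succ i => exact ENNReal.toReal_nonneg

theorem measurable_elapsed (hΘ : ∀ i, Measurable[ν.sampInfo i] (Θ i)) (i : ℕ) :
    Measurable[ν.doneInfo i] (elapsed ν Θ i) := by
  have hC := ν.measurable_C_doneInfo i
  have hΘ' : Measurable[ν.doneInfo i] (Θ i) := (hΘ i).mono le_sup_left le_rfl
  cases i with
  | zero => exact hC
  | succ i => exact (hΘ'.min hC.ennreal_ofReal).ennreal_toReal

theorem measurable_queueing (hΘ : ∀ i, Measurable[ν.sampInfo i] (Θ i)) (i : ℕ) :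
    Measurable[ν.history i] (queueing srv ν Θ i) := by
  cases i with
  | zero => exact measurable_const
  | succ i =>
    cases srv
    · exact measurable_const.max (((ν.measurable_C_history (Nat.lt_succ_self i)).sub
        ((measurable_elapsed hΘ i).mono (ν.doneInfo_le_history i) le_rfl)).sub
        (ν.measurable_T_history le_rfl))
    · exact measurable_const

theorem ofReal_thresholdSampler {ω : Ω} (hT : ∀ i, 0 < ν.T i ω) (i : ℕ) :
    ENNReal.ofReal (thresholdSampler srv ν Θ (i + 1) ω) = ENNReal.ofReal (ν.T (i + 1) ω) +
      ENNReal.ofReal (waiting srv ν (thresholdSampler srv ν Θ) (i + 1) ω) +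
      min (Θ (i + 1) ω) (ENNReal.ofReal (ν.C (i + 1) ω)) := by
  have hW := waiting_nonneg srv ν (thresholdSampler srv ν Θ) (i + 1) ω
  have hW' := hW
  rw [waiting_thresholdSampler] at hW'
  rw [waiting_thresholdSampler, thresholdSampler, elapsed,
    ENNReal.ofReal_add (add_nonneg (hT _).le hW') ENNReal.toReal_nonneg,
    ENNReal.ofReal_add (hT _).le hW', ENNReal.ofReal_toReal]
  exact ne_top_of_le_ne_top ENNReal.ofReal_ne_top (min_le_right _ _)

variable [MeasurableSpace Ω] {P : Measure Ω} {μT μC : Measure ℝ}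

theorem causalSampler_thresholdSampler (hν : ν.IsModel P μT μC) (hC : IsTimeLaw μC)
    (hΘ : ∀ i, Measurable[ν.sampInfo i] (Θ i)) :
    CausalSampler srv ν P (thresholdSampler srv ν Θ) := by
  have hle : ∀ i, ν.history i ≤ ν.doneInfo i := fun i =>
    (ν.history_le_sampInfo i).trans le_sup_left
  refine ⟨fun i => ?_, ae_of_all _ fun ω => ?_, fun i => ?_, Θ, hΘ, fun i hi => ?_⟩
  · exact (((ν.measurable_T_history le_rfl).mono (hle i) le_rfl).add
      ((measurable_queueing hΘ i).mono (hle i) le_rfl)).add (measurable_elapsed hΘ i)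
  · simp [thresholdSampler, queueing, elapsed]
  · filter_upwards [hν.ae_C_pos hC] with ω hω
    have := elapsed_nonneg (Θ := Θ) (hω 0) i
    rw [waiting_thresholdSampler, thresholdSampler]
    linarith
  · obtain ⟨i, rfl⟩ := Nat.exists_eq_add_of_le' hi
    filter_upwards [hν.ae_C_pos hC] with ω hω
    rw [waiting_thresholdSampler, thresholdSampler, elapsed]
    refine ⟨fun h => by rw [min_eq_left h.le], fun h => ?_⟩
    rw [min_eq_right h, ENNReal.toReal_ofReal (hω _).le]

theorem ae_followsThreshold (hν : ν.IsModel P μT μC) (hT : IsTimeLaw μT) (hC : IsTimeLaw μC) :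
    ∀ᵐ ω ∂P, ∀ i, 1 ≤ i → FollowsThreshold srv ν (thresholdSampler srv ν Θ) (Θ i ω) ω i := by
  filter_upwards [hν.ae_T_pos hT, hν.ae_C_pos hC] with ω h2 h3 i hi
  obtain ⟨i, rfl⟩ := Nat.exists_eq_add_of_le' hi
  refine followsThreshold h2 (h3 _) (fun h => ?_) fun h => ?_
  · rw [waiting_thresholdSampler, thresholdSampler, elapsed, min_eq_left h.le]
  · rw [waiting_thresholdSampler, thresholdSampler, elapsed, min_eq_right h,
      ENNReal.toReal_ofReal (h3 _).le]

theorem IsTimeLaw.lintegral_ne_top {μ : Measure ℝ} (h : IsTimeLaw μ) :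
    ∫⁻ t, ENNReal.ofReal t ∂μ ≠ ⊤ := by
  rw [← ofReal_integral_eq_lintegral_ofReal h.integrable (h.pos.mono fun t ht => ht.le)]
  exact ENNReal.ofReal_ne_top

theorem lintegral_thresholdSampler_zero (hν : ν.IsModel P μT μC) (hT : IsTimeLaw μT)
    (hC : IsTimeLaw μC) : ∫⁻ ω, ENNReal.ofReal (thresholdSampler srv ν Θ 0 ω) ∂P ≠ ⊤ := by
  have hc : ∫⁻ ω, ENNReal.ofReal (ν.C 0 ω) ∂P = ∫⁻ t, ENNReal.ofReal t ∂μC := by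
    rw [← hν.law_C 0, lintegral_map (by fun_prop) (hν.meas_C 0)]
  have ht : ∫⁻ ω, ENNReal.ofReal (ν.T 0 ω) ∂P = ∫⁻ t, ENNReal.ofReal t ∂μT := by
    rw [← hν.law_T 0, lintegral_map (by fun_prop) (hν.meas_T 0)]
  refine ne_top_of_le_ne_top (ENNReal.add_ne_top.2 ⟨hT.lintegral_ne_top, hC.lintegral_ne_top⟩) ?_
  rw [← ht, ← hc, ← lintegral_add_left (hν.meas_T 0).ennreal_ofReal]
  refine lintegral_mono fun ω => ?_
  simp only [thresholdSampler, queueing, elapsed, add_zero]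
  exact ENNReal.ofReal_add_le

end ThresholdSampler

/-! ### Randomised decisions with a prescribed law -/

section FreshDecisions
variable {Ω : Type*} {ν : Noise Ω} {M : ℕ} {ξ : Scheduler Ω M}

theorem isFresh_const (𝒢 : MeasurableSpace Ω) {mΩ : MeasurableSpace Ω} {P : Measure Ω}
    [IsProbabilityMeasure P] (h : 𝒢 ≤ mΩ) {𝒳 : Type*} [MeasurableSpace 𝒳] (a : 𝒳) :
    IsFresh 𝒢 𝒢 P (fun _ => a) (Measure.dirac a) where
  le := le_rfl
  le_ambient := h
  meas := measurable_const
  indep := by rw [MeasurableSpace.comap_const]; exact indep_bot_right _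
  map := by rw [Measure.map_const, measure_univ, one_smul]

/-- Thresholds drawn from a decision rule `κ`, which sees the source of the packet and the side
information of the server. -/
def ruleThreshold (κ : Fin M × ℝ≥0∞ → ℝ → ℝ≥0∞) (ν : Noise Ω) (ξ : Scheduler Ω M) :
    Server → ℕ → Ω → ℝ≥0∞
  | .nonpreemptive, i, ω => κ (ξ (i + 1) ω, 0) (ν.V i ω)
  | .preemptive, 0, _ => 0
  | .preemptive, i + 1, ω => κ (ξ (i + 1) ω, ENNReal.ofReal (ν.T (i + 1) ω)) (ν.V (i + 1) ω)

theorem measurable_ruleThreshold {κ : Fin M × ℝ≥0∞ → ℝ → ℝ≥0∞}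
    (hκ : Measurable (Function.uncurry κ)) (hξ : CausalScheduler ν ξ) (srv : Server) (i : ℕ) :
    Measurable[ν.sampInfo i] (ruleThreshold κ ν ξ srv i) := by
  cases srv with
  | nonpreemptive =>
    have h1 : Measurable[ν.sampInfo i] (ξ (i + 1)) := (hξ i).mono le_sup_left le_rfl
    exact hκ.comp ((h1.prodMk measurable_const).prodMk (ν.measurable_V_sampInfo i))
  | preemptive =>
    cases i with
    | zero => exact measurable_const
    | succ i =>
      have h1 : Measurable[ν.sampInfo (i + 1)] (ξ (i + 1)) :=
        (hξ i).mono ((ν.schedInfo_le_history i).trans (ν.history_le_sampInfo _)) le_rfl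
      have h2 : Measurable[ν.sampInfo (i + 1)] (ν.T (i + 1)) :=
        (ν.measurable_T_history le_rfl).mono (ν.history_le_sampInfo _) le_rfl
      exact hκ.comp ((h1.prodMk h2.ennreal_ofReal).prodMk (ν.measurable_V_sampInfo _))

variable [MeasurableSpace Ω] {P : Measure Ω} {μT μC : Measure ℝ}

theorem Noise.IsModel.schedInfo_le (hν : ν.IsModel P μT μC) (i : ℕ) :
    ν.schedInfo i ≤ ‹MeasurableSpace Ω› := le_sup_left.trans (hν.sampInfo_le i)

theorem Noise.IsModel.isFresh_V (hν : ν.IsModel P μT μC) (i : ℕ) :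
    IsFresh (ν.schedInfo i) (ν.sampInfo i) P (ν.V i) (volume.restrict (Set.Icc 0 1)) where
  le := le_sup_left
  le_ambient := hν.sampInfo_le i
  meas := ν.measurable_V_sampInfo i
  indep := by
    have hd : Disjoint (pastSet i ∪ {(i, 2)}) ({(i, 3)} : Set (ℕ × Fin 4)) := by
      rw [Set.disjoint_left]
      rintro ⟨j, k⟩ (h | h) <;> simp [pastSet] at * <;> omega
    have := hν.indep_sigma hd
    rw [← ν.schedInfo_eq, ν.sigma_singleton] at this
    exact this
  map := hν.law_V i

theorem Noise.IsModel.isFresh_T (hν : ν.IsModel P μT μC) (i : ℕ) :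
    IsFresh (ν.schedInfo i) (ν.history (i + 1)) P (ν.T (i + 1)) μT where
  le := ν.schedInfo_le_history i
  le_ambient := hν.history_le _
  meas := ν.measurable_T_history le_rfl
  indep := by
    have hd : Disjoint (pastSet i ∪ {(i, 2)}) ({(i + 1, 0)} : Set (ℕ × Fin 4)) := by
      rw [Set.disjoint_left]
      rintro ⟨j, k⟩ (h | h) <;> simp [pastSet] at * <;> omega
    have := hν.indep_sigma hd
    rw [← ν.schedInfo_eq, ν.sigma_singleton] at this
    exact this
  map := hν.law_T _

theorem IsRandomScheduler.isFresh (hν : ν.IsModel P μT μC) {y : Measure (Fin M)}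
    [IsFiniteMeasure y] (h : IsRandomScheduler ν P (fun m => (y {m}).toReal) ξ) (i : ℕ) :
    IsFresh (ν.history i) (ν.schedInfo i) P (ξ (i + 1)) y where
  le := le_sup_left
  le_ambient := hν.schedInfo_le i
  meas := h.1 i
  indep := (h.2.2 i).symm
  map := by
    refine Measure.ext_of_singleton fun m => ?_
    rw [Measure.map_apply (h.1.measurable hν i) (measurableSet_singleton m)]
    have := h.2.1 i m
    rw [ENNReal.ofReal_toReal (measure_ne_top _ _)] at this
    exact this

theorem exists_randomScheduler (hν : ν.IsModel P μT μC) (y : Measure (Fin M))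
    [IsProbabilityMeasure y] :
    ∃ ξ : Scheduler Ω M, IsRandomScheduler ν P (fun m => (y {m}).toReal) ξ := by
  have : Nonempty (Fin M) := by
    by_contra h
    rw [not_nonempty_iff] at h
    have h1 : y Set.univ = 1 := measure_univ
    rw [Set.eq_empty_of_isEmpty Set.univ, measure_empty] at h1
    exact zero_ne_one h1
  obtain ⟨f, hf, hfy⟩ := y.exists_measurable_map_eq
  have hproj : Measurable (Set.projIcc (0 : ℝ) 1 zero_le_one) := continuous_projIcc.measurable
  have hI := map_projIcc_restrict
  set g : ℝ → Fin M := fun u => f (Set.projIcc 0 1 zero_le_one u) with hg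
  have hgm : Measurable g := hf.comp hproj
  have hmap : ∀ i, P.map (fun ω => g (ν.U i ω)) = y := fun i => by
    have : (fun ω => g (ν.U i ω)) = f ∘ (Set.projIcc 0 1 zero_le_one) ∘ ν.U i := rfl
    rw [this, ← Measure.map_map hf (hproj.comp (hν.meas_U i)), ← Measure.map_map hproj (hν.meas_U i),
      hν.law_U, hI, hfy]
  -- The source of packet `i + 1` must be drawn from the seed `U i`, hence the index `i - 1`; the
  -- value at 0 is irrelevant.
  refine ⟨fun i ω => g (ν.U (i - 1) ω), fun i => ?_, fun i m => ?_, fun i => ?_⟩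
  · have : Measurable[ν.schedInfo i] (ν.U i) := by
      rw [ν.schedInfo_eq]
      exact ν.measurable_sigma (x := (i, 2)) (Or.inr rfl)
    exact hgm.comp this
  · have hgi : Measurable fun ω => g (ν.U i ω) := hgm.comp (hν.meas_U i)
    rw [ENNReal.ofReal_toReal (measure_ne_top _ _), ← hmap i,
      Measure.map_apply hgi (measurableSet_singleton m)]
    rfl
  · have hd : Disjoint ({(i, 2)} : Set (ℕ × Fin 4)) (pastSet i) := by
      rw [Set.disjoint_left]
      rintro ⟨j, k⟩ h
      simp [pastSet] at *
      omega
    have h1 := hν.indep_sigma hd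
    rw [← ν.history_eq, ν.sigma_singleton] at h1
    refine indep_of_indep_of_le_left h1 ?_
    rintro s ⟨t, ht, rfl⟩
    exact ⟨g ⁻¹' t, hgm ht, rfl⟩

variable [IsProbabilityMeasure P]

theorem Noise.IsModel.isFresh_C_T (hν : ν.IsModel P μT μC) (i : ℕ) :
    IsFresh (ν.sampInfo i) (ν.history (i + 1)) P (fun ω => (ν.C i ω, ν.T (i + 1) ω))
      (μC.prod μT) where
  le := ν.sampInfo_le_history i
  le_ambient := hν.history_le _
  meas := (ν.measurable_C_history (Nat.lt_succ_self i)).prodMk (ν.measurable_T_history le_rfl)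
  indep := hν.indep_sampInfo i
  map := hν.map_C_T i

variable {κ : Fin M × ℝ≥0∞ → ℝ → ℝ≥0∞} {η : ProbabilityMeasure (Key M)}

/-- The source, the seed and then the noise are revealed successively; the rule `κ` turns source and
seed into a decision of law `η`. -/
theorem isFresh_key_nonpreemptive (hν : ν.IsModel P μT μC)
    (hκ : Measurable (Function.uncurry κ))
    (hlaw : ((((η : Measure (Key M)).map Prod.fst).prod (Measure.dirac (0 : ℝ≥0∞))).prod
      (volume.restrict (Set.Icc (0 : ℝ) 1))).map (fun x => (x.1.1, x.1.2, κ x.1 x.2)) =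
      (η : Measure (Key M)))
    (h : IsRandomScheduler ν P (fun m => ((η : Measure (Key M)).map Prod.fst {m}).toReal) ξ)
    (i : ℕ) :
    IsFresh (ν.history i) (ν.history (i + 1)) P
      (fun ω => ((ξ (i + 1) ω, (0 : ℝ≥0∞), ruleThreshold κ ν ξ .nonpreemptive i ω),
        (ν.C i ω, ν.T (i + 1) ω))) ((η : Measure (Key M)).prod (μC.prod μT)) := by
  have h1 := ((h.isFresh hν i).pair (isFresh_const _ (hν.schedInfo_le i) (0 : ℝ≥0∞))).pair
    (hν.isFresh_V i)
  have hm : Measurable fun x : (Fin M × ℝ≥0∞) × ℝ => (x.1.1, x.1.2, κ x.1 x.2) :=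
    (measurable_fst.comp measurable_fst).prodMk ((measurable_snd.comp measurable_fst).prodMk hκ)
  have h2 := h1.comp hm
  rw [hlaw] at h2
  exact h2.pair (hν.isFresh_C_T i)

/-- The transmission time is revealed between the source and the seed, so the stage extends over two
steps. Consecutive stages share a transmission time, which is noise for one and side information for
the next. -/
theorem isFresh_key_preemptive (hν : ν.IsModel P μT μC)
    (hκ : Measurable (Function.uncurry κ))
    (hlaw : ((((η : Measure (Key M)).map Prod.fst).prod (μT.map ENNReal.ofReal)).prod
      (volume.restrict (Set.Icc (0 : ℝ) 1))).map (fun x => (x.1.1, x.1.2, κ x.1 x.2)) =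
      (η : Measure (Key M)))
    (h : IsRandomScheduler ν P (fun m => ((η : Measure (Key M)).map Prod.fst {m}).toReal) ξ)
    (i : ℕ) :
    IsFresh (ν.history i) (ν.history (i + 2)) P
      (fun ω => ((ξ (i + 1) ω, ENNReal.ofReal (ν.T (i + 1) ω),
        ruleThreshold κ ν ξ .preemptive (i + 1) ω),
        (ν.C (i + 1) ω, ν.T (i + 2) ω))) ((η : Measure (Key M)).prod (μC.prod μT)) := by
  have h1 := ((h.isFresh hν i).pair (((hν.isFresh_T i).comp ENNReal.measurable_ofReal).mono le_rfl
    le_sup_left (hν.schedInfo_le (i + 1)))).pair (hν.isFresh_V (i + 1))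
  have hm : Measurable fun x : (Fin M × ℝ≥0∞) × ℝ => (x.1.1, x.1.2, κ x.1 x.2) :=
    (measurable_fst.comp measurable_fst).prodMk ((measurable_snd.comp measurable_fst).prodMk hκ)
  have h2 := h1.comp hm
  rw [hlaw] at h2
  exact h2.pair (hν.isFresh_C_T (i + 1))

end FreshDecisions

/-! ### Mean rewards of a stage -/

section Rewards
variable {M : ℕ} {μT μC : Measure ℝ}

theorem exists_le_lvl {a : ℝ≥0∞} (h : a ≠ ⊤) : ∃ K : ℕ, a ≤ lvl K := by
  obtain ⟨K, hK⟩ := ENNReal.exists_nat_gt h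
  exact ⟨K, hK.le.trans le_self_add⟩

theorem lvl_mono : Monotone lvl := fun a b h => by unfold lvl; gcongr

theorem transG_mono (θ : ℝ≥0∞) (n : ℝ × ℝ) : Monotone fun K => transG K θ n := fun _ _ h =>
  min_le_min_left _ (lvl_mono h)

theorem compG_mono (θ : ℝ≥0∞) (n : ℝ × ℝ) : Monotone fun K => compG K θ n := fun _ _ h =>
  min_le_min_left _ (lvl_mono h)

theorem runG_mono (θ : ℝ≥0∞) (n : ℝ × ℝ) : Monotone fun K => runG K θ n := fun _ _ h =>
  min_le_min_left _ (min_le_min_left _ (lvl_mono h))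

theorem waitG_mono (θ : ℝ≥0∞) (n : ℝ × ℝ) : Monotone fun K => waitG K θ n := fun _ _ h =>
  tsub_le_tsub_right (tsub_le_tsub_right (min_le_min_left _ (lvl_mono h)) _) _

theorem coe_gainFn_nonpre [IsProbabilityMeasure μT] [IsProbabilityMeasure μC] (hT : IsTimeLaw μT)
    (hC : IsTimeLaw μC) (K : ℕ) (m : Fin M) (x : Key M) :
    ((nonpreData hT hC).gainFn K m x : ℝ≥0∞) =
      (∫⁻ n, transG K x.2.2 n ∂(μC.prod μT)) + ((∫⁻ n, runG K x.2.2 n ∂(μC.prod μT)) +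
        ∫⁻ n, waitG K x.2.2 n ∂(μC.prod μT)) + srcOne m x.1 *
      ((∫⁻ n, transG K x.2.2 n ∂(μC.prod μT)) + (∫⁻ n, waitG K x.2.2 n ∂(μC.prod μT)) +
        ∫⁻ n, compG K x.2.2 n ∂(μC.prod μT)) := by
  simp only [← coe_meanMap (μC.prod μT) (isRegular_transG (lN := μC.prod μT) K),
    ← coe_meanMap (μC.prod μT) (isRegular_runG (lN := μC.prod μT) K),
    ← coe_meanMap (μC.prod μT) (isRegular_waitG (lN := μC.prod μT) K),
    ← coe_meanMap (μC.prod μT) (isRegular_compG (lN := μC.prod μT) K), ← coe_srcInd,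
    ← ENNReal.coe_add, ← ENNReal.coe_mul]
  rfl

theorem coe_gainFn_pre [IsProbabilityMeasure μT] [IsProbabilityMeasure μC] (hT : IsTimeLaw μT)
    (hC : IsTimeLaw μC) (K : ℕ) (m : Fin M) (x : Key M) :
    ((preData hT hC).gainFn K m x : ℝ≥0∞) =
      (∫⁻ n, transG K x.2.2 n ∂(μC.prod μT)) + (∫⁻ n, runG K x.2.2 n ∂(μC.prod μT)) +
      srcOne m x.1 * (min x.2.1 (lvl K) * (∫⁻ n, recvG x.2.2 n ∂(μC.prod μT)) +
        ∫⁻ n, compG K x.2.2 n * recvG x.2.2 n ∂(μC.prod μT)) := by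
  simp only [← coe_meanMap (μC.prod μT) (isRegular_transG (lN := μC.prod μT) K),
    ← coe_meanMap (μC.prod μT) (isRegular_runG (lN := μC.prod μT) K),
    ← coe_meanMap (μC.prod μT) (isRegular_recvG (μC := μC) hT),
    ← coe_meanMap (μC.prod μT) (isRegular_recvG_mul (μC := μC) hT K), ← coe_srcInd,
    ← ENNReal.coe_add, ← ENNReal.coe_mul, ← coe_truncMap]
  rfl

/-- Source, side information, threshold, and the noise that the decision meets. -/
abbrev Stage (M : ℕ) := Key M × (ℝ × ℝ)

/-- Inter-generation time plus, for source `m`, system time of a packet under the non-preemptive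
server, in terms of two consecutive stages; truncated at level `K`. -/
def nonpreReward (m : Fin M) (K : ℕ) (p : Stage M × Stage M) : ℝ≥0∞ :=
  (transG K p.1.1.2.2 p.1.2 + waitG K p.1.1.2.2 p.1.2 +
    srcOne m p.1.1.1 * (transG K p.1.1.2.2 p.1.2 + waitG K p.1.1.2.2 p.1.2)) +
  (runG K p.2.1.2.2 p.2.2 + srcOne m p.1.1.1 * compG K p.2.1.2.2 p.2.2)

/-- Inter-generation time plus, for a delivery of source `m`, system time of a packet under the
preemptive server; truncated at level `K`. -/
def preReward (m : Fin M) (K : ℕ) (p : Stage M) : ℝ≥0∞ :=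
  min p.1.2.1 (lvl K) + (runG K p.1.2.2 p.2 + srcOne m p.1.1 *
    (min p.1.2.1 (lvl K) * recvG p.1.2.2 p.2 + compG K p.1.2.2 p.2 * recvG p.1.2.2 p.2))

theorem nonpreReward_mono (m : Fin M) : Monotone (nonpreReward m) := by
  intro K L h p
  have h1 := transG_mono p.1.1.2.2 p.1.2 h
  have h2 := waitG_mono p.1.1.2.2 p.1.2 h
  have h3 := runG_mono p.2.1.2.2 p.2.2 h
  have h4 := compG_mono p.2.1.2.2 p.2.2 h
  simp only at h1 h2 h3 h4
  unfold nonpreReward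
  gcongr

theorem preReward_mono (m : Fin M) : Monotone (preReward m) := by
  intro K L h p
  have h3 := runG_mono p.1.2.2 p.2 h
  have h4 := compG_mono p.1.2.2 p.2 h
  have h5 := lvl_mono h
  simp only at h3 h4
  unfold preReward
  gcongr

theorem measurable_stage {G : ℝ≥0∞ → ℝ × ℝ → ℝ≥0∞} (h : Measurable (Function.uncurry G)) :
    Measurable fun p : Stage M => G p.1.2.2 p.2 :=
  h.comp (by fun_prop : Measurable fun p : Stage M => (p.1.2.2, p.2))

theorem measurable_srcOne_stage (m : Fin M) : Measurable fun p : Stage M => srcOne m p.1.1 :=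
  (measurable_srcOne m).comp (measurable_fst.comp measurable_fst)

theorem measurable_nonpreReward (m : Fin M) (K : ℕ) : Measurable (nonpreReward m K) := by
  have hT := measurable_stage (M := M) (isRegular_transG (lN := 0) K).meas
  have hR := measurable_stage (M := M) (isRegular_runG (lN := 0) K).meas
  have hW := measurable_stage (M := M) (isRegular_waitG (lN := 0) K).meas
  have hC := measurable_stage (M := M) (isRegular_compG (lN := 0) K).meas
  have hs := measurable_srcOne_stage m
  exact (((hT.add hW).add (hs.mul (hT.add hW))).comp measurable_fst).add
    ((hR.comp measurable_snd).add ((hs.comp measurable_fst).mul (hC.comp measurable_snd)))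

theorem measurable_preReward (m : Fin M) (K : ℕ) : Measurable (preReward m K) := by
  have hR := measurable_stage (M := M) (isRegular_runG (lN := 0) K).meas
  have hC := measurable_stage (M := M) (isRegular_compG (lN := 0) K).meas
  have hD := measurable_stage (M := M) measurable_recvG
  have hs := measurable_srcOne_stage m
  have ht : Measurable fun p : Stage M => min p.1.2.1 (lvl K) := by fun_prop
  exact ht.add (hR.add (hs.mul ((ht.mul hD).add (hC.mul hD))))

/-- A packet involves two consecutive stages: transmission and wait come from the first, computation
from the second. The stages are independent with equal law, so the mean of the sum equals a gain
computed from one decision law. -/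
theorem lintegral_nonpreReward (hT : IsTimeLaw μT) (hC : IsTimeLaw μC)
    (η : ProbabilityMeasure (Key M)) (m : Fin M) (K : ℕ) :
    ∫⁻ p, nonpreReward m K p ∂(((η : Measure (Key M)).prod (μC.prod μT)).prod
      ((η : Measure (Key M)).prod (μC.prod μT))) =
    ∫⁻ x, (nonpreData hT hC).gainFn K m x ∂(η : Measure (Key M)) := by
  have := hT.isProbability
  have := hC.isProbability
  have hmT := measurable_stage (M := M) (isRegular_transG (lN := 0) K).meas
  have hmR := measurable_stage (M := M) (isRegular_runG (lN := 0) K).meas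
  have hmW := measurable_stage (M := M) (isRegular_waitG (lN := 0) K).meas
  have hmC := measurable_stage (M := M) (isRegular_compG (lN := 0) K).meas
  have hs := measurable_srcOne_stage m
  set Λ := (η : Measure (Key M)).prod (μC.prod μT) with hΛ
  have hA : Measurable fun p : Stage M => transG K p.1.2.2 p.2 + waitG K p.1.2.2 p.2 +
    srcOne m p.1.1 * (transG K p.1.2.2 p.2 + waitG K p.1.2.2 p.2) :=
    (hmT.add hmW).add (hs.mul (hmT.add hmW))
  have hpush : ∀ {G : ℝ≥0∞ → ℝ × ℝ → ℝ≥0∞}, Measurable (Function.uncurry G) →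
      Measurable fun x : Key M => ∫⁻ n, G x.2.2 n ∂(μC.prod μT) := fun {G} hG =>
    (hG.lintegral_prod_right').comp (by fun_prop : Measurable fun x : Key M => x.2.2)
  have kT := hpush (isRegular_transG (lN := 0) K).meas
  have kR := hpush (isRegular_runG (lN := 0) K).meas
  have kW := hpush (isRegular_waitG (lN := 0) K).meas
  have ks : Measurable fun x : Key M => srcOne m x.1 := (measurable_srcOne m).comp measurable_fst
  have eA : ∫⁻ p, transG K p.1.2.2 p.2 + waitG K p.1.2.2 p.2 +
      srcOne m p.1.1 * (transG K p.1.2.2 p.2 + waitG K p.1.2.2 p.2) ∂Λ =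
      ∫⁻ x, ((∫⁻ n, transG K x.2.2 n ∂(μC.prod μT)) + ∫⁻ n, waitG K x.2.2 n ∂(μC.prod μT)) +
        srcOne m x.1 * ((∫⁻ n, transG K x.2.2 n ∂(μC.prod μT)) +
          ∫⁻ n, waitG K x.2.2 n ∂(μC.prod μT)) ∂(η : Measure (Key M)) := by
    rw [hΛ, lintegral_prod _ hA.aemeasurable]
    refine lintegral_congr fun x => ?_
    have u1 : Measurable (transG K x.2.2) := (isRegular_transG (lN := 0) K).meas.of_uncurry_left
    have u2 : Measurable (waitG K x.2.2) := (isRegular_waitG (lN := 0) K).meas.of_uncurry_left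
    have u3 : Measurable fun n => transG K x.2.2 n + waitG K x.2.2 n := u1.add u2
    dsimp only
    rw [lintegral_add_left u3, lintegral_const_mul _ u3, lintegral_add_left u1]
  have eR : ∫⁻ p, runG K p.1.2.2 p.2 ∂Λ =
      ∫⁻ x, ∫⁻ n, runG K x.2.2 n ∂(μC.prod μT) ∂(η : Measure (Key M)) := by
    rw [hΛ, lintegral_prod _ hmR.aemeasurable]
  have es : ∫⁻ p, srcOne m p.1.1 ∂Λ = ∫⁻ x, srcOne m x.1 ∂(η : Measure (Key M)) := by
    rw [hΛ, lintegral_prod _ hs.aemeasurable]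
    simp
  have eC : ∫⁻ p, compG K p.1.2.2 p.2 ∂Λ = ∫⁻ n, compG K 0 n ∂(μC.prod μT) := by
    rw [hΛ, lintegral_prod _ hmC.aemeasurable]
    simp only [compG, lintegral_const, measure_univ, mul_one]
  have hfst : ∀ {g : Stage M → ℝ≥0∞}, Measurable g → ∫⁻ p, g p.1 ∂(Λ.prod Λ) = ∫⁻ p, g p ∂Λ :=
    fun hg => measurePreserving_fst.lintegral_comp hg
  have hsnd : ∀ {g : Stage M → ℝ≥0∞}, Measurable g → ∫⁻ p, g p.2 ∂(Λ.prod Λ) = ∫⁻ p, g p ∂Λ :=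
    fun hg => measurePreserving_snd.lintegral_comp hg
  have e1 : ∫⁻ p, nonpreReward m K p ∂(Λ.prod Λ) =
      (∫⁻ p, transG K p.1.2.2 p.2 + waitG K p.1.2.2 p.2 +
      srcOne m p.1.1 * (transG K p.1.2.2 p.2 + waitG K p.1.2.2 p.2) ∂Λ) +
      ((∫⁻ p, runG K p.1.2.2 p.2 ∂Λ) +
        (∫⁻ p, srcOne m p.1.1 ∂Λ) * ∫⁻ p, compG K p.1.2.2 p.2 ∂Λ) := by
    have a1 := hA.comp (measurable_fst : Measurable (Prod.fst : Stage M × Stage M → Stage M))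
    have a2 := hmR.comp (measurable_snd : Measurable (Prod.snd : Stage M × Stage M → Stage M))
    rw [← hfst hA, ← hsnd hmR, ← lintegral_prod_mul hs.aemeasurable hmC.aemeasurable]
    have b2 := lintegral_add_left (μ := Λ.prod Λ) a2 fun p => srcOne m p.1.1.1 * compG K p.2.1.2.2 p.2.2
    have b1 := lintegral_add_left (μ := Λ.prod Λ) a1 fun p => runG K p.2.1.2.2 p.2.2 +
      srcOne m p.1.1.1 * compG K p.2.1.2.2 p.2.2
    simp only [Function.comp_apply] at b1 b2
    rw [← b2, ← b1]
    rfl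
  have kA : Measurable fun x : Key M =>
      ((∫⁻ n, transG K x.2.2 n ∂(μC.prod μT)) + ∫⁻ n, waitG K x.2.2 n ∂(μC.prod μT)) +
        srcOne m x.1 * ((∫⁻ n, transG K x.2.2 n ∂(μC.prod μT)) +
          ∫⁻ n, waitG K x.2.2 n ∂(μC.prod μT)) := (kT.add kW).add (ks.mul (kT.add kW))
  rw [e1, eA, eR, es, eC, ← lintegral_mul_const _ ks, ← lintegral_add_left kR,
    ← lintegral_add_left kA]
  refine lintegral_congr fun x => ?_
  rw [coe_gainFn_nonpre]
  have : ∫⁻ n, compG K x.2.2 n ∂(μC.prod μT) = ∫⁻ n, compG K 0 n ∂(μC.prod μT) := rfl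
  rw [this]
  ring

theorem lintegral_preReward (hT : IsTimeLaw μT) (hC : IsTimeLaw μC)
    {η : ProbabilityMeasure (Key M)} (hη : η ∈ (preData hT hC).admissible M) (m : Fin M) (K : ℕ) :
    ∫⁻ p, preReward m K p ∂((η : Measure (Key M)).prod (μC.prod μT)) =
    ∫⁻ x, (preData hT hC).gainFn K m x ∂(η : Measure (Key M)) := by
  have := hT.isProbability
  have := hC.isProbability
  have : IsProbabilityMeasure (preData hT hC).base := isProbabilityMeasure_base .preemptive hT hC
  -- Admissibility is used here: under `η` the side information has the law of a transmission time,
  -- so charging the observed time or its mean gives the same integral.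
  have hside : (η : Measure (Key M)).map (fun x => x.2.1) = μT.map ENNReal.ofReal := by
    have h1 := congrArg (Measure.map Prod.snd) ((preData hT hC).map_eq_prod hη)
    rw [Measure.map_map (by fun_prop) (by fun_prop), Measure.map_snd_prod] at h1
    have : IsProbabilityMeasure ((η : Measure (Key M)).map Prod.fst) :=
      Measure.isProbabilityMeasure_map (by fun_prop)
    rw [measure_univ, one_smul] at h1
    exact h1
  have htr : ∫⁻ x, min x.2.1 (lvl K) ∂(η : Measure (Key M)) =
      ∫⁻ n, transG K 0 n ∂(μC.prod μT) := by
    have h1 : ∫⁻ x, min x.2.1 (lvl K) ∂(η : Measure (Key M)) =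
        ∫⁻ t, min t (lvl K) ∂((η : Measure (Key M)).map (fun x => x.2.1)) := by
      rw [lintegral_map (by fun_prop) (by fun_prop)]
    have h2 : ∫⁻ n, transG K 0 n ∂(μC.prod μT) =
        ∫⁻ t, min (ENNReal.ofReal t) (lvl K) ∂μT :=
      measurePreserving_snd.lintegral_comp (f := fun t => min (ENNReal.ofReal t) (lvl K))
        (by fun_prop)
    rw [h1, hside, lintegral_map (by fun_prop) (by fun_prop), h2]
  have kt : Measurable fun x : Key M => min x.2.1 (lvl K) := by fun_prop
  rw [lintegral_prod _ (measurable_preReward m K).aemeasurable]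
  have e1 : ∀ x : Key M, ∫⁻ n, preReward m K (x, n) ∂(μC.prod μT) = min x.2.1 (lvl K) +
      ((∫⁻ n, runG K x.2.2 n ∂(μC.prod μT)) +
      srcOne m x.1 * (min x.2.1 (lvl K) * (∫⁻ n, recvG x.2.2 n ∂(μC.prod μT)) +
        ∫⁻ n, compG K x.2.2 n * recvG x.2.2 n ∂(μC.prod μT))) := by
    intro x
    have u2 : Measurable (runG K x.2.2) := (isRegular_runG (lN := 0) K).meas.of_uncurry_left
    have u3 : Measurable (recvG x.2.2) := measurable_recvG.of_uncurry_left
    have u4 : Measurable (compG K x.2.2) := (isRegular_compG (lN := 0) K).meas.of_uncurry_left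
    have u5 : Measurable fun n => min x.2.1 (lvl K) * recvG x.2.2 n := u3.const_mul _
    have u6 : Measurable fun n => min x.2.1 (lvl K) * recvG x.2.2 n +
      compG K x.2.2 n * recvG x.2.2 n := u5.add (u4.mul u3)
    simp only [preReward]
    rw [lintegral_add_left measurable_const, lintegral_add_left u2, lintegral_const_mul _ u6,
      lintegral_add_left u5, lintegral_const_mul _ u3, lintegral_const, measure_univ, mul_one]
  simp only [e1, coe_gainFn_pre, add_assoc]
  have kc : Measurable fun x : Key M => ∫⁻ n, transG K x.2.2 n ∂(μC.prod μT) :=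
    measurable_const (a := ∫⁻ n, transG K 0 n ∂(μC.prod μT))
  rw [lintegral_add_left kt, htr, lintegral_add_left kc]
  congr 1
  simp only [transG, lintegral_const, measure_univ, mul_one]

theorem lintegral_iSup_nonpreReward (hT : IsTimeLaw μT) (hC : IsTimeLaw μC)
    (η : ProbabilityMeasure (Key M)) (m : Fin M) :
    ∫⁻ p, ⨆ K, nonpreReward m K p ∂(((η : Measure (Key M)).prod (μC.prod μT)).prod
      ((η : Measure (Key M)).prod (μC.prod μT))) =
    ⨆ K, ∫⁻ x, (nonpreData hT hC).gainFn K m x ∂(η : Measure (Key M)) := by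
  rw [lintegral_iSup (measurable_nonpreReward m) (nonpreReward_mono m)]
  simp only [lintegral_nonpreReward hT hC]

theorem lintegral_iSup_preReward (hT : IsTimeLaw μT) (hC : IsTimeLaw μC)
    {η : ProbabilityMeasure (Key M)} (hη : η ∈ (preData hT hC).admissible M) (m : Fin M) :
    ∫⁻ p, ⨆ K, preReward m K p ∂((η : Measure (Key M)).prod (μC.prod μT)) =
    ⨆ K, ∫⁻ x, (preData hT hC).gainFn K m x ∂(η : Measure (Key M)) := by
  rw [lintegral_iSup (measurable_preReward m) (preReward_mono m)]
  simp only [lintegral_preReward hT hC hη]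

theorem iSup_nonpreReward (m : Fin M) (p : Stage M × Stage M) :
    ⨆ K, nonpreReward m K p =
      (ENNReal.ofReal p.1.2.2 + (ENNReal.ofReal p.1.2.1 - p.1.1.2.2 - ENNReal.ofReal p.1.2.2) +
        srcOne m p.1.1.1 * (ENNReal.ofReal p.1.2.2 +
          (ENNReal.ofReal p.1.2.1 - p.1.1.2.2 - ENNReal.ofReal p.1.2.2))) +
      (min p.2.1.2.2 (ENNReal.ofReal p.2.2.1) + srcOne m p.1.1.1 * ENNReal.ofReal p.2.2.1) := by
  apply le_antisymm
  · refine iSup_le fun K => ?_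
    unfold nonpreReward transG waitG runG compG
    gcongr <;> exact min_le_left _ _
  · obtain ⟨K, hK⟩ := exists_le_lvl (a := ENNReal.ofReal p.1.2.2 + ENNReal.ofReal p.1.2.1 +
      ENNReal.ofReal p.2.2.1) (by simp)
    refine le_iSup_of_le K (le_of_eq ?_)
    have h1 : ENNReal.ofReal p.1.2.2 ≤ lvl K := (le_self_add.trans le_self_add).trans hK
    have h2 : ENNReal.ofReal p.1.2.1 ≤ lvl K := (le_add_self.trans le_self_add).trans hK
    have h3 : ENNReal.ofReal p.2.2.1 ≤ lvl K := le_add_self.trans hK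
    unfold nonpreReward transG waitG runG compG
    rw [min_eq_left h1, min_eq_left h2, min_eq_left h3]

theorem iSup_preReward (m : Fin M) (p : Stage M) (hp : p.1.2.1 ≠ ⊤) :
    ⨆ K, preReward m K p = p.1.2.1 + (min p.1.2.2 (ENNReal.ofReal p.2.1) + srcOne m p.1.1 *
      (p.1.2.1 * recvG p.1.2.2 p.2 + ENNReal.ofReal p.2.1 * recvG p.1.2.2 p.2)) := by
  apply le_antisymm
  · refine iSup_le fun K => ?_
    unfold preReward runG compG
    gcongr <;> exact min_le_left _ _
  · obtain ⟨K, hK⟩ := exists_le_lvl (a := p.1.2.1 + ENNReal.ofReal p.2.1) (by simp [hp])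
    refine le_iSup_of_le K (le_of_eq ?_)
    have h1 : p.1.2.1 ≤ lvl K := le_self_add.trans hK
    have h2 : ENNReal.ofReal p.2.1 ≤ lvl K := le_add_self.trans hK
    unfold preReward runG compG
    rw [min_eq_left h1, min_eq_left h2]

theorem measure_source_stage [IsProbabilityMeasure μT] [IsProbabilityMeasure μC]
    (hT : IsTimeLaw μT) (hC : IsTimeLaw μC) (η : ProbabilityMeasure (Key M)) (m : Fin M) :
    (((η : Measure (Key M)).prod (μC.prod μT)).prod ((η : Measure (Key M)).prod (μC.prod μT)))
      {p | p.1.1.1 = m} = ∫⁻ x, (nonpreData hT hC).rateFn m x ∂(η : Measure (Key M)) := by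
  have hs := measurable_srcOne_stage m
  have hms : MeasurableSet {p : Stage M × Stage M | p.1.1.1 = m} :=
    (measurable_fst.comp (measurable_fst.comp measurable_fst)) (measurableSet_singleton m)
  rw [← lintegral_indicator_one hms]
  have e : ∀ p : Stage M × Stage M, Set.indicator {p : Stage M × Stage M | p.1.1.1 = m} 1 p =
      srcOne m p.1.1.1 := fun p => by simp [Set.indicator_apply, srcOne]
  simp only [e]
  have h1 := (measurePreserving_fst (μ := (η : Measure (Key M)).prod (μC.prod μT))
    (ν := (η : Measure (Key M)).prod (μC.prod μT))).lintegral_comp hs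
  rw [h1, lintegral_prod _ hs.aemeasurable]
  refine lintegral_congr fun x => ?_
  dsimp only
  rw [lintegral_const, measure_univ, mul_one, ← coe_srcInd]
  exact congrArg _ (mul_one _).symm

theorem measurableSet_delivery_stage (m : Fin M) : MeasurableSet {p : Stage M | p.1.1 = m ∧
    ENNReal.ofReal p.2.1 ≤ p.1.2.2 + ENNReal.ofReal p.2.2} := by
  have h1 : MeasurableSet {p : Stage M | p.1.1 = m} :=
    (measurable_fst.comp measurable_fst) (measurableSet_singleton m)
  have h2 : Measurable fun p : Stage M => ENNReal.ofReal p.2.1 := by fun_prop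
  have h3 : Measurable fun p : Stage M => p.1.2.2 + ENNReal.ofReal p.2.2 := by fun_prop
  exact h1.inter (measurableSet_le h2 h3)

theorem measure_delivery_stage [IsProbabilityMeasure μT] [IsProbabilityMeasure μC]
    (hT : IsTimeLaw μT) (hC : IsTimeLaw μC) (η : ProbabilityMeasure (Key M)) (m : Fin M) :
    ((η : Measure (Key M)).prod (μC.prod μT))
      {p | p.1.1 = m ∧ ENNReal.ofReal p.2.1 ≤ p.1.2.2 + ENNReal.ofReal p.2.2} =
      ∫⁻ x, (preData hT hC).rateFn m x ∂(η : Measure (Key M)) := by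
  have hs := measurable_srcOne_stage m
  have hD := measurable_stage (M := M) measurable_recvG
  rw [← lintegral_indicator_one (measurableSet_delivery_stage m)]
  have e : ∀ p : Stage M, Set.indicator {p : Stage M | p.1.1 = m ∧
      ENNReal.ofReal p.2.1 ≤ p.1.2.2 + ENNReal.ofReal p.2.2} 1 p =
      srcOne m p.1.1 * recvG p.1.2.2 p.2 := fun p => by
    by_cases h1 : p.1.1 = m <;>
      by_cases h2 : ENNReal.ofReal p.2.1 ≤ p.1.2.2 + ENNReal.ofReal p.2.2 <;>
      simp [srcOne, recvG, h1, h2]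
  simp only [e]
  have hsD : Measurable fun p : Stage M => srcOne m p.1.1 * recvG p.1.2.2 p.2 := hs.mul hD
  rw [lintegral_prod _ hsD.aemeasurable]
  refine lintegral_congr fun x => ?_
  have u3 : Measurable (recvG x.2.2) := measurable_recvG.of_uncurry_left
  dsimp only
  rw [lintegral_const_mul _ u3, ← coe_meanMap (μC.prod μT) (isRegular_recvG (μC := μC) hT),
    ← coe_srcInd, ← ENNReal.coe_mul]
  rfl

end Rewards

/-! ### Attaining the cost of an admissible law -/

section Achievability
variable {Ω : Type*} [MeasurableSpace Ω] {P : Measure Ω} [IsProbabilityMeasure P]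
  {μT μC : Measure ℝ} {ν : Noise Ω} {M : ℕ} {ξ : Scheduler Ω M}

theorem recvSys_nonpreemptive {Ω : Type*} {ν : Noise Ω} {ξ : Scheduler Ω M} {Z : Sampler Ω} {ω : Ω}
    {m : Fin M} {n : ℕ} : recvSys .nonpreemptive ν ξ Z ω m (n + 1) =
      srcOne m (ξ (n + 1) ω) * ENNReal.ofReal (sysTime .nonpreemptive ν Z (n + 1) ω) := by
  by_cases h : ξ (n + 1) ω = m
  · have hr : ReceivedFrom .nonpreemptive ν ξ Z m ω (n + 1) := ⟨by omega, h, trivial⟩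
    rw [recvSys_of_received hr, srcOne, if_pos h, one_mul]
  · rw [recvSys_of_not_received fun h' => h h'.2.1, srcOne, if_neg h, zero_mul]

theorem recvSys_preemptive {Ω : Type*} {ν : Noise Ω} {ξ : Scheduler Ω M} {Z : Sampler Ω} {ω : Ω}
    {m : Fin M} {n : ℕ} {θ : ℝ≥0∞} (h : FollowsThreshold .preemptive ν Z θ ω (n + 1)) :
    recvSys .preemptive ν ξ Z ω m (n + 1) = srcOne m (ξ (n + 1) ω) *
      (ENNReal.ofReal (sysTime .preemptive ν Z (n + 1) ω) *
        recvG θ (ν.C (n + 1) ω, ν.T (n + 2) ω)) := by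
  have hr := h.recv rfl
  by_cases h1 : ξ (n + 1) ω = m
  · by_cases h2 : Received .preemptive ν Z (n + 1) ω
    · rw [recvSys_of_received ⟨by omega, h1, h2⟩, srcOne, if_pos h1, recvG, if_pos (hr.1 h2)]
      simp
    · rw [recvSys_of_not_received fun h' => h2 h'.2.2, recvG, if_neg fun h' => h2 (hr.2 h')]
      simp
  · rw [recvSys_of_not_received fun h' => h1 h'.2.1, srcOne, if_neg h1, zero_mul]

/-- Two consecutive stages form the renewal variable; the reward of packet `n + 1` is exact from `n
= 1` on and an upper bound for `n = 0`. -/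
theorem exists_sampler_nonpreemptive (hν : ν.IsModel P μT μC) (hT : IsTimeLaw μT)
    (hC : IsTimeLaw μC) {η : ProbabilityMeasure (Key M)}
    (hη : η ∈ (nonpreData hT hC).admissible M)
    (hpos : ∀ m, ∫⁻ x, (nonpreData hT hC).rateFn m x ∂(η : Measure (Key M)) ≠ 0)
    (hfin : ∀ m, ⨆ K, ∫⁻ x, (nonpreData hT hC).gainFn K m x ∂(η : Measure (Key M)) ≠ ⊤)
    (hξ : IsRandomScheduler ν P (fun m => ((η : Measure (Key M)).map Prod.fst {m}).toReal) ξ) :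
    ∃ Z : Sampler Ω, Feasible .nonpreemptive ν P ξ Z ∧ ∀ m,
      Tendsto (fun K : ℕ => meanPeakAge .nonpreemptive ν P ξ Z m K) atTop
        (𝓝 ((⨆ K, ∫⁻ x, (nonpreData hT hC).gainFn K m x ∂(η : Measure (Key M))) /
          ∫⁻ x, (nonpreData hT hC).rateFn m x ∂(η : Measure (Key M)))) := by
  have := hT.isProbability
  have := hC.isProbability
  have : IsProbabilityMeasure (nonpreData hT hC).base :=
    isProbabilityMeasure_base .nonpreemptive hT hC
  obtain ⟨κ, hκ, hlaw⟩ := (nonpreData hT hC).exists_threshold hη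
  set Θ := ruleThreshold κ ν ξ .nonpreemptive with hΘdef
  have hΘ : ∀ i, Measurable[ν.sampInfo i] (Θ i) := measurable_ruleThreshold hκ hξ.1 _
  set Z := thresholdSampler .nonpreemptive ν Θ with hZdef
  have hZ : CausalSampler .nonpreemptive ν P Z := causalSampler_thresholdSampler hν hC hΘ
  set F : ℕ → Ω → Stage M := fun n ω =>
    ((ξ (n + 1) ω, (0 : ℝ≥0∞), Θ n ω), (ν.C n ω, ν.T (n + 1) ω)) with hF
  have hfresh : ∀ n, IsFresh (ν.history n) (ν.history (n + 1)) P (F n)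
      ((η : Measure (Key M)).prod (μC.prod μT)) := isFresh_key_nonpreemptive hν hκ hlaw hξ
  have hN : ∀ n, IsFresh (ν.history n) (ν.history (n + 2)) P (fun ω => (F n ω, F (n + 1) ω))
      (((η : Measure (Key M)).prod (μC.prod μT)).prod
        ((η : Measure (Key M)).prod (μC.prod μT))) := fun n => (hfresh n).pair (hfresh (n + 1))
  have hB : ∀ m, MeasurableSet {p : Stage M × Stage M | p.1.1.1 = m} := fun m =>
    (measurable_fst.comp (measurable_fst.comp measurable_fst)) (measurableSet_singleton m)
  have hrecv : ∀ m, ∀ᵐ ω ∂P, ∀ n, ReceivedFrom .nonpreemptive ν ξ Z m ω (n + 1) ↔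
      (F n ω, F (n + 1) ω) ∈ {p : Stage M × Stage M | p.1.1.1 = m} := fun m =>
    ae_of_all _ fun ω n => ⟨fun h => h.2.1, fun h => ⟨by omega, h, trivial⟩⟩
  have hval : ∀ m, ∀ᵐ ω ∂P, ∀ n,
      ENNReal.ofReal (Z (n + 1) ω) + recvSys .nonpreemptive ν ξ Z ω m (n + 1) ≤
        ⨆ K, nonpreReward m K (F n ω, F (n + 1) ω) ∧ (1 ≤ n →
      ⨆ K, nonpreReward m K (F n ω, F (n + 1) ω) ≤
        ENNReal.ofReal (Z (n + 1) ω) + recvSys .nonpreemptive ν ξ Z ω m (n + 1)) := by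
    intro m
    filter_upwards [ae_followsThreshold (srv := .nonpreemptive) (Θ := Θ) hν hT hC,
      hν.ae_T_pos hT, hν.ae_C_pos hC] with ω h1 h2 h3 n
    rw [iSup_nonpreReward, recvSys_nonpreemptive, ofReal_sysTime (h2 _).le (h3 _).le, hZdef,
      ofReal_thresholdSampler h2]
    simp only [hF]
    refine ⟨?_, fun hn => ?_⟩
    · have hw : ENNReal.ofReal (waiting .nonpreemptive ν (thresholdSampler .nonpreemptive ν Θ)
          (n + 1) ω) ≤ ENNReal.ofReal (ν.C n ω) - Θ n ω - ENNReal.ofReal (ν.T (n + 1) ω) := by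
        rcases n with _ | n
        · rw [waiting_thresholdSampler]
          have := h2 1
          simp [queueing, elapsed, this.le]
        · exact ((h1 (n + 1) (by omega)).wait rfl).le
      refine le_trans (add_le_add (add_le_add_left (add_le_add_right hw _) _)
        (mul_le_mul_right (add_le_add_left (add_le_add_right hw _) _) _)) (le_of_eq ?_)
      ring
    · rw [(h1 n hn).wait rfl]
      exact le_of_eq (by ring)
  refine ⟨Z, ⟨hξ.1, hZ, ?_⟩, fun m => ?_⟩
  · filter_upwards [ae_all_iff.2 fun m => ae_tendsto_frequency ν.history_mono hN (hB m) (hrecv m)]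
      with ω hω m
    exact ⟨_, hω m⟩
  · have hy : Measurable fun p => ⨆ K, nonpreReward m K p := Measurable.iSup (measurable_nonpreReward m)
    have h := tendsto_meanPeakAge_of_fresh (m := m) hν.meas_T hν.meas_C (hZ.measurable hν)
      (hξ.1.measurable hν) (hZ.ae_nonneg hν hT) (ae_sysTime_nonneg hν hT hC _ Z) ν.history_mono hN
      (hB m) (by rw [measure_source_stage hT hC]; exact hpos m) hy
      (by rw [lintegral_iSup_nonpreReward hT hC]; exact hfin m)
      (lintegral_thresholdSampler_zero hν hT hC) (hrecv m)
      ((hval m).mono fun ω h n => (h n).1) ((hval m).mono fun ω h n => (h (n + 1)).2 (by omega))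
    rwa [lintegral_iSup_nonpreReward hT hC, measure_source_stage hT hC] at h

/-- Without waiting, one stage determines the delivery and the reward of its packet exactly, for
every packet `n + 1`. -/
theorem exists_sampler_preemptive (hν : ν.IsModel P μT μC) (hT : IsTimeLaw μT)
    (hC : IsTimeLaw μC) {η : ProbabilityMeasure (Key M)}
    (hη : η ∈ (preData hT hC).admissible M)
    (hpos : ∀ m, ∫⁻ x, (preData hT hC).rateFn m x ∂(η : Measure (Key M)) ≠ 0)
    (hfin : ∀ m, ⨆ K, ∫⁻ x, (preData hT hC).gainFn K m x ∂(η : Measure (Key M)) ≠ ⊤)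
    (hξ : IsRandomScheduler ν P (fun m => ((η : Measure (Key M)).map Prod.fst {m}).toReal) ξ) :
    ∃ Z : Sampler Ω, Feasible .preemptive ν P ξ Z ∧ ∀ m,
      Tendsto (fun K : ℕ => meanPeakAge .preemptive ν P ξ Z m K) atTop
        (𝓝 ((⨆ K, ∫⁻ x, (preData hT hC).gainFn K m x ∂(η : Measure (Key M))) /
          ∫⁻ x, (preData hT hC).rateFn m x ∂(η : Measure (Key M)))) := by
  have := hT.isProbability
  have := hC.isProbability
  have : IsProbabilityMeasure (preData hT hC).base :=
    isProbabilityMeasure_base .preemptive hT hC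
  obtain ⟨κ, hκ, hlaw⟩ := (preData hT hC).exists_threshold hη
  set Θ := ruleThreshold κ ν ξ .preemptive with hΘdef
  have hΘ : ∀ i, Measurable[ν.sampInfo i] (Θ i) := measurable_ruleThreshold hκ hξ.1 _
  set Z := thresholdSampler .preemptive ν Θ with hZdef
  have hZ : CausalSampler .preemptive ν P Z := causalSampler_thresholdSampler hν hC hΘ
  set F : ℕ → Ω → Stage M := fun n ω =>
    ((ξ (n + 1) ω, ENNReal.ofReal (ν.T (n + 1) ω), Θ (n + 1) ω),
      (ν.C (n + 1) ω, ν.T (n + 2) ω)) with hF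
  have hN : ∀ n, IsFresh (ν.history n) (ν.history (n + 2)) P (F n)
      ((η : Measure (Key M)).prod (μC.prod μT)) := isFresh_key_preemptive hν hκ hlaw hξ
  set B : Fin M → Set (Stage M) := fun m =>
    {p | p.1.1 = m ∧ ENNReal.ofReal p.2.1 ≤ p.1.2.2 + ENNReal.ofReal p.2.2} with hBdef
  have hB : ∀ m, MeasurableSet (B m) := measurableSet_delivery_stage
  have hthr := ae_followsThreshold (srv := .preemptive) (Θ := Θ) hν hT hC
  have hrecv : ∀ m, ∀ᵐ ω ∂P, ∀ n, ReceivedFrom .preemptive ν ξ Z m ω (n + 1) ↔ F n ω ∈ B m := by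
    intro m
    filter_upwards [hthr] with ω h1 n
    have hr := (h1 (n + 1) (by omega)).recv rfl
    exact ⟨fun h => ⟨h.2.1, hr.1 h.2.2⟩, fun h => ⟨by omega, h.1, hr.2 h.2⟩⟩
  have hval : ∀ m, ∀ᵐ ω ∂P, ∀ n,
      ENNReal.ofReal (Z (n + 1) ω) + recvSys .preemptive ν ξ Z ω m (n + 1) =
        ⨆ K, preReward m K (F n ω) := by
    intro m
    filter_upwards [hthr, hν.ae_T_pos hT, hν.ae_C_pos hC] with ω h1 h2 h3 n
    have hw : waiting .preemptive ν (thresholdSampler .preemptive ν Θ) (n + 1) ω = 0 := rfl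
    rw [iSup_preReward _ _ ENNReal.ofReal_ne_top, recvSys_preemptive (h1 (n + 1) (by omega)),
      ofReal_sysTime (h2 _).le (h3 _).le, hZdef, ofReal_thresholdSampler h2, hw]
    simp only [hF, ENNReal.ofReal_zero, add_zero]
    ring
  refine ⟨Z, ⟨hξ.1, hZ, ?_⟩, fun m => ?_⟩
  · filter_upwards [ae_all_iff.2 fun m => ae_tendsto_frequency ν.history_mono hN (hB m) (hrecv m)]
      with ω hω m
    exact ⟨_, hω m⟩
  · have hy : Measurable fun p => ⨆ K, preReward m K p := Measurable.iSup (measurable_preReward m)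
    have h := tendsto_meanPeakAge_of_fresh (m := m) hν.meas_T hν.meas_C (hZ.measurable hν)
      (hξ.1.measurable hν) (hZ.ae_nonneg hν hT) (ae_sysTime_nonneg hν hT hC _ Z) ν.history_mono hN
      (hB m) (by rw [measure_delivery_stage hT hC]; exact hpos m) hy
      (by rw [lintegral_iSup_preReward hT hC hη]; exact hfin m)
      (lintegral_thresholdSampler_zero hν hT hC) (hrecv m)
      ((hval m).mono fun ω h n => (h n).le) ((hval m).mono fun ω h n => (h (n + 1)).ge)
    rwa [lintegral_iSup_preReward hT hC hη, measure_delivery_stage hT hC] at h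

end Achievability

/-! ### A decision law of finite cost -/

section Finiteness
variable {M : ℕ}

/-- Decision law that waits for the end of every computation, with source law `w`. -/
def patientLaw (D : CostData) (w : Fin M → ℝ) : Measure (Key M) :=
  ((∑ m, ENNReal.ofReal (w m) • Measure.dirac m).prod D.base).map fun x => (x.1, x.2, ⊤)

theorem lintegral_patientLaw (D : CostData) [IsProbabilityMeasure D.base] (w : Fin M → ℝ)
    {g : Key M → ℝ≥0∞} (hg : Measurable g) :
    ∫⁻ x, g x ∂patientLaw D w = ∑ m, ENNReal.ofReal (w m) * ∫⁻ t, g (m, t, ⊤) ∂D.base := by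
  have hf : Measurable fun x : Fin M × ℝ≥0∞ => (x.1, x.2, (⊤ : ℝ≥0∞)) := by fun_prop
  have : SFinite (∑ m : Fin M, ENNReal.ofReal (w m) • Measure.dirac m) := by
    have : IsFiniteMeasure (∑ m : Fin M, ENNReal.ofReal (w m) • Measure.dirac m) :=
      ⟨by simp [Measure.finsetSum_apply]⟩
    infer_instance
  have hgf : Measurable fun x : Fin M × ℝ≥0∞ => g (x.1, x.2, ⊤) := hg.comp hf
  rw [patientLaw, lintegral_map hg hf, lintegral_prod _ hgf.aemeasurable,
    lintegral_finsetSum_measure]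
  simp [lintegral_smul_measure, lintegral_dirac]

theorem isProbabilityMeasure_patientLaw (D : CostData) [IsProbabilityMeasure D.base]
    {w : Fin M → ℝ} (hw : ∀ m, 0 < w m) (hw1 : ∑ m, w m = 1) :
    IsProbabilityMeasure (patientLaw D w) := by
  refine ⟨?_⟩
  rw [← lintegral_one, lintegral_patientLaw D w measurable_const]
  simp only [lintegral_one, measure_univ, mul_one]
  rw [← ENNReal.ofReal_sum_of_nonneg fun m _ => (hw m).le, hw1, ENNReal.ofReal_one]

/-- With threshold `∞` and source law `w`, source `m` has rate `w m` and gain at most `3b`,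
uniformly in the truncation. -/
theorem exists_admissible_finite (D : CostData) [IsProbabilityMeasure D.base]
    {w : Fin M → ℝ} (hw : ∀ m, 0 < w m) (hw1 : ∑ m, w m = 1) (hrate : D.rate ⊤ = 1) {b : ℝ≥0∞}
    (hb : b ≠ ⊤) (hinc : ∀ K, (D.inc K ⊤ : ℝ≥0∞) ≤ b)
    (hsys : ∀ K t, (D.sys K (t, ⊤) : ℝ≥0∞) ≤ t + b) (hbase : ∫⁻ t, t ∂D.base ≤ b) :
    ∃ η ∈ D.admissible M, ⨆ K, D.cost w K (η : Measure (Key M)) < ⊤ := by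
  have hprob := isProbabilityMeasure_patientLaw D hw hw1
  have hind : ∀ m, ∫⁻ x, srcInd m x ∂patientLaw D w = ENNReal.ofReal (w m) := by
    intro m
    rw [lintegral_patientLaw D w (by fun_prop), Finset.sum_eq_single m]
    · simp [coe_srcInd, srcOne]
    · intro i _ hi
      simp [coe_srcInd, srcOne, hi]
    · simp
  refine ⟨⟨patientLaw D w, hprob⟩, fun m φ => ?_, ?_⟩
  · change ∫⁻ x, srcInd m x * φ x.2.1 ∂patientLaw D w =
      (∫⁻ x, srcInd m x ∂patientLaw D w) * _
    rw [hind, lintegral_patientLaw D w (by fun_prop), Finset.sum_eq_single m]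
    · simp [coe_srcInd, srcOne]
    · intro i _ hi
      simp [coe_srcInd, srcOne, hi]
    · simp
  · refine lt_of_le_of_lt (iSup_le fun K => ?_)
      (show ∑ m : Fin M, ENNReal.ofReal (w m) * ((b + (b + b)) / ENNReal.ofReal (w m)) < ⊤ from
        ENNReal.sum_lt_top.2 fun m _ => ENNReal.mul_lt_top ENNReal.ofReal_lt_top
          (ENNReal.div_lt_top (by simp [hb]) (ENNReal.ofReal_pos.2 (hw m)).ne'))
    refine Finset.sum_le_sum fun m _ => mul_le_mul_right (ENNReal.div_le_div ?_ ?_) _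
    · have hgain : ∀ i t, (D.gainFn K m (i, t, ⊤) : ℝ≥0∞) ≤ b + (t + b) := by
        intro i t
        have e : (D.gainFn K m (i, t, ⊤) : ℝ≥0∞) =
          (D.inc K ⊤ : ℝ≥0∞) + srcOne m i * (D.sys K (t, ⊤) : ℝ≥0∞) := by
          rw [← coe_srcInd m (i, t, ⊤), ← ENNReal.coe_mul, ← ENNReal.coe_add]; rfl
        rw [e]
        exact add_le_add (hinc K)
          ((mul_le_mul' (srcOne_le m i) (hsys K t)).trans (one_mul _).le)
      have hbound : ∀ i, ∫⁻ t, D.gainFn K m (i, t, ⊤) ∂D.base ≤ b + (b + b) := by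
        intro i
        refine (lintegral_mono (hgain i)).trans ?_
        rw [lintegral_add_left measurable_const, lintegral_add_left measurable_id']
        simp only [lintegral_const, measure_univ, mul_one]
        gcongr
      change ∫⁻ x, D.gainFn K m x ∂patientLaw D w ≤ _
      rw [lintegral_patientLaw D w (by fun_prop)]
      calc _ ≤ ∑ i, ENNReal.ofReal (w i) * (b + (b + b)) :=
            Finset.sum_le_sum fun i _ => mul_le_mul_right (hbound i) _
        _ = b + (b + b) := by
            rw [← Finset.sum_mul, ← ENNReal.ofReal_sum_of_nonneg fun m _ => (hw m).le, hw1,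
              ENNReal.ofReal_one, one_mul]
    · change _ ≤ ∫⁻ x, D.rateFn m x ∂patientLaw D w
      rw [← hind m, lintegral_patientLaw D w (by fun_prop), lintegral_patientLaw D w (by fun_prop)]
      refine Finset.sum_le_sum fun i _ => mul_le_mul_right (lintegral_mono fun t => ?_) _
      have e : D.rateFn m (i, t, ⊤) = srcInd m (i, t, ⊤) * D.rate ⊤ := rfl
      rw [e, hrate, mul_one]

variable {μT μC : Measure ℝ}

theorem exists_admissible_finite_data (srv : Server) (hT : IsTimeLaw μT) (hC : IsTimeLaw μC)
    {w : Fin M → ℝ} (hw : ∀ m, 0 < w m) (hw1 : ∑ m, w m = 1) :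
    ∃ η ∈ (srv.data hT hC).admissible M,
      ⨆ K, (srv.data hT hC).cost w K (η : Measure (Key M)) < ⊤ := by
  have := hT.isProbability
  have := hC.isProbability
  have := isProbabilityMeasure_base srv hT hC
  set b : ℝ≥0∞ := (∫⁻ t, ENNReal.ofReal t ∂μT) + ∫⁻ t, ENNReal.ofReal t ∂μC with hb
  have hTle : ∀ K θ, ∫⁻ n, transG K θ n ∂(μC.prod μT) ≤ ∫⁻ t, ENNReal.ofReal t ∂μT := fun K θ => by
    rw [← measurePreserving_snd.lintegral_comp (μ := μC.prod μT) ENNReal.measurable_ofReal]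
    exact lintegral_mono fun n => min_le_left _ _
  have hCint : ∫⁻ n, ENNReal.ofReal n.1 ∂(μC.prod μT) = ∫⁻ t, ENNReal.ofReal t ∂μC :=
    measurePreserving_fst.lintegral_comp ENNReal.measurable_ofReal
  have hCle : ∀ K θ, ∫⁻ n, compG K θ n ∂(μC.prod μT) ≤ ∫⁻ t, ENNReal.ofReal t ∂μC := fun K θ => by
    rw [← hCint]
    exact lintegral_mono fun n => min_le_left _ _
  have hRle : ∀ K θ, ∫⁻ n, runG K θ n ∂(μC.prod μT) ≤ ∫⁻ t, ENNReal.ofReal t ∂μC := fun K θ => by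
    rw [← hCint]
    exact lintegral_mono fun n => (min_le_right _ _).trans (min_le_left _ _)
  have hW : ∀ K, ∫⁻ n, waitG K ⊤ n ∂(μC.prod μT) = 0 := fun K => by simp [waitG]
  have hbtop : b ≠ ⊤ := ENNReal.add_ne_top.2 ⟨hT.lintegral_ne_top, hC.lintegral_ne_top⟩
  refine exists_admissible_finite _ hw hw1 ?_ hbtop ?_ ?_ ?_ <;> cases srv
  · rfl
  · rw [← ENNReal.coe_inj]
    refine (coe_meanMap (μC.prod μT) (isRegular_recvG (μC := μC) hT) ⊤).trans ?_
    simp [recvG]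
  · intro K
    change ((meanMap _ (isRegular_transG K) ⊤ + (meanMap _ (isRegular_runG K) ⊤ +
      meanMap _ (isRegular_waitG K) ⊤) : ℝ≥0) : ℝ≥0∞) ≤ b
    simp only [ENNReal.coe_add, coe_meanMap, hW, add_zero]
    exact add_le_add (hTle K _) (hRle K _)
  · intro K
    change ((meanMap _ (isRegular_transG K) ⊤ + meanMap _ (isRegular_runG K) ⊤ : ℝ≥0) : ℝ≥0∞) ≤ b
    simp only [ENNReal.coe_add, coe_meanMap]
    exact add_le_add (hTle K _) (hRle K _)
  · intro K t
    change ((meanMap _ (isRegular_transG K) ⊤ + meanMap _ (isRegular_waitG K) ⊤ +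
      meanMap _ (isRegular_compG K) ⊤ : ℝ≥0) : ℝ≥0∞) ≤ t + b
    simp only [ENNReal.coe_add, coe_meanMap, hW, add_zero]
    exact (add_le_add (hTle K _) (hCle K _)).trans le_add_self
  · intro K t
    change ((truncMap K t * meanMap _ (isRegular_recvG hT) ⊤ +
      meanMap _ (isRegular_recvG_mul hT K) ⊤ : ℝ≥0) : ℝ≥0∞) ≤ t + b
    simp only [ENNReal.coe_add, ENNReal.coe_mul, coe_meanMap, coe_truncMap]
    refine add_le_add ?_ ((lintegral_mono fun n => ?_).trans ((hCle K ⊤).trans le_add_self))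
    · refine (mul_le_mul' (min_le_left _ _) (lintegral_mono fun n => recvG_le_one ⊤ n)).trans ?_
      simp
    · exact (mul_le_mul_right (recvG_le_one _ _) _).trans (mul_one _).le
  · change ∫⁻ t, t ∂(Measure.dirac 0) ≤ b
    rw [lintegral_dirac]
    exact zero_le
  · change ∫⁻ t, t ∂(μT.map ENNReal.ofReal) ≤ b
    rw [lintegral_map measurable_id' ENNReal.measurable_ofReal]
    exact le_self_add

end Finiteness

/-! ### Removing the truncation -/

section Monotone
variable {M : ℕ} {μT μC : Measure ℝ}

/-- The truncated rewards increase pointwise with the level, and the gains are their integrals. For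
the preemptive server this identification uses admissibility. -/
theorem lintegral_gainFn_mono (srv : Server) (hT : IsTimeLaw μT) (hC : IsTimeLaw μC)
    {η : ProbabilityMeasure (Key M)} (hη : η ∈ (srv.data hT hC).admissible M) (m : Fin M) :
    Monotone fun K => ∫⁻ x, (srv.data hT hC).gainFn K m x ∂(η : Measure (Key M)) := by
  intro K L h
  cases srv with
  | nonpreemptive =>
    change ∫⁻ x, (nonpreData hT hC).gainFn K m x ∂_ ≤ ∫⁻ x, (nonpreData hT hC).gainFn L m x ∂_
    rw [← lintegral_nonpreReward, ← lintegral_nonpreReward]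
    exact lintegral_mono (nonpreReward_mono m h)
  | preemptive =>
    change ∫⁻ x, (preData hT hC).gainFn K m x ∂_ ≤ ∫⁻ x, (preData hT hC).gainFn L m x ∂_
    rw [← lintegral_preReward hT hC hη, ← lintegral_preReward hT hC hη]
    exact lintegral_mono (preReward_mono m h)

theorem iSup_cost (srv : Server) (hT : IsTimeLaw μT) (hC : IsTimeLaw μC)
    {η : ProbabilityMeasure (Key M)} (hη : η ∈ (srv.data hT hC).admissible M) (w : Fin M → ℝ) :
    ⨆ K, (srv.data hT hC).cost w K (η : Measure (Key M)) = ∑ m, ENNReal.ofReal (w m) *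
      ((⨆ K, ∫⁻ x, (srv.data hT hC).gainFn K m x ∂(η : Measure (Key M))) /
        ∫⁻ x, (srv.data hT hC).rateFn m x ∂(η : Measure (Key M))) := by
  simp only [ENNReal.iSup_div, ENNReal.mul_iSup]
  exact (ENNReal.finsetSum_iSup_of_monotone (f := fun m K => ENNReal.ofReal (w m) *
    ((∫⁻ x, (srv.data hT hC).gainFn K m x ∂(η : Measure (Key M))) /
      ∫⁻ x, (srv.data hT hC).rateFn m x ∂(η : Measure (Key M)))) fun m K L h =>
    mul_le_mul_right (ENNReal.div_le_div_right (lintegral_gainFn_mono srv hT hC hη m h) _) _).symm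

/-- All weights and gains are positive, so a zero rate or an infinite gain of a single source would
make the cost infinite. -/
theorem finite_of_iSup_cost (srv : Server) (hT : IsTimeLaw μT) (hC : IsTimeLaw μC)
    {η : ProbabilityMeasure (Key M)} (hη : η ∈ (srv.data hT hC).admissible M) {w : Fin M → ℝ}
    (hw : ∀ m, 0 < w m) (hfin : ⨆ K, (srv.data hT hC).cost w K (η : Measure (Key M)) < ⊤)
    (m : Fin M) :
    ∫⁻ x, (srv.data hT hC).rateFn m x ∂(η : Measure (Key M)) ≠ 0 ∧
    ⨆ K, ∫⁻ x, (srv.data hT hC).gainFn K m x ∂(η : Measure (Key M)) ≠ ⊤ := by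
  rw [iSup_cost srv hT hC hη, ENNReal.sum_lt_top] at hfin
  have h1 := hfin m (Finset.mem_univ m)
  have h2 : (⨆ K, ∫⁻ x, (srv.data hT hC).gainFn K m x ∂(η : Measure (Key M))) /
      ∫⁻ x, (srv.data hT hC).rateFn m x ∂(η : Measure (Key M)) ≠ ⊤ := fun h => by
    rw [h, ENNReal.mul_top (ENNReal.ofReal_pos.2 (hw m)).ne'] at h1
    exact h1.ne rfl
  have hg : ⨆ K, ∫⁻ x, (srv.data hT hC).gainFn K m x ∂(η : Measure (Key M)) ≠ 0 := by
    have : 0 < ∫⁻ x, (srv.data hT hC).gainFn 0 m x ∂(η : Measure (Key M)) := by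
      rw [lintegral_pos_iff_support (by fun_prop)]
      have : Function.support (fun x => ((srv.data hT hC).gainFn 0 m x : ℝ≥0∞)) = Set.univ := by
        ext x
        simp only [Function.mem_support, Set.mem_univ, iff_true, ne_eq, ENNReal.coe_eq_zero]
        have h3 := inc_pos srv hT hC 0 x.2.2
        exact (lt_of_lt_of_le h3 le_self_add).ne'
      rw [this, measure_univ]
      exact one_pos
    exact (this.trans_le (le_iSup (fun K => ∫⁻ x, (srv.data hT hC).gainFn K m x
      ∂(η : Measure (Key M))) 0)).ne'
  refine ⟨fun h => h2 ?_, fun h => h2 ?_⟩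
  · rw [h, ENNReal.div_zero hg]
  · rw [h, ENNReal.top_div_of_ne_top (lintegral_ne_top_of_compact _ η)]

end Monotone

/-! ### Optimality of random scheduling -/

section Optimality
variable {Ω : Type*} [MeasurableSpace Ω] {P : Measure Ω} [IsProbabilityMeasure P]
  {μT μC : Measure ℝ} {ν : Noise Ω} {M : ℕ} {ξ : Scheduler Ω M}

theorem exists_sampler (hν : ν.IsModel P μT μC) (hT : IsTimeLaw μT) (hC : IsTimeLaw μC)
    (srv : Server) {η : ProbabilityMeasure (Key M)} (hη : η ∈ (srv.data hT hC).admissible M)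
    (hpos : ∀ m, ∫⁻ x, (srv.data hT hC).rateFn m x ∂(η : Measure (Key M)) ≠ 0)
    (hfin : ∀ m, ⨆ K, ∫⁻ x, (srv.data hT hC).gainFn K m x ∂(η : Measure (Key M)) ≠ ⊤)
    (hξ : IsRandomScheduler ν P (fun m => ((η : Measure (Key M)).map Prod.fst {m}).toReal) ξ) :
    ∃ Z : Sampler Ω, Feasible srv ν P ξ Z ∧ ∀ m,
      Tendsto (fun K : ℕ => meanPeakAge srv ν P ξ Z m K) atTop
        (𝓝 ((⨆ K, ∫⁻ x, (srv.data hT hC).gainFn K m x ∂(η : Measure (Key M))) /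
          ∫⁻ x, (srv.data hT hC).rateFn m x ∂(η : Measure (Key M)))) := by
  cases srv
  · exact exists_sampler_nonpreemptive hν hT hC hη hpos hfin hξ
  · exact exists_sampler_preemptive hν hT hC hη hpos hfin hξ

theorem exists_optimal_frequency (hν : ν.IsModel P μT μC) (hT : IsTimeLaw μT) (hC : IsTimeLaw μC)
    {w : Fin M → ℝ} (hw : ∀ m, 0 < w m) (hw1 : ∑ m, w m = 1) (srv : Server) :
    ∃ f ∈ stdSimplex ℝ (Fin M), (∃ ξ : Scheduler Ω M, IsRandomScheduler ν P f ξ) ∧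
      ∀ ξ : Scheduler Ω M, IsRandomScheduler ν P f ξ →
        ∃ Z : Sampler Ω, Feasible srv ν P ξ Z ∧
          (∀ m, ∃ c : ℝ≥0∞, c ≠ ⊤ ∧
            Tendsto (fun N : ℕ => meanPeakAge srv ν P ξ Z m N) atTop (𝓝 c)) ∧
          ∀ (ξ' : Scheduler Ω M) (Z' : Sampler Ω), Feasible srv ν P ξ' Z' →
            avgPAoI srv ν P w ξ Z ≤ avgPAoI srv ν P w ξ' Z' := by
  have := isProbabilityMeasure_base srv hT hC
  obtain ⟨η₀, hη₀, hfin₀⟩ := exists_admissible_finite_data srv hT hC hw hw1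
  -- The source marginal of the minimising decision law supplies the optimal frequencies.
  obtain ⟨η, hη, hmin⟩ := (srv.data hT hC).exists_minimizer w (inc_pos srv hT hC) ⟨η₀, hη₀⟩
  have hfin := (hmin η₀ hη₀).trans_lt hfin₀
  have hbounds := finite_of_iSup_cost srv hT hC hη hw hfin
  have hy : IsProbabilityMeasure ((η : Measure (Key M)).map Prod.fst) :=
    Measure.isProbabilityMeasure_map (by fun_prop)
  refine ⟨fun m => ((η : Measure (Key M)).map Prod.fst {m}).toReal,
    ⟨fun m => ENNReal.toReal_nonneg, ?_⟩, exists_randomScheduler hν _, fun ξ hξ => ?_⟩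
  · rw [← ENNReal.toReal_sum fun m _ => measure_ne_top _ _, sum_measure_singleton,
      Finset.coe_univ, measure_univ, ENNReal.toReal_one]
  · obtain ⟨Z, hZ, hlim⟩ := exists_sampler hν hT hC srv hη (fun m => (hbounds m).1)
      (fun m => (hbounds m).2) hξ
    refine ⟨Z, hZ, fun m => ⟨_, ENNReal.div_ne_top (hbounds m).2 (hbounds m).1, hlim m⟩,
      fun ξ' Z' hF => ?_⟩
    refine le_trans (le_of_eq ?_) (le_avgPAoI hν hT hC w srv hF hmin)
    rw [iSup_cost srv hT hC hη]
    exact Finset.sum_congr rfl fun m _ => by rw [(hlim m).limsup_eq]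

end Optimality
end StatusUpdate
end

/-- The two infima agree because policies with a random scheduler are among the feasible ones and
one of them attains the overall minimum. -/
theorem corollary1 {Ω : Type*} [MeasurableSpace Ω] (P : Measure Ω) [IsProbabilityMeasure P]
    (μT μC : Measure ℝ) (hT : StatusUpdate.IsTimeLaw μT) (hC : StatusUpdate.IsTimeLaw μC)
    (ν : StatusUpdate.Noise Ω) (hν : ν.IsModel P μT μC)
    (M : ℕ) (w : Fin M → ℝ) (hw : ∀ m, 0 < w m) (hw1 : ∑ m, w m = 1)
    (srv : StatusUpdate.Server) :
    (∃ f ∈ stdSimplex ℝ (Fin M),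
      (∃ ξ : StatusUpdate.Scheduler Ω M, StatusUpdate.IsRandomScheduler ν P f ξ) ∧
      ∀ ξ : StatusUpdate.Scheduler Ω M, StatusUpdate.IsRandomScheduler ν P f ξ →
        ∃ Z : StatusUpdate.Sampler Ω,
          StatusUpdate.Feasible srv ν P ξ Z ∧
          (∀ m, ∃ c : ℝ≥0∞, c ≠ ⊤ ∧
            Tendsto (fun N : ℕ => StatusUpdate.meanPeakAge srv ν P ξ Z m N) atTop (𝓝 c)) ∧
          ∀ (ξ' : StatusUpdate.Scheduler Ω M) (Z' : StatusUpdate.Sampler Ω),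
            StatusUpdate.Feasible srv ν P ξ' Z' →
              StatusUpdate.avgPAoI srv ν P w ξ Z ≤ StatusUpdate.avgPAoI srv ν P w ξ' Z') ∧
    (⨅ (ξ : StatusUpdate.Scheduler Ω M) (Z : StatusUpdate.Sampler Ω)
        (_ : StatusUpdate.Feasible srv ν P ξ Z), StatusUpdate.avgPAoI srv ν P w ξ Z) =
      ⨅ f ∈ stdSimplex ℝ (Fin M), ⨅ (ξ : StatusUpdate.Scheduler Ω M)
        (_ : StatusUpdate.IsRandomScheduler ν P f ξ) (Z : StatusUpdate.Sampler Ω)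
        (_ : StatusUpdate.Feasible srv ν P ξ Z), StatusUpdate.avgPAoI srv ν P w ξ Z := by
  have h := StatusUpdate.exists_optimal_frequency hν hT hC hw hw1 srv
  refine ⟨h, le_antisymm ?_ ?_⟩
  · exact le_iInf₂ fun f _ => le_iInf₂ fun ξ _ => le_iInf₂ fun Z hZ =>
      iInf_le_of_le ξ (iInf₂_le Z hZ)
  · obtain ⟨f, hf, ⟨ξ, hξ⟩, hopt⟩ := h
    obtain ⟨Z, hZ, -, hle⟩ := hopt ξ hξ
    refine le_iInf fun ξ' => le_iInf₂ fun Z' hZ' => le_trans ?_ (hle ξ' Z' hZ')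
    exact iInf₂_le_of_le f hf (iInf₂_le_of_le ξ hξ (iInf₂_le Z hZ))
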